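/- For all integers $k\ge 1$ there are a program for the randomized Word RAM and a constant $C$, both depending only on $k$, such that the following holds for every word length $d\ge 1$. Let $p=a/b\in(0,1)$ be a rational number whose numerator $a$ and denominator $b$ are positive integers fitting in $k$ words of $d$ bits, and let $n$ be a positive integer fitting in $k$ words. On input $(a,b,n)$ the program halts with probability one, and its output is distributed exactly according to the truncated geometric distribution $\text{T-Geo}(p,n)$, i.e. $$\Pr[\text{output}=i]=\frac{p(1-p)^{i-1}}{1-(1-p)^n}\qquad (i\in\{1,\dots,n\});$$ its expected running time is at most $C$ (that is, $O(1)$), and in the worst case, over all outcomes of the random words, it uses at most $C\,n$ words of space (that is, $O(n)$). Here, in the Word RAM model with $d$-bit words, each of the following takes one unit of time: access to a memory cell (one word) through an address of $O(1)$ words, addition, subtraction, multiplication, division with rounding, comparison and bit operations on words, and the generation of a uniformly random $d$-bit word. -/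

import Mathlib

open scoped ENNReal

/-! Randomized programs on the `d`-bit Word RAM. A program is a fixed finite text that does not
depend on the word length `d`; it is run for every `d`. -/

namespace WordRAM

/-- Unary one-word operations: bitwise complement, index of the highest nonzero bit, index of the
lowest nonzero bit. -/
inductive UnOp where
  | compl | highBit | lowBit

/-- Binary one-word operations. The product of two words is a two-word number; `mulLo` and `mulHi`
return its low and its high word. -/
inductive BinOp where
  | add | sub | mulLo | mulHi | div | and | or | xor | shl | shr

/-- Comparisons of the contents of two registers. -/
inductive Test where
  | lt (x y : ℕ)
  | eq (x y : ℕ)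

/-- Elementary instructions. Registers are numbered by `ℕ`, and a program mentions only finitely
many of them. An address is a fixed list of registers, read as a number in base `2 ^ d`, least
significant word first; so in a given program every address consists of `O(1)` words. -/
inductive Instr where
  /-- Write the constant `v` (modulo `2 ^ d`) to a register. -/
  | const (dst : ℕ) (v : ℕ)
  | move (dst src : ℕ)
  | un (op : UnOp) (dst x : ℕ)
  | bin (op : BinOp) (dst x y : ℕ)
  /-- Read the memory cell with the given address into a register. -/
  | load (dst : ℕ) (addr : List ℕ)
  /-- Write a register to the memory cell with the given address. -/
  | store (addr : List ℕ) (src : ℕ)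
  /-- Write a fresh uniformly random word to a register. -/
  | rand (dst : ℕ)

/-- Programs: elementary instructions, composition, branching and while-loops. -/
inductive Cmd where
  | skip
  | instr (i : Instr)
  | seq (P Q : Cmd)
  | ite (t : Test) (P Q : Cmd)
  | loop (t : Test) (P : Cmd)

/-- The registers in a comparison. -/
def Test.registers : Test → Finset ℕ
  | .lt x y => {x, y}
  | .eq x y => {x, y}

/-- The registers in an instruction. -/
def Instr.registers : Instr → Finset ℕ
  | .const dst _ => {dst}
  | .move dst src => {dst, src}
  | .un _ dst x => {dst, x}
  | .bin _ dst x y => {dst, x, y}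
  | .load dst addr => insert dst addr.toFinset
  | .store addr src => insert src addr.toFinset
  | .rand dst => {dst}

/-- The registers in a program. -/
def Cmd.registers : Cmd → Finset ℕ
  | .skip => ∅
  | .instr i => i.registers
  | .seq P Q => P.registers ∪ Q.registers
  | .ite t P Q => t.registers ∪ (P.registers ∪ Q.registers)
  | .loop t P => t.registers ∪ P.registers

/-- A configuration: what remains to be executed (a stack whose entries are subprograms of the
program), the registers, and the memory. -/
structure Config (d : ℕ) where
  todo : List Cmd
  regs : ℕ → BitVec d
  mem : ℕ → BitVec d

/-- The value of a unary operation (`highBit` of `0` is `0`, `lowBit` of `0` is `d`). -/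
def UnOp.eval {d : ℕ} : UnOp → BitVec d → BitVec d
  | .compl, x => ~~~x
  | .highBit, x => BitVec.ofNat d (Nat.log2 x.toNat)
  | .lowBit, x => x.ctz

/-- The value of a binary operation. Addition, subtraction and multiplication are modulo `2 ^ d`,
division is rounded down (division by `0` gives `0`), and shifts fill up with zeros. -/
def BinOp.eval {d : ℕ} : BinOp → BitVec d → BitVec d → BitVec d
  | .add, x, y => x + y
  | .sub, x, y => x - y
  | .mulLo, x, y => x * y
  | .mulHi, x, y => BitVec.ofNat d (x.toNat * y.toNat / 2 ^ d)
  | .div, x, y => x / y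
  | .and, x, y => x &&& y
  | .or, x, y => x ||| y
  | .xor, x, y => x ^^^ y
  | .shl, x, y => x <<< y
  | .shr, x, y => x >>> y

/-- The outcome of a comparison of words as natural numbers. -/
def Test.eval {d : ℕ} (r : ℕ → BitVec d) : Test → Bool
  | .lt x y => decide ((r x).toNat < (r y).toNat)
  | .eq x y => decide (r x = r y)

/-- The natural number written in base `2 ^ d` in a list of registers, least significant word
first. -/
def readNat {d : ℕ} (r : ℕ → BitVec d) (l : List ℕ) : ℕ :=
  Nat.ofDigits (2 ^ d) (l.map fun j => (r j).toNat)

noncomputable section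

/-- The law of a uniformly random word. -/
def randomWord (d : ℕ) : PMF (BitVec d) :=
  (PMF.uniformOfFintype (Fin (2 ^ d))).map BitVec.ofFin

/-- The effect of an instruction on registers and memory. -/
def Instr.exec {d : ℕ} (i : Instr) (r m : ℕ → BitVec d) :
    PMF ((ℕ → BitVec d) × (ℕ → BitVec d)) :=
  match i with
  | .const dst v => PMF.pure (Function.update r dst (BitVec.ofNat d v), m)
  | .move dst src => PMF.pure (Function.update r dst (r src), m)
  | .un op dst x => PMF.pure (Function.update r dst (op.eval (r x)), m)
  | .bin op dst x y => PMF.pure (Function.update r dst (op.eval (r x) (r y)), m)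
  | .load dst addr => PMF.pure (Function.update r dst (m (readNat r addr)), m)
  | .store addr src => PMF.pure (r, Function.update m (readNat r addr) (r src))
  | .rand dst => (randomWord d).map fun w => (Function.update r dst w, m)

/-- One step of the machine, which takes one unit of time. A configuration with nothing left to
execute is halted and does not change any more. -/
def Config.step {d : ℕ} (c : Config d) : PMF (Config d) :=
  match c.todo with
  | [] => PMF.pure c
  | .skip :: K => PMF.pure ⟨K, c.regs, c.mem⟩
  | .instr i :: K => (i.exec c.regs c.mem).map fun s => ⟨K, s.1, s.2⟩
  | .seq P Q :: K => PMF.pure ⟨P :: Q :: K, c.regs, c.mem⟩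
  | .ite t P Q :: K => PMF.pure ⟨(if t.eval c.regs then P else Q) :: K, c.regs, c.mem⟩
  | .loop t P :: K =>
      PMF.pure ⟨if t.eval c.regs then P :: .loop t P :: K else K, c.regs, c.mem⟩

/-- The law of the configuration after `t` steps from `c`. -/
def Config.after {d : ℕ} : ℕ → Config d → PMF (Config d)
  | 0, c => PMF.pure c
  | t + 1, c => c.step.bind (Config.after t)

/-- Nothing is left to execute. -/
def Config.Halted {d : ℕ} (c : Config d) : Prop := c.todo = []

/-- The expected number of steps until the machine halts: the sum over all `t` of the probability
that step `t + 1` has to be executed, i.e. that the machine has not halted after `t` steps (`∞` if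
it fails to halt with positive probability). -/
def Config.expectedTime {d : ℕ} (c : Config d) : ℝ≥0∞ :=
  ∑' t : ℕ, (c.after t).toOuterMeasure {c' | ¬ c'.Halted}

/-- The number of the first cells of memory that have to be present for the next step: `A + 1` if
it accesses the cell with address `A`, and `0` if it does not access memory. -/
def Config.cells {d : ℕ} (c : Config d) : ℕ :=
  match c.todo with
  | .instr (.load _ addr) :: _ => readNat c.regs addr + 1
  | .instr (.store addr _) :: _ => readNat c.regs addr + 1
  | _ => 0

/-- The number of memory cells used from `c` on, in the worst case over all outcomes of the random
words and at any time: the least `s` such that only addresses below `s` are ever accessed. -/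
def Config.memorySpace {d : ℕ} (c : Config d) : ℕ∞ :=
  ⨆ (t : ℕ) (c' ∈ (c.after t).support), (c'.cells : ℕ∞)

/-- The probability that the machine started in `c` halts with the number `v` in the
registers `0, …, k - 1`. -/
def Config.outputProb {d : ℕ} (k : ℕ) (c : Config d) (v : ℕ) : ℝ≥0∞ :=
  ⨆ t : ℕ, (c.after t).toOuterMeasure {c' | c'.Halted ∧ readNat c'.regs (List.range k) = v}

/-- The word with index `j` (from the least significant one) of a natural number. -/
def wordOf (d a j : ℕ) : BitVec d := BitVec.ofNat d (a / 2 ^ (d * j))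

/-- The initial configuration of `P` on the input of three `k`-word numbers `a`, `b`, `n`: they are
in the registers `0, …, k - 1`, `k, …, 2 k - 1` and `2 k, …, 3 k - 1`; all else is `0`. -/
def Cmd.start (P : Cmd) (d k a b n : ℕ) : Config d where
  todo := [P]
  regs j :=
    if j < k then wordOf d a j
    else if j < 2 * k then wordOf d b (j - k)
    else if j < 3 * k then wordOf d n (j - 2 * k)
    else 0
  mem _ := 0

/-- The mass function of the truncated geometric distribution `T-Geo(p, n)` on `{1, …, n}`. -/
def truncGeoMass (p : ℝ) (n i : ℕ) : ℝ :=
  if 1 ≤ i ∧ i ≤ n then p * (1 - p) ^ (i - 1) / (1 - (1 - p) ^ n) else 0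

end

end WordRAM

/-!
For `q = 1 - p`, the law `T-Geo(p, n)` is that of `G % n + 1`, where `G ≥ 0` has the law
`P(G = g) = p * q ^ g`. A power of two `m` of order `1 / p` with `m * p ≤ 1` is computed from the
highest bits of `a` and `b`. If `m < n`, then `G` is generated in blocks of length `m`: a
uniformly random proposal `R < m` is accepted with probability `m * p * q ^ R`, so that each `r`
below `m` is the accepted proposal with probability `p * q ^ r`, and with the remaining
probability `q ^ m` the base `β`, which the accepted proposal is added to, moves on by `m`; all
this modulo `n` (`meanValue_eq_add`). If `n ≤ m`, a proposal below a power of two between `n` and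
`2 * n` is accepted with probability `q ^ R` if it is less than `n`, and the round is repeated
otherwise. In both cases a round succeeds with probability at least `1 / 8` (`Params.round_time`).

Exact random decisions take `O(1)` expected time. A decision with probability `x / y` compares the
digits of `x / y` in base two, found by doubling and subtraction, with random bits until they
differ (`coin`). A decision with probability `q ^ r`, where `r * p ≤ 1`, uses the expansion
`q ^ r = ∑ i, (-p) ^ i * (r.choose i)`: the trials with success probabilities
`(r - j) * p / (j + 1)`, `j = 0, 1, …`, all succeed up to the `i`-th with probability
`p ^ i * (r.choose i)`, and the parity of the number of successes has the right law (`powCoin`,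
`choose_mul_realAltSum`). Each trial is a conjunction of decisions with rational probabilities
whose numerators and denominators fit in `k + 2` words, so that no products have to be computed.

The analysis needs only upper bounds. `Bound` is a calculus of upper bounds for the expectation of
`τ` times the running time plus a nonnegative function `v` of the result, in which loops are
treated by an invariant that does not grow in expectation (`bound_loop`). It yields that this
expectation is at most `τ * C + ∑ i, P(T-Geo(p, n) = i) * v i`, for all `τ` and `v`
(`cost_sampler_le`). With `v = 0` this bounds the expected time, so the program halts almost
surely. With `τ = 0` and the indicators of a point and of its complement it bounds the output
probabilities from above, and since these bounds add up to one, they are attained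
(`outputProb_eq_of_cost_le`).

The program keeps all numbers in a fixed number of registers and does not access memory, so it
uses `O(1)` words of space.
-/

namespace WordRAM

section

/-! ### Expected cost of a run -/

section Expectation

variable {α β : Type*}

theorem tsum_pure_mul (a : α) (g : α → ℝ≥0∞) : ∑' x, PMF.pure a x * g x = g a := by
  rw [tsum_eq_single a]
  · simp
  · intro b hb
    simp [hb]

theorem tsum_bind_mul (p : PMF α) (h : α → PMF β) (g : β → ℝ≥0∞) :
    ∑' x, p.bind h x * g x = ∑' y, p y * ∑' x, h y x * g x := by
  simp only [PMF.bind_apply, ← ENNReal.tsum_mul_right, ← ENNReal.tsum_mul_left, mul_assoc]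
  exact ENNReal.tsum_comm

theorem tsum_map_mul (p : PMF α) (h : α → β) (g : β → ℝ≥0∞) :
    ∑' x, p.map h x * g x = ∑' y, p y * g (h y) := by
  rw [← PMF.bind_pure_comp, tsum_bind_mul]
  simp

theorem toOuterMeasure_eq_tsum (p : PMF α) (s : Set α) [DecidablePred (· ∈ s)] :
    p.toOuterMeasure s = ∑' x, p x * if x ∈ s then 1 else 0 := by
  rw [PMF.toOuterMeasure_apply]
  refine tsum_congr fun x => ?_
  by_cases h : x ∈ s <;> simp [h]

end Expectation

variable {d : ℕ}

/-- The expectation, for the machine started in the given configuration and watched for `t` steps,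
of `τ` times the number of steps executed plus, if the machine has halted, the value of `f` at its
registers. Taking `τ = 1`, `f = 0` measures time, taking `τ = 0` measures the output. -/
noncomputable def cost (τ : ℝ≥0∞) (f : (ℕ → BitVec d) → ℝ≥0∞) : ℕ → Config d → ℝ≥0∞
  | 0, c => if c.todo = [] then f c.regs else 0
  | t + 1, c => if c.todo = [] then f c.regs else τ + ∑' c', c.step c' * cost τ f t c'

theorem cost_nil (τ : ℝ≥0∞) (f : (ℕ → BitVec d) → ℝ≥0∞) (t : ℕ) (r m : ℕ → BitVec d) :
    cost τ f t ⟨[], r, m⟩ = f r := by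
  cases t <;> simp [cost]

theorem cost_cons (τ : ℝ≥0∞) (f : (ℕ → BitVec d) → ℝ≥0∞) (t : ℕ) (P : Cmd) (K : List Cmd)
    (r m : ℕ → BitVec d) :
    cost τ f (t + 1) ⟨P :: K, r, m⟩ =
      τ + ∑' c', (Config.step ⟨P :: K, r, m⟩) c' * cost τ f t c' := by
  simp [cost]

theorem cost_eq (τ : ℝ≥0∞) (f : (ℕ → BitVec d) → ℝ≥0∞) (t : ℕ) (c : Config d) :
    cost τ f t c =
      (∑ u ∈ Finset.range t, τ * (c.after u).toOuterMeasure {c' | ¬ c'.Halted}) +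
        ∑' c', c.after t c' * if c'.todo = [] then f c'.regs else 0 := by
  classical
  induction t generalizing c with
  | zero => rw [Config.after, tsum_pure_mul]; simp [cost]
  | succ t ih =>
    obtain ⟨todo, r, m⟩ := c
    cases todo with
    | nil =>
      have hstep : Config.step (⟨[], r, m⟩ : Config d) = PMF.pure ⟨[], r, m⟩ := rfl
      have hafter : ∀ u, Config.after u (⟨[], r, m⟩ : Config d) = PMF.pure ⟨[], r, m⟩ := by
        intro u
        induction u with
        | zero => rfl
        | succ u ihu => simp [Config.after, hstep, ihu]
      rw [hafter, tsum_pure_mul]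
      simp [hafter, cost_nil, Config.Halted]
    | cons P K =>
      rw [cost_cons, Finset.sum_range_succ']
      simp only [Config.after, toOuterMeasure_eq_tsum, tsum_bind_mul]
      simp only [tsum_pure_mul]
      simp only [ih, mul_add, ENNReal.tsum_add, toOuterMeasure_eq_tsum]
      simp only [Config.Halted, Set.mem_ofPred_eq, reduceCtorEq, not_false_eq_true, if_true,
        Finset.mul_sum, mul_one]
      rw [Summable.tsum_finsetSum (fun _ _ => ENNReal.summable)]
      rw [add_comm τ, add_right_comm]
      congr 3
      funext u
      rw [← ENNReal.tsum_mul_left]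
      exact tsum_congr fun x => by ring

/-! ### A calculus of upper bounds -/

/-- `Bound τ P f r x`: the expectation of `τ` times the running time of `P`, started with registers
`r`, plus `f` of the registers at the end, is at most `x`. The definition is in continuation-passing
style and counts only the first `t` steps, for every `t`: whatever follows `P` and has cost at most
`f`, running `P` before it has cost at most `x`. -/
def Bound (τ : ℝ≥0∞) (P : Cmd) (f : (ℕ → BitVec d) → ℝ≥0∞) (r : ℕ → BitVec d) (x : ℝ≥0∞) :
    Prop :=
  ∀ (f₀ : (ℕ → BitVec d) → ℝ≥0∞) (K : List Cmd) (t : ℕ) (m : ℕ → BitVec d),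
    (∀ t' ≤ t, ∀ r' m', cost τ f₀ t' ⟨K, r', m'⟩ ≤ f r') → cost τ f₀ t ⟨P :: K, r, m⟩ ≤ x

variable {τ : ℝ≥0∞} {P Q : Cmd} {f g : (ℕ → BitVec d) → ℝ≥0∞} {r : ℕ → BitVec d} {x y : ℝ≥0∞}

theorem Bound.mono (h : Bound τ P g r x) (hfg : ∀ r', f r' ≤ g r') (hxy : x ≤ y) :
    Bound τ P f r y :=
  fun f₀ K t m hK => (h f₀ K t m fun t' ht' r' m' => (hK t' ht' r' m').trans (hfg r')).trans hxy

theorem bound_skip : Bound τ .skip f r (τ + f r) := by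
  intro f₀ K t m hK
  cases t with
  | zero => simp [cost]
  | succ t =>
    rw [cost_cons]
    simp only [Config.step, tsum_pure_mul]
    exact add_le_add_right (hK t t.le_succ _ _) _

theorem bound_instr (i : Instr) (hx : ∀ m, τ + ∑' s, i.exec r m s * f s.1 ≤ x) :
    Bound τ (.instr i) f r x := by
  intro f₀ K t m hK
  cases t with
  | zero => simp [cost]
  | succ t =>
    rw [cost_cons]
    simp only [Config.step, tsum_map_mul]
    refine le_trans ?_ (hx m)
    gcongr with s
    exact hK t t.le_succ _ _

theorem bound_seq (hP : Bound τ P g r x) (hQ : ∀ r', Bound τ Q f r' (g r')) :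
    Bound τ (.seq P Q) f r (τ + x) := by
  intro f₀ K t m hK
  cases t with
  | zero => simp [cost]
  | succ t =>
    rw [cost_cons]
    simp only [Config.step, tsum_pure_mul]
    gcongr
    refine hP f₀ (Q :: K) t m fun t' ht' r' m' => hQ r' f₀ K t' m' fun t'' ht'' => hK t'' ?_
    omega

theorem bound_ite {c : Test} (h : Bound τ (if c.eval r then P else Q) f r x) :
    Bound τ (.ite c P Q) f r (τ + x) := by
  intro f₀ K t m hK
  cases t with
  | zero => simp [cost]
  | succ t =>
    rw [cost_cons]
    simp only [Config.step, tsum_pure_mul]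
    gcongr
    exact h f₀ K t m fun t' ht' => hK t' (by omega)

/-- Upper bounds for loops by Park induction: it suffices that `I` does not grow in expectation. -/
theorem bound_loop {c : Test} (I : (ℕ → BitVec d) → ℝ≥0∞)
    (htrue : ∀ r, c.eval r = true → ∃ y, Bound τ P I r y ∧ τ + y ≤ I r)
    (hfalse : ∀ r, c.eval r = false → τ + f r ≤ I r) (r : ℕ → BitVec d) :
    Bound τ (.loop c P) f r (I r) := by
  intro f₀ K t m hK
  induction t using Nat.strong_induction_on generalizing r m with
  | _ t ih =>
    cases t with
    | zero => simp [cost]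
    | succ t =>
      rw [cost_cons]
      simp only [Config.step, tsum_pure_mul]
      cases hc : c.eval r with
      | true =>
        obtain ⟨y, hy, hyI⟩ := htrue r hc
        refine le_trans ?_ hyI
        simp only [if_true]
        gcongr
        refine hy f₀ _ t m fun t' ht' r' m' => ?_
        exact ih t' (by omega) r' m' fun t'' ht'' => hK t'' (by omega)
      | false =>
        refine le_trans ?_ (hfalse r hc)
        simp only [Bool.false_eq_true, if_false]
        gcongr
        exact hK t t.le_succ _ _

theorem bound_rand (dst : ℕ) :
    Bound τ (.instr (.rand dst)) f r (τ +
      (∑ w ∈ Finset.range (2 ^ d), f (Function.update r dst (BitVec.ofNat d w))) / 2 ^ d) := by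
  refine bound_instr _ fun m => le_of_eq ?_
  simp only [Instr.exec, randomWord, tsum_map_mul]
  congr 1
  rw [tsum_fintype, ← Fin.sum_univ_eq_sum_range
    (fun w => f (Function.update r dst (BitVec.ofNat d w))), div_eq_mul_inv, Finset.sum_mul]
  refine Finset.sum_congr rfl fun w _ => ?_
  simp only [PMF.uniformOfFintype_apply, Fintype.card_fin, Nat.cast_pow, Nat.cast_ofNat]
  rw [mul_comm]
  congr 3
  apply BitVec.eq_of_toNat_eq
  simp

/-! ### Deterministic code without loops -/

/-- The registers after a deterministic instruction that does not use memory (other instructions do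
nothing here). -/
def Instr.det : Instr → (ℕ → BitVec d) → (ℕ → BitVec d)
  | .const dst v, r => Function.update r dst (BitVec.ofNat d v)
  | .move dst src, r => Function.update r dst (r src)
  | .un op dst x, r => Function.update r dst (op.eval (r x))
  | .bin op dst x y, r => Function.update r dst (op.eval (r x) (r y))
  | _, r => r

/-- The registers after a program that consists of skips, such instructions, composition and
branching. -/
def Cmd.det : Cmd → (ℕ → BitVec d) → (ℕ → BitVec d)
  | .instr i, r => i.det r
  | .seq P Q, r => Q.det (P.det r)
  | .ite t P Q, r => if t.eval r then P.det r else Q.det r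
  | _, r => r

/-- The program uses neither random words nor memory nor loops. -/
def Cmd.Simple : Cmd → Prop
  | .skip => True
  | .instr (.load _ _) => False
  | .instr (.store _ _) => False
  | .instr (.rand _) => False
  | .instr _ => True
  | .seq P Q => P.Simple ∧ Q.Simple
  | .ite _ P Q => P.Simple ∧ Q.Simple
  | .loop _ _ => False

/-- The number of nodes of a program, which bounds its running time if there are no loops. -/
def Cmd.size : Cmd → ℕ
  | .skip => 1
  | .instr _ => 1
  | .seq P Q => P.size + Q.size + 1
  | .ite _ P Q => P.size + Q.size + 1
  | .loop _ P => P.size + 1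

theorem bound_det {P : Cmd} (hP : P.Simple) (f : (ℕ → BitVec d) → ℝ≥0∞) (r : ℕ → BitVec d) :
    Bound τ P f r (τ * P.size + f (P.det r)) := by
  induction P generalizing f r with
  | skip => simpa [Cmd.size, Cmd.det] using bound_skip
  | instr i =>
    refine bound_instr _ fun m => ?_
    cases i <;> simp_all [Cmd.size, Cmd.det, Instr.det, Instr.exec, Cmd.Simple]
  | seq P Q ihP ihQ =>
    refine (bound_seq (ihP hP.1 _ r) fun r' => ihQ hP.2 f r').mono (fun _ => le_rfl) ?_
    simp only [Cmd.size, Cmd.det]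
    push_cast
    apply le_of_eq; ring
  | ite t P Q ihP ihQ =>
    cases ht : t.eval r with
    | true =>
      refine (bound_ite (c := t) (P := P) (Q := Q) (x := τ * P.size + f (P.det r)) ?_).mono
        (fun _ => le_rfl) ?_
      · simpa [ht] using ihP hP.1 f r
      · simp only [Cmd.size, Cmd.det, ht, if_true]
        push_cast
        calc _ = τ * (P.size + 0 + 1) + f (P.det r) := by ring
          _ ≤ _ := by gcongr; simp
    | false =>
      refine (bound_ite (c := t) (P := P) (Q := Q) (x := τ * Q.size + f (Q.det r)) ?_).mono
        (fun _ => le_rfl) ?_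
      · simpa [ht] using ihQ hP.2 f r
      · simp only [Cmd.size, Cmd.det, ht, Bool.false_eq_true, if_false]
        push_cast
        calc _ = τ * (0 + Q.size + 1) + f (Q.det r) := by ring
          _ ≤ _ := by gcongr; simp
  | loop t P ih => exact hP.elim

end

section

/-! ### Multiword numbers -/

section Val

variable {d : ℕ}

/-- The number written in base `2 ^ d` in `len` consecutive registers from `x` on, least significant
word first. -/
def val (s : ℕ → BitVec d) : ℕ → ℕ → ℕ
  | _, 0 => 0
  | x, len + 1 => (s x).toNat + 2 ^ d * val s (x + 1) len

theorem val_congr {s s' : ℕ → BitVec d} {x x' len : ℕ} (h : ∀ i < len, s (x + i) = s' (x' + i)) :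
    val s x len = val s' x' len := by
  induction len generalizing x x' with
  | zero => rfl
  | succ len ih =>
    rw [val, val, ih (x := x + 1) (x' := x' + 1), ← Nat.add_zero x, h 0 (by omega)]
    · simp
    · intro i hi
      have := h (i + 1) (by omega)
      rwa [add_right_comm, add_right_comm x', add_assoc, add_assoc]

theorem val_succ_last (s : ℕ → BitVec d) (x len : ℕ) :
    val s x (len + 1) = val s x len + 2 ^ (d * len) * (s (x + len)).toNat := by
  induction len generalizing x with
  | zero => simp [val]
  | succ len ih =>
    rw [val, ih (x + 1), val, show x + 1 + len = x + (len + 1) by ring]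
    ring

theorem val_lt (s : ℕ → BitVec d) (x len : ℕ) : val s x len < 2 ^ (d * len) := by
  induction len generalizing x with
  | zero => simp [val]
  | succ len ih =>
    rw [val]
    have h1 := ih (x + 1)
    have h2 := (s x).isLt
    have h3 : 2 ^ (d * (len + 1)) = 2 ^ d * 2 ^ (d * len) := by ring
    rw [h3]
    calc (s x).toNat + 2 ^ d * val s (x + 1) len < 2 ^ d * (val s (x + 1) len + 1) := by
          rw [Nat.mul_succ]; omega
      _ ≤ _ := Nat.mul_le_mul_left _ h1

theorem val_eq_zero {s : ℕ → BitVec d} {x len : ℕ} (h : ∀ i < len, s (x + i) = 0) :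
    val s x len = 0 := by
  induction len generalizing x with
  | zero => rfl
  | succ len ih =>
    have h0 := h 0 (by omega)
    rw [add_zero] at h0
    rw [val, ih fun i hi => by rw [add_right_comm]; exact h (i + 1) (by omega), h0]
    simp

theorem val_mod (s : ℕ → BitVec d) (x len : ℕ) : val s x (len + 1) % 2 ^ d = (s x).toNat := by
  rw [val, Nat.add_mul_mod_self_left, Nat.mod_eq_of_lt (s x).isLt]

end Val

/-! ### Layout of the registers -/

/-- The register that holds word `j` of the multiword variable `v`. Every variable has `k + 2`
words; two more than the input numbers leave room for carries. -/
def reg (k v j : ℕ) : ℕ := 3 * k + 8 + v * (k + 2) + j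

/-- The scratch registers of multiword operations lie between the input and the variables. -/
def scratch (k i : ℕ) : ℕ := 3 * k + i

/-- The values of all variables. The variable `0` is the flag set by subtractions, `1` and `2` are
the constants zero and one, and `3`, `4`, `5` are the input `a`, `b`, `n`. The variables `6`, `7`,
`8` are `S`, `T` and the block length `m = S / T`, where `m * a / b = (S / b) * (a / T)`; `9` is
the mask for proposals, and `10` tells whether `m < n`. The base is `11`, the proposal `12`, the
result `13`, and `14` tells whether the rejection loop goes on. The variables from `15` on are
local: `15` to `18` to `powCoin`, `19` to `21` to `coin`, and `22` to additions and comparisons.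
-/
def env (k : ℕ) {d : ℕ} (s : ℕ → BitVec d) (v : ℕ) : ℕ := val s (reg k v 0) (k + 2)

section Layout

variable {k v w i j : ℕ}

theorem reg_add : reg k v 0 + j = reg k v j := by simp [reg]

theorem reg_inj (hi : i < k + 2) (hj : j < k + 2) : reg k v i = reg k w j ↔ v = w ∧ i = j := by
  constructor
  · intro h
    have h' : (k + 2) * v + i = (k + 2) * w + j := by
      unfold reg at h
      rw [mul_comm _ v, mul_comm _ w]
      omega
    have h1 := congrArg (· / (k + 2)) h'
    have h2 := congrArg (· % (k + 2)) h'
    simp only [Nat.mul_add_div (Nat.succ_pos (k + 1)), Nat.mul_add_mod, Nat.div_eq_of_lt hi,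
      Nat.div_eq_of_lt hj, Nat.mod_eq_of_lt hi, Nat.mod_eq_of_lt hj] at h1 h2
    exact ⟨by simpa using h1, h2⟩
  · rintro ⟨rfl, rfl⟩; rfl

theorem reg_inj_left : reg k v i = reg k v j ↔ i = j := by simp [reg]

theorem reg_ne_scratch (hi : i < 8) : reg k v j ≠ scratch k i := by unfold reg scratch; omega

theorem scratch_ne_reg (hi : i < 8) : scratch k i ≠ reg k v j := by unfold reg scratch; omega

theorem scratch_inj : scratch k i = scratch k j ↔ i = j := by simp [scratch]

theorem reg_ge : 3 * k + 8 ≤ reg k v j := by unfold reg; omega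

variable {d : ℕ} {s s' : ℕ → BitVec d}

theorem env_lt (s : ℕ → BitVec d) (v : ℕ) : env k s v < 2 ^ (d * (k + 2)) := val_lt _ _ _

theorem env_congr (h : ∀ j < k + 2, s (reg k v j) = s' (reg k v j)) : env k s v = env k s' v :=
  val_congr fun j hj => by rw [reg_add]; exact h j hj

theorem env_mod (s : ℕ → BitVec d) (v : ℕ) : env k s v % 2 ^ d = (s (reg k v 0)).toNat :=
  val_mod _ _ _

theorem env_eq_update (h : ∀ w ≠ v, ∀ j < k + 2, s' (reg k w j) = s (reg k w j)) :
    env k s' = Function.update (env k s) v (env k s' v) := by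
  funext w
  by_cases hw : w = v
  · subst hw; simp
  · rw [Function.update_of_ne hw]
    exact env_congr (h w hw)

end Layout

/-! ### Multiword operations -/

/-- The commands `body 0, …, body (n - 1)` one after another. -/
def forUp (body : ℕ → Cmd) : ℕ → Cmd
  | 0 => .skip
  | n + 1 => .seq (forUp body n) (body n)

/-- The commands `body (n - 1), …, body 0` one after another. -/
def forDown (body : ℕ → Cmd) : ℕ → Cmd
  | 0 => .skip
  | n + 1 => .seq (body n) (forDown body n)

theorem forUp_simple {body : ℕ → Cmd} (h : ∀ j, (body j).Simple) (n : ℕ) :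
    (forUp body n).Simple := by
  induction n with
  | zero => trivial
  | succ n ih => exact ⟨ih, h n⟩

theorem forDown_simple {body : ℕ → Cmd} (h : ∀ j, (body j).Simple) (n : ℕ) :
    (forDown body n).Simple := by
  induction n with
  | zero => trivial
  | succ n ih => exact ⟨h n, ih⟩

/-- One word of a subtraction; the scratch register `0` holds the borrow before and after it. -/
def subWord (k z v w j : ℕ) : Cmd :=
  .seq (.instr (.bin .sub (scratch k 1) (reg k v j) (reg k w j)))
  (.seq (.ite (.lt (reg k v j) (reg k w j))
    (.instr (.const (scratch k 2) 1)) (.instr (.const (scratch k 2) 0)))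
  (.seq (.ite (.lt (scratch k 1) (scratch k 0)) (.instr (.const (scratch k 2) 1)) .skip)
  (.seq (.instr (.bin .sub (reg k z j) (scratch k 1) (scratch k 0)))
    (.instr (.move (scratch k 0) (scratch k 2))))))

/-- Set the variable `0` to the value of the scratch register `0`. -/
def setFlag (k : ℕ) : Cmd :=
  .seq (forUp (fun j => .instr (.const (reg k 0 (j + 1)) 0)) (k + 1))
    (.instr (.move (reg k 0 0) (scratch k 0)))

/-- `z := v - w` modulo the range of variables; the variable `0` becomes `1` if `v < w`, and `0`
otherwise. -/
def sub (k z v w : ℕ) : Cmd :=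
  .seq (.instr (.const (scratch k 0) 0)) (.seq (forUp (subWord k z v w) (k + 2)) (setFlag k))

/-- `z := z &&& w`. -/
def and (k z w : ℕ) : Cmd :=
  forUp (fun j => .instr (.bin .and (reg k z j) (reg k z j) (reg k w j))) (k + 2)

/-- `z` becomes the greatest power of two that is at most `v`. From the highest word down, the first
nonzero word of `v` gives the bit; the scratch register `0` tells whether it has been found. -/
def topPow (k z v : ℕ) : Cmd :=
  .seq (.instr (.const (scratch k 0) 0))
  (.seq (.instr (.const (scratch k 3) 0))
  (.seq (.instr (.const (scratch k 4) 1))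
  (forDown (fun j =>
    .ite (.eq (scratch k 0) (scratch k 3))
      (.ite (.eq (reg k v j) (scratch k 3))
        (.instr (.const (reg k z j) 0))
        (.seq (.instr (.un .highBit (scratch k 1) (reg k v j)))
        (.seq (.instr (.bin .shl (reg k z j) (scratch k 4) (scratch k 1)))
          (.instr (.const (scratch k 0) 1)))))
      (.instr (.const (reg k z j) 0))) (k + 2))))

/-- Shift `z` to the right by the number of zero bits at the end of the lowest word of `t`. The word
length `d`, needed for the bits that move to the next word, is obtained as the index of the lowest
nonzero bit of the word `0`. -/
def shr (k z t : ℕ) : Cmd :=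
  .seq (.instr (.un .lowBit (scratch k 1) (reg k t 0)))
  (.seq (.instr (.const (scratch k 3) 0))
  (.seq (.instr (.un .lowBit (scratch k 2) (scratch k 3)))
  (.seq (.instr (.bin .sub (scratch k 2) (scratch k 2) (scratch k 1)))
  (.seq (forUp (fun j =>
    .seq (.instr (.bin .shr (scratch k 4) (reg k z j) (scratch k 1)))
    (.seq (.instr (.bin .shl (scratch k 5) (reg k z (j + 1)) (scratch k 2)))
    (.instr (.bin .add (reg k z j) (scratch k 4) (scratch k 5))))) (k + 1))
  (.instr (.bin .shr (reg k z (k + 1)) (reg k z (k + 1)) (scratch k 1)))))))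

theorem sub_simple (k z v w : ℕ) : (sub k z v w).Simple := by
  refine ⟨trivial, forUp_simple (fun j => ?_) _, forUp_simple (fun j => ?_) _, trivial⟩ <;>
    simp [subWord, Cmd.Simple]

theorem and_simple (k z w : ℕ) : (and k z w).Simple :=
  forUp_simple (fun j => by simp [Cmd.Simple]) _

theorem topPow_simple (k z v : ℕ) : (topPow k z v).Simple := by
  refine ⟨trivial, trivial, trivial, forDown_simple (fun j => ?_) _⟩
  simp [Cmd.Simple]

theorem shr_simple (k z t : ℕ) : (shr k z t).Simple := by
  refine ⟨trivial, trivial, trivial, trivial, forUp_simple (fun j => ?_) _, trivial⟩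
  simp [Cmd.Simple]

section Spec

variable {d k z v w t : ℕ}

theorem subWord_det (j : ℕ) (s : ℕ → BitVec d) :
    (subWord k z v w j).det s =
      let a := s (reg k v j)
      let b := s (reg k w j)
      let c := s (scratch k 0)
      let u : BitVec d := if (a - b).toNat < c.toNat then BitVec.ofNat d 1
        else if a.toNat < b.toNat then BitVec.ofNat d 1 else BitVec.ofNat d 0
      fun x => if x = scratch k 0 then u else if x = reg k z j then a - b - c
        else if x = scratch k 2 then u else if x = scratch k 1 then a - b else s x := by
  set s₁ := Function.update s (scratch k 1) (s (reg k v j) - s (reg k w j)) with hs₁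
  have r₁ : ∀ u, s₁ (reg k u j) = s (reg k u j) := fun u =>
    Function.update_of_ne (reg_ne_scratch (by norm_num)) _ _
  set s₂ := Function.update s₁ (scratch k 2) (if (s (reg k v j)).toNat < (s (reg k w j)).toNat then
    BitVec.ofNat d 1 else BitVec.ofNat d 0) with hs₂
  have e₂ : (Cmd.ite (.lt (reg k v j) (reg k w j))
      (.instr (.const (scratch k 2) 1)) (.instr (.const (scratch k 2) 0))).det s₁ = s₂ := by
    simp only [Cmd.det, Instr.det, Test.eval, decide_eq_true_eq, r₁, hs₂]
    split_ifs <;> rfl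
  have a₂ : s₂ (scratch k 1) = s (reg k v j) - s (reg k w j) := by
    simp [hs₂, hs₁, scratch_inj]
  have c₂ : s₂ (scratch k 0) = s (scratch k 0) := by
    simp [hs₂, hs₁, scratch_inj]
  set s₃ := Function.update s₂ (scratch k 2)
    (if (s (reg k v j) - s (reg k w j)).toNat < (s (scratch k 0)).toNat then BitVec.ofNat d 1
      else s₂ (scratch k 2)) with hs₃
  have e₃ : (Cmd.ite (.lt (scratch k 1) (scratch k 0))
      (.instr (.const (scratch k 2) 1)) .skip).det s₂ = s₃ := by
    simp only [Cmd.det, Instr.det, Test.eval, decide_eq_true_eq, a₂, c₂, hs₃]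
    split_ifs
    · rfl
    · simp
  have hdet : (subWord k z v w j).det s =
      (Cmd.seq (.instr (.bin .sub (reg k z j) (scratch k 1) (scratch k 0)))
        (.instr (.move (scratch k 0) (scratch k 2)))).det s₃ := by
    rw [← e₃, ← e₂, hs₁]
    rfl
  rw [hdet]
  funext x
  simp only [Cmd.det, Instr.det, BinOp.eval]
  have a₃ : s₃ (scratch k 1) = s (reg k v j) - s (reg k w j) := by
    simp only [hs₃, Function.update_apply, scratch_inj, a₂]
    simp
  have c₃ : s₃ (scratch k 0) = s (scratch k 0) := by
    simp only [hs₃, Function.update_apply, scratch_inj, c₂]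
    simp
  rw [a₃, c₃]
  simp only [Function.update_apply, scratch_ne_reg (show 2 < 8 by norm_num), if_false, hs₃, if_true,
    hs₂, hs₁]
  grind

theorem subWord_spec (hd : 1 ≤ d) (j : ℕ) (s : ℕ → BitVec d) (hc : (s (scratch k 0)).toNat ≤ 1) :
    ((subWord k z v w j).det s (scratch k 0)).toNat ≤ 1 ∧
    ((subWord k z v w j).det s (reg k z j)).toNat + (s (reg k w j)).toNat
        + (s (scratch k 0)).toNat =
      (s (reg k v j)).toNat + 2 ^ d * ((subWord k z v w j).det s (scratch k 0)).toNat ∧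
    ∀ x, (∀ i < 8, x ≠ scratch k i) → x ≠ reg k z j → (subWord k z v w j).det s x = s x := by
  have h2 : 2 ≤ 2 ^ d := by
    calc 2 = 2 ^ 1 := rfl
      _ ≤ 2 ^ d := Nat.pow_le_pow_right (by norm_num) hd
  have hone : (BitVec.ofNat d 1).toNat = 1 := by
    rw [BitVec.toNat_ofNat, Nat.mod_eq_of_lt h2]
  have hzero : (BitVec.ofNat d 0).toNat = 0 := by simp
  rw [subWord_det]
  dsimp only
  rw [if_pos rfl, if_neg (reg_ne_scratch (by norm_num)), if_pos rfl]
  generalize s (reg k v j) = a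
  generalize s (reg k w j) = b
  generalize s (scratch k 0) = c at *
  have hsub : ∀ x y : BitVec d, (x - y).toNat = if x.toNat < y.toNat then x.toNat + 2 ^ d - y.toNat
      else x.toNat - y.toNat := by
    intro x y
    have hx := x.isLt
    have hy := y.isLt
    rw [BitVec.toNat_sub]
    split_ifs with h
    · rw [Nat.mod_eq_of_lt (by omega)]; omega
    · rw [show 2 ^ d - y.toNat + x.toNat = x.toNat - y.toNat + 2 ^ d by omega,
        Nat.add_mod_right, Nat.mod_eq_of_lt (by omega)]
  have ha := a.isLt
  have hb := b.isLt
  rw [hsub (a - b) c, hsub a b]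
  refine ⟨?_, ?_, ?_⟩
  · split_ifs <;> omega
  · by_cases h1 : a.toNat < b.toNat
    · simp only [h1, if_true]
      split_ifs <;> simp only [hone] <;> omega
    · simp only [h1, if_false]
      split_ifs <;> simp only [hone, hzero] <;> omega
  · intro x hx hz
    rw [if_neg (hx 0 (by norm_num)), if_neg hz, if_neg (hx 2 (by norm_num)),
      if_neg (hx 1 (by norm_num))]

theorem setFlag_spec (s : ℕ → BitVec d) :
    env k ((setFlag k).det s) = Function.update (env k s) 0 (s (scratch k 0)).toNat := by
  have key : ∀ n ≤ k + 1, ∀ x,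
      (forUp (fun j => .instr (.const (reg k 0 (j + 1)) 0)) n).det s x =
        if ∃ j < n, x = reg k 0 (j + 1) then 0 else s x := by
    intro n hn x
    induction n with
    | zero => simp [forUp, Cmd.det]
    | succ n ih =>
      simp only [forUp, Cmd.det, Instr.det, Function.update_apply, ih (by omega)]
      by_cases hx : x = reg k 0 (n + 1)
      · simp only [hx, if_true]
        rw [if_pos ⟨n, by omega, rfl⟩]
        rfl
      · rw [if_neg hx]
        congr 1
        apply propext
        constructor
        · rintro ⟨j, hj, h⟩; exact ⟨j, by omega, h⟩
        · rintro ⟨j, hj, h⟩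
          rcases Nat.lt_succ_iff_lt_or_eq.mp hj with h' | rfl
          · exact ⟨j, h', h⟩
          · exact absurd h hx
  have hs : ∀ x, (setFlag k).det s x = if x = reg k 0 0 then s (scratch k 0) else
      if ∃ j < k + 1, x = reg k 0 (j + 1) then 0 else s x := by
    intro x
    simp only [setFlag, Cmd.det, Instr.det, Function.update_apply, key (k + 1) le_rfl,
      scratch_ne_reg (show 0 < 8 by norm_num), and_false, exists_false, if_false]
  rw [env_eq_update (s := s) (v := 0)]
  · congr 1
    rw [env, val, hs, if_pos rfl, val_eq_zero]
    · simp
    · intro i hi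
      rw [add_assoc, add_comm 1 i, reg_add, hs, if_neg, if_pos ⟨i, hi, rfl⟩]
      simp [reg_inj_left]
  · intro w hw j hj
    rw [hs, if_neg, if_neg]
    · rintro ⟨i, hi, h⟩
      exact hw ((reg_inj hj (by omega)).mp h).1
    · intro h
      exact hw ((reg_inj hj (by omega)).mp h).1

theorem env_sub (hd : 1 ≤ d) (s : ℕ → BitVec d) :
    env k ((sub k z v w).det s) = Function.update (Function.update (env k s) z
      (if env k s v < env k s w then env k s v + 2 ^ (d * (k + 2)) - env k s w
        else env k s v - env k s w)) 0 (if env k s v < env k s w then 1 else 0) := by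
  set s₀ : ℕ → BitVec d := Function.update s (scratch k 0) 0 with hs₀
  have hreg : ∀ u j, s₀ (reg k u j) = s (reg k u j) := fun u j => by
    rw [hs₀, Function.update_of_ne (reg_ne_scratch (by norm_num))]
  have key : ∀ n ≤ k + 2,
      ((forUp (subWord k z v w) n).det s₀ (scratch k 0)).toNat ≤ 1 ∧
      val ((forUp (subWord k z v w) n).det s₀) (reg k z 0) n + val s (reg k w 0) n =
        val s (reg k v 0) n
          + 2 ^ (d * n) * ((forUp (subWord k z v w) n).det s₀ (scratch k 0)).toNat ∧
      ∀ x, (∀ i < 8, x ≠ scratch k i) → (∀ j < n, x ≠ reg k z j) →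
        (forUp (subWord k z v w) n).det s₀ x = s x := by
    intro n hn
    induction n with
    | zero =>
      refine ⟨by simp [forUp, Cmd.det, hs₀], by simp [forUp, Cmd.det, hs₀, val], ?_⟩
      intro x hx _
      simp [forUp, Cmd.det, hs₀, hx 0]
    | succ n ih =>
      obtain ⟨h1, h2, h3⟩ := ih (by omega)
      set s' := (forUp (subWord k z v w) n).det s₀ with hs'
      have hdet : (forUp (subWord k z v w) (n + 1)).det s₀ = (subWord k z v w n).det s' := rfl
      obtain ⟨g1, g2, g3⟩ := subWord_spec (z := z) (v := v) (w := w) hd n s' h1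
      have hun : ∀ u, s' (reg k u n) = s (reg k u n) := by
        intro u
        refine h3 _ (fun i hi => reg_ne_scratch hi) fun j hj h => ?_
        have := ((reg_inj (by omega) (by omega)).mp h).2
        omega
      rw [hun, hun] at g2
      rw [hdet]
      refine ⟨g1, ?_, ?_⟩
      · rw [val_succ_last, val_succ_last, val_succ_last, reg_add, reg_add, reg_add]
        have hlow : val ((subWord k z v w n).det s') (reg k z 0) n = val s' (reg k z 0) n := by
          refine val_congr fun i hi => ?_
          rw [reg_add]
          refine g3 _ (fun i hi => reg_ne_scratch hi) fun h => ?_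
          have := reg_inj_left.mp h
          omega
        rw [hlow, Nat.mul_succ d n, pow_add]
        linear_combination h2 + 2 ^ (d * n) * g2
      · intro x hx hz'
        rw [g3 x hx (hz' n (by omega)), h3 x hx fun j hj => hz' j (by omega)]
  obtain ⟨h1, h2, h3⟩ := key (k + 2) le_rfl
  have hdet : (sub k z v w).det s =
      (setFlag k).det ((forUp (subWord k z v w) (k + 2)).det s₀) := rfl
  rw [hdet, setFlag_spec]
  set s' := (forUp (subWord k z v w) (k + 2)).det s₀
  have hz1 : env k s' z < 2 ^ (d * (k + 2)) := env_lt _ _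
  have hv1 : env k s v < 2 ^ (d * (k + 2)) := env_lt _ _
  have hw1 : env k s w < 2 ^ (d * (k + 2)) := env_lt _ _
  change env k s' z + env k s w = env k s v + _ at h2
  generalize (s' (scratch k 0)).toNat = c at *
  rw [env_eq_update (s := s) (s' := s') (v := z)]
  · interval_cases c
    · rw [if_neg (by omega), if_neg (by omega), show env k s' z = env k s v - env k s w by omega]
    · rw [if_pos (by omega), if_pos (by omega),
        show env k s' z = env k s v + 2 ^ (d * (k + 2)) - env k s w by omega]
  · intro u hu j hj
    refine h3 _ (fun i hi => reg_ne_scratch hi) fun i hi h => ?_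
    exact hu ((reg_inj hj hi).mp h).1

theorem add_two_pow_mul_land {x y : ℕ} (hx : x < 2 ^ d) (hy : y < 2 ^ d) (X Y : ℕ) :
    (x + 2 ^ d * X) &&& (y + 2 ^ d * Y) = (x &&& y) + 2 ^ d * (X &&& Y) := by
  apply Nat.eq_of_testBit_eq
  intro i
  rw [Nat.testBit_and, add_comm x, add_comm y, add_comm (x &&& y),
    Nat.testBit_two_pow_mul_add _ hx, Nat.testBit_two_pow_mul_add _ hy,
    Nat.testBit_two_pow_mul_add _ (Nat.and_lt_two_pow _ hy)]
  split_ifs <;> simp [Nat.testBit_and]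

theorem val_land {s s' : ℕ → BitVec d} {x y len : ℕ}
    (h : ∀ i < len, s' (x + i) = s (x + i) &&& s (y + i)) :
    val s' x len = val s x len &&& val s y len := by
  induction len generalizing x y with
  | zero => simp [val]
  | succ len ih =>
    have h0 := h 0 (by omega)
    simp only [add_zero] at h0
    rw [val, val, val, ih (x := x + 1) (y := y + 1), h0, BitVec.toNat_and,
      add_two_pow_mul_land (s x).isLt (s y).isLt]
    intro i hi
    rw [add_right_comm, add_right_comm y]
    exact h (i + 1) (by omega)

theorem env_and (hzw : z ≠ w) {e : ℕ} (s : ℕ → BitVec d) (hw : env k s w + 1 = 2 ^ e) :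
    env k ((and k z w).det s) = Function.update (env k s) z (env k s z % 2 ^ e) := by
  have key : ∀ n ≤ k + 2, ∀ u, ∀ j < k + 2,
      (forUp (fun j => .instr (.bin .and (reg k z j) (reg k z j) (reg k w j))) n).det s
        (reg k u j) = if u = z ∧ j < n then s (reg k z j) &&& s (reg k w j) else s (reg k u j) := by
    intro n hn u j hj
    induction n generalizing u j with
    | zero => simp [forUp, Cmd.det]
    | succ n ih =>
      simp only [forUp, Cmd.det, Instr.det, Function.update_apply, BinOp.eval]
      rw [ih (by omega) z n (by omega), ih (by omega) w n (by omega), ih (by omega) u j hj]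
      simp only [reg_inj hj (show n < k + 2 by omega), lt_irrefl, and_false, if_false]
      by_cases hu : u = z
      · subst hu
        rcases lt_trichotomy j n with h | h | h
        · simp [h, h.ne, Nat.lt_succ_of_lt h]
        · subst h; simp
        · simp [h.ne', h.not_gt, show ¬ j < n + 1 by omega]
      · simp [hu]
  rw [env_eq_update (s := s) (v := z)]
  · congr 1
    rw [env, val_land (s := s) (y := reg k w 0)]
    · change env k s z &&& env k s w = _
      rw [show env k s w = 2 ^ e - 1 by omega, Nat.and_two_pow_sub_one_eq_mod]
    · intro i hi
      rw [reg_add, reg_add, and, key _ le_rfl z i hi]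
      simp [hi]
  · intro u hu j hj
    rw [and, key _ le_rfl u j hj]
    simp [hu]

end Spec

end

section

section Spec

variable {d k z v w t : ℕ}

theorem two_le_two_pow (hd : 1 ≤ d) : 2 ≤ 2 ^ d := by
  calc 2 = 2 ^ 1 := rfl
    _ ≤ 2 ^ d := Nat.pow_le_pow_right (by norm_num) hd

theorem env_topPow (hd : 1 ≤ d) (hzv : z ≠ v) (s : ℕ → BitVec d) (hv : env k s v ≠ 0) :
    env k ((topPow k z v).det s) = Function.update (env k s) z (2 ^ Nat.log2 (env k s v)) := by
  have h2 := two_le_two_pow hd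
  have hne : (BitVec.ofNat d 1) ≠ BitVec.ofNat d 0 := by
    intro h
    have := congrArg BitVec.toNat h
    simp [Nat.mod_eq_of_lt h2] at this
  obtain ⟨body, hbody⟩ : ∃ body : ℕ → Cmd, body = fun j =>
    Cmd.ite (.eq (scratch k 0) (scratch k 3))
      (.ite (.eq (reg k v j) (scratch k 3))
        (.instr (.const (reg k z j) 0))
        (.seq (.instr (.un .highBit (scratch k 1) (reg k v j)))
        (.seq (.instr (.bin .shl (reg k z j) (scratch k 4) (scratch k 1)))
          (.instr (.const (scratch k 0) 1)))))
      (.instr (.const (reg k z j) 0)) := ⟨_, rfl⟩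
  -- The words from index `n` on have been processed.
  let Inv : ℕ → (ℕ → BitVec d) → Prop := fun n s' =>
    s' (scratch k 3) = BitVec.ofNat d 0 ∧ s' (scratch k 4) = BitVec.ofNat d 1 ∧
    (∀ u ≠ z, ∀ j < k + 2, s' (reg k u j) = s (reg k u j)) ∧
    ((s' (scratch k 0) = BitVec.ofNat d 0 ∧ val s (reg k v n) (k + 2 - n) = 0 ∧
        val s' (reg k z n) (k + 2 - n) = 0) ∨
      (s' (scratch k 0) = BitVec.ofNat d 1 ∧ ∃ e, val s' (reg k z n) (k + 2 - n) = 2 ^ e ∧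
        2 ^ e ≤ val s (reg k v n) (k + 2 - n) ∧ val s (reg k v n) (k + 2 - n) < 2 ^ (e + 1)))
  have step : ∀ n < k + 2, ∀ s', Inv (n + 1) s' → Inv n ((body n).det s') := by
    rintro n hn s' ⟨h3, h4, hu, hcase⟩
    have hlen : k + 2 - n = (k + 2 - (n + 1)) + 1 := by omega
    have hvn : s' (reg k v n) = s (reg k v n) := hu v hzv.symm n hn
    have hregs : ∀ u, reg k u n + 1 = reg k u (n + 1) := fun u => rfl
    have htop : ∀ s'' : ℕ → BitVec d, (∀ j, n < j → s'' (reg k z j) = s' (reg k z j)) →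
        val s'' (reg k z n) (k + 2 - n) =
          (s'' (reg k z n)).toNat + 2 ^ d * val s' (reg k z (n + 1)) (k + 2 - (n + 1)) := by
      intro s'' h
      rw [hlen, val, hregs]
      congr 2
      refine val_congr fun i hi => ?_
      have := h (n + 1 + i) (by omega)
      rwa [show reg k z (n + 1 + i) = reg k z (n + 1) + i from by simp [reg]; ring] at this
    have hvtop : val s (reg k v n) (k + 2 - n) =
        (s (reg k v n)).toNat + 2 ^ d * val s (reg k v (n + 1)) (k + 2 - (n + 1)) := by
      rw [hlen, val, hregs]
    have hzn : ∀ j, n < j → reg k z j ≠ reg k z n := by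
      intro j hj h
      have := reg_inj_left.mp h
      omega
    rcases hcase with ⟨h0, hH, hZ⟩ | ⟨h0, e, hZ, hH1, hH2⟩
    · by_cases hw : s (reg k v n) = BitVec.ofNat d 0
      · have hdet : (body n).det s' = Function.update s' (reg k z n) (BitVec.ofNat d 0) := by
          simp only [hbody, Cmd.det, Instr.det, Test.eval, h0, h3, hvn, hw, decide_true, if_true]
        rw [hdet]
        refine ⟨?_, ?_, ?_, Or.inl ⟨?_, ?_, ?_⟩⟩
        · rw [Function.update_of_ne (scratch_ne_reg (by norm_num)), h3]
        · rw [Function.update_of_ne (scratch_ne_reg (by norm_num)), h4]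
        · intro u huz j hj
          rw [Function.update_of_ne, hu u huz j hj]
          exact fun h => huz ((reg_inj hj hn).mp h).1
        · rw [Function.update_of_ne (scratch_ne_reg (by norm_num)), h0]
        · rw [hvtop, hH, hw]; simp
        · rw [htop, hZ]
          · simp
          · intro j hj
            rw [Function.update_of_ne (hzn j hj)]
      · have hdet : (body n).det s' = Function.update (Function.update (Function.update s'
            (scratch k 1) (BitVec.ofNat d (Nat.log2 (s (reg k v n)).toNat))) (reg k z n)
            (BitVec.ofNat d 1 <<< BitVec.ofNat d (Nat.log2 (s (reg k v n)).toNat)))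
            (scratch k 0) (BitVec.ofNat d 1) := by
          simp only [hbody, Cmd.det, Instr.det, Test.eval, h0, h3, hvn, hw, decide_true, if_true,
            decide_false, Bool.false_eq_true, if_false, UnOp.eval, BinOp.eval,
            Function.update_self]
          rw [Function.update_of_ne (by simp [scratch_inj]), h4]
        have hw0 : (s (reg k v n)).toNat ≠ 0 := by
          intro h
          exact hw (BitVec.eq_of_toNat_eq (by simpa using h))
        have hlog : Nat.log2 (s (reg k v n)).toNat < d := (Nat.log2_lt hw0).mpr (s (reg k v n)).isLt
        rw [hdet]
        refine ⟨?_, ?_, ?_, Or.inr ⟨?_, Nat.log2 (s (reg k v n)).toNat, ?_, ?_, ?_⟩⟩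
        · simp [scratch_inj, scratch_ne_reg, h3]
        · simp [scratch_inj, scratch_ne_reg, h4]
        · intro u huz j hj
          rw [Function.update_of_ne (reg_ne_scratch (by norm_num)), Function.update_of_ne,
            Function.update_of_ne (reg_ne_scratch (by norm_num)), hu u huz j hj]
          exact fun h => huz ((reg_inj hj hn).mp h).1
        · simp
        · rw [htop, hZ, Function.update_of_ne (reg_ne_scratch (by norm_num)),
            Function.update_self]
          · have h5 : Nat.log2 (s (reg k v n)).toNat < 2 ^ d := hlog.trans Nat.lt_two_pow_self
            rw [BitVec.shiftLeft_eq', BitVec.toNat_shiftLeft, BitVec.toNat_ofNat,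
              BitVec.toNat_ofNat, Nat.mod_eq_of_lt h2, Nat.mod_eq_of_lt h5, Nat.shiftLeft_eq,
              one_mul, Nat.mod_eq_of_lt (Nat.pow_lt_pow_right (by norm_num) hlog)]
            simp
          · intro j hj
            rw [Function.update_of_ne (reg_ne_scratch (by norm_num)),
              Function.update_of_ne (hzn j hj),
              Function.update_of_ne (reg_ne_scratch (by norm_num))]
        · rw [hvtop, hH]
          exact Nat.log2_self_le hw0
        · rw [hvtop, hH]
          exact Nat.lt_log2_self
    · have hdet : (body n).det s' = Function.update s' (reg k z n) (BitVec.ofNat d 0) := by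
        simp only [hbody, Cmd.det, Instr.det, Test.eval, h0, h3, hne, decide_false,
          Bool.false_eq_true, if_false]
      rw [hdet]
      refine ⟨?_, ?_, ?_, Or.inr ⟨?_, e + d, ?_, ?_, ?_⟩⟩
      · rw [Function.update_of_ne (scratch_ne_reg (by norm_num)), h3]
      · rw [Function.update_of_ne (scratch_ne_reg (by norm_num)), h4]
      · intro u huz j hj
        rw [Function.update_of_ne, hu u huz j hj]
        exact fun h => huz ((reg_inj hj hn).mp h).1
      · rw [Function.update_of_ne (scratch_ne_reg (by norm_num)), h0]
      · rw [htop, hZ]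
        · simp [pow_add, mul_comm]
        · intro j hj
          rw [Function.update_of_ne (hzn j hj)]
      · rw [hvtop, pow_add, mul_comm]
        exact le_add_left (Nat.mul_le_mul_left _ hH1)
      · rw [hvtop, show e + d + 1 = d + (e + 1) by ring, pow_add]
        have := (s (reg k v n)).isLt
        calc _ < 2 ^ d * (val s (reg k v (n + 1)) (k + 2 - (n + 1)) + 1) := by
              rw [Nat.mul_succ]; omega
          _ ≤ _ := Nat.mul_le_mul_left _ hH2
  have all : ∀ n ≤ k + 2, ∀ s', Inv n s' → Inv 0 ((forDown body n).det s') := by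
    intro n
    induction n with
    | zero => intro _ s' h; exact h
    | succ n ih => intro hn s' h; exact ih (by omega) _ (step n (by omega) s' h)
  have hfin := all (k + 2) le_rfl (Function.update (Function.update (Function.update s
    (scratch k 0) (BitVec.ofNat d 0)) (scratch k 3) (BitVec.ofNat d 0)) (scratch k 4)
    (BitVec.ofNat d 1)) (by
      refine ⟨?_, ?_, ?_, Or.inl ⟨?_, ?_, ?_⟩⟩
      · simp [scratch_inj]
      · simp
      · intro u _ j _
        simp [reg_ne_scratch]
      · simp [scratch_inj]
      · simp [val]
      · simp [val])
  have hdet : (topPow k z v).det s = (forDown body (k + 2)).det (Function.update (Function.update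
    (Function.update s (scratch k 0) (BitVec.ofNat d 0)) (scratch k 3) (BitVec.ofNat d 0))
    (scratch k 4) (BitVec.ofNat d 1)) := by rw [hbody]; rfl
  rw [hdet]
  obtain ⟨-, -, hu, hcase⟩ := hfin
  rw [env_eq_update hu]
  congr 1
  rcases hcase with ⟨-, h, -⟩ | ⟨-, e, h1, h2, h3⟩
  · exact absurd h hv
  · change env k _ z = _ at h1
    change _ ≤ env k s v at h2
    change env k s v < _ at h3
    rw [h1, (Nat.log2_eq_iff hv).mpr ⟨h2, h3⟩]

theorem toNat_ctz {x : BitVec d} (hx : x.toNat = 2 ^ t % 2 ^ d) : x.ctz.toNat = min t d := by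
  rcases lt_or_ge t d with h | h
  · rw [min_eq_left h.le]
    rw [Nat.mod_eq_of_lt (Nat.pow_lt_pow_right (by norm_num) h)] at hx
    have hx0 : x ≠ 0#d := by
      rintro rfl
      exact (pow_pos (by norm_num : 0 < 2) t).ne hx
    have := BitVec.getLsbD_true_ctz_of_ne_zero hx0
    rw [← BitVec.testBit_toNat, hx, Nat.testBit_two_pow] at this
    exact (of_decide_eq_true this).symm
  · rw [min_eq_right h]
    have hx0 : x = 0#d := by
      apply BitVec.eq_of_toNat_eq
      rw [hx, Nat.mod_eq_zero_of_dvd (pow_dvd_pow 2 h)]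
      simp
    have : x.ctz = (d : BitVec d) := by
      rw [BitVec.ctz_eq_reverse_clz, BitVec.clz_eq_iff_eq_zero, hx0]
      simp
    rw [this]
    simp

theorem val_shr {s s' : ℕ → BitVec d} {x len h : ℕ} (hh : h ≤ d)
    (hs : ∀ i < len, (s' (x + i)).toNat = ((s (x + i)).toNat / 2 ^ h
        + if i + 1 < len then (s (x + (i + 1))).toNat * 2 ^ (d - h) % 2 ^ d else 0) % 2 ^ d) :
    val s' x len = val s x len / 2 ^ h := by
  induction len generalizing x with
  | zero => simp [val]
  | succ len ih =>
    rw [val, val, ih]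
    · have h0 := hs 0 (by omega)
      simp only [add_zero, zero_add] at h0
      rw [h0]
      have hq : 2 ^ d = 2 ^ h * 2 ^ (d - h) := by rw [← pow_add]; congr 1; omega
      have hlow : (s x).toNat / 2 ^ h < 2 ^ (d - h) := by
        rw [Nat.div_lt_iff_lt_mul (by positivity), mul_comm, ← hq]
        exact (s x).isLt
      have hnext : (if 1 < len + 1 then (s (x + 1)).toNat * 2 ^ (d - h) % 2 ^ d else 0) =
          2 ^ (d - h) * (val s (x + 1) len % 2 ^ h) := by
        cases len with
        | zero => simp [val]
        | succ n =>
          rw [if_pos (by omega), hq, Nat.mul_mod_mul_right, mul_comm]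
          congr 1
          rw [val, hq, mul_assoc, Nat.add_mul_mod_self_left]
      rw [hnext]
      set V := val s (x + 1) len
      have hV : V % 2 ^ h + 2 ^ h * (V / 2 ^ h) = V := Nat.mod_add_div V _
      have hVlt : V % 2 ^ h < 2 ^ h := Nat.mod_lt _ (by positivity)
      rw [Nat.mod_eq_of_lt]
      · have : (s x).toNat + 2 ^ d * V = (s x).toNat + 2 ^ h * (2 ^ (d - h) * V) := by
          rw [hq]; ring
        rw [this, Nat.add_mul_div_left _ _ (by positivity)]
        conv_rhs => rw [← hV]
        rw [hq]; ring
      · calc _ < 2 ^ (d - h) + 2 ^ (d - h) * (V % 2 ^ h) := by omega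
          _ = 2 ^ (d - h) * (V % 2 ^ h + 1) := by ring
          _ ≤ 2 ^ (d - h) * 2 ^ h := Nat.mul_le_mul_left _ hVlt
          _ = 2 ^ d := by rw [hq, mul_comm]
    · intro i hi
      have := hs (i + 1) (by omega)
      rw [show x + 1 + i = x + (i + 1) by ring, show x + 1 + (i + 1) = x + (i + 1 + 1) by ring]
      simpa using this

theorem env_shr (s : ℕ → BitVec d) (ht : env k s t = 2 ^ w) :
    env k ((shr k z t).det s) = Function.update (env k s) z (env k s z / 2 ^ min w d) := by
  obtain ⟨body, hbody⟩ : ∃ body : ℕ → Cmd, body = fun j =>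
    Cmd.seq (.instr (.bin .shr (scratch k 4) (reg k z j) (scratch k 1)))
    (.seq (.instr (.bin .shl (scratch k 5) (reg k z (j + 1)) (scratch k 2)))
    (.instr (.bin .add (reg k z j) (scratch k 4) (scratch k 5)))) := ⟨_, rfl⟩
  obtain ⟨c, hc⟩ : ∃ c, c = (s (reg k t 0)).ctz := ⟨_, rfl⟩
  obtain ⟨e, he⟩ : ∃ e, e = (0#d).ctz - c := ⟨_, rfl⟩
  have hd0 : (0#d).ctz.toNat = d := by
    rw [toNat_ctz (t := d) (by simp)]; simp
  have hcn : c.toNat = min w d := by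
    rw [hc]
    exact toNat_ctz (by rw [← env_mod, ht])
  have hen : e.toNat = d - min w d := by
    have h1 : min w d ≤ d := min_le_right _ _
    have h2 : d < 2 ^ d := Nat.lt_two_pow_self
    rw [he, BitVec.toNat_sub, hd0, hcn,
      show 2 ^ d - min w d + d = d - min w d + 2 ^ d by omega, Nat.add_mod_right,
      Nat.mod_eq_of_lt (by omega)]
  set s₀ : ℕ → BitVec d := Function.update (Function.update (Function.update (Function.update s
    (scratch k 1) c) (scratch k 3) (BitVec.ofNat d 0)) (scratch k 2) (0#d).ctz) (scratch k 2) e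
    with hs₀
  have hdet : (shr k z t).det s = (Cmd.instr (.bin .shr (reg k z (k + 1)) (reg k z (k + 1))
      (scratch k 1))).det ((forUp body (k + 1)).det s₀) := by
    rw [hbody, hs₀, he, hc]
    simp only [shr, Cmd.det, Instr.det, UnOp.eval, BinOp.eval, Function.update_self]
    rw [Function.update_of_ne (a := scratch k 1) (by simp [scratch_inj]),
      Function.update_of_ne (a := scratch k 1) (by simp [scratch_inj]), Function.update_self]
  have hreg : ∀ u j, s₀ (reg k u j) = s (reg k u j) := fun u j => by
    simp [hs₀, reg_ne_scratch]
  have key : ∀ n ≤ k + 1, (forUp body n).det s₀ (scratch k 1) = c ∧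
      (forUp body n).det s₀ (scratch k 2) = e ∧
      ∀ u, ∀ j < k + 2, (forUp body n).det s₀ (reg k u j) =
        if u = z ∧ j < n then (s (reg k z j) >>> c) + (s (reg k z (j + 1)) <<< e)
          else s (reg k u j) := by
    intro n hn
    induction n with
    | zero =>
      simp only [forUp, Cmd.det, hreg]
      simp [hs₀, scratch_inj]
    | succ n ih =>
      obtain ⟨h1, h2, h3⟩ := ih (by omega)
      have hs' : (forUp body (n + 1)).det s₀ = (body n).det ((forUp body n).det s₀) := rfl
      rw [hs']
      generalize (forUp body n).det s₀ = s' at *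
      have hz0 := h3 z n (by omega)
      have hz1 := h3 z (n + 1) (by omega)
      rw [if_neg (by simp)] at hz0 hz1
      have hb : (body n).det s' = Function.update (Function.update (Function.update s'
          (scratch k 4) (s (reg k z n) >>> c)) (scratch k 5) (s (reg k z (n + 1)) <<< e))
          (reg k z n) ((s (reg k z n) >>> c) + (s (reg k z (n + 1)) <<< e)) := by
        rw [hbody]
        simp only [Cmd.det, Instr.det, BinOp.eval, Function.update_self]
        simp only [Function.update_apply, scratch_inj, reg_ne_scratch (show 4 < 8 by norm_num), h1,
          h2, hz0, hz1]
        simp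
      rw [hb]
      refine ⟨?_, ?_, ?_⟩
      · simp [scratch_inj, scratch_ne_reg, h1]
      · simp [scratch_inj, scratch_ne_reg, h2]
      · intro u j hj
        by_cases hu : u = z ∧ j = n
        · obtain ⟨rfl, rfl⟩ := hu
          simp
        · rw [Function.update_of_ne (fun h => hu ((reg_inj hj (by omega)).mp h)),
            Function.update_of_ne (reg_ne_scratch (by norm_num)),
            Function.update_of_ne (reg_ne_scratch (by norm_num)), h3 u j hj]
          congr 1
          apply propext
          constructor
          · rintro ⟨h, h'⟩; exact ⟨h, by omega⟩
          · rintro ⟨h, h'⟩; exact ⟨h, by have : j ≠ n := fun hh => hu ⟨h, hh⟩; omega⟩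
  obtain ⟨h1, -, h3⟩ := key (k + 1) le_rfl
  rw [hdet]
  simp only [Cmd.det, Instr.det, BinOp.eval, h1]
  rw [env_eq_update (s := s) (v := z)]
  · congr 1
    refine val_shr (min_le_right _ _) fun i hi => ?_
    rw [reg_add, reg_add, ← hen, ← hcn]
    by_cases hik : i = k + 1
    · subst hik
      rw [Function.update_self, h3 z _ (by omega), if_neg (by omega), if_neg (by omega),
        BitVec.ushiftRight_eq', BitVec.toNat_ushiftRight, Nat.shiftRight_eq_div_pow, add_zero,
        Nat.mod_eq_of_lt]
      exact (Nat.div_le_self _ _).trans_lt (s _).isLt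
    · rw [Function.update_of_ne (fun h => hik (reg_inj_left.mp h)), h3 z _ (by omega),
        if_pos ⟨rfl, by omega⟩, if_pos (by omega), BitVec.toNat_add, BitVec.ushiftRight_eq',
        BitVec.toNat_ushiftRight, Nat.shiftRight_eq_div_pow, BitVec.shiftLeft_eq',
        BitVec.toNat_shiftLeft, Nat.shiftLeft_eq]
  · intro u hu j hj
    rw [Function.update_of_ne (fun h => hu ((reg_inj hj (by omega)).mp h).1), h3 u j hj,
      if_neg (by simp [hu])]

end Spec

end

section

/-! ### Random numbers, input and output -/

section Words

variable {d : ℕ}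

theorem toNat_wordOf (y j : ℕ) : (wordOf d y j).toNat = y / 2 ^ (d * j) % 2 ^ d := by
  simp [wordOf]

theorem wordOf_mod (y : ℕ) {j n : ℕ} (h : j < n) : wordOf d (y % 2 ^ (d * n)) j = wordOf d y j := by
  apply BitVec.eq_of_toNat_eq
  obtain ⟨m, rfl⟩ : ∃ m, n = j + (m + 1) := ⟨n - j - 1, by omega⟩
  rw [toNat_wordOf, toNat_wordOf, mul_add, pow_add, Nat.mod_mul_right_div_self, mul_add, mul_one,
    Nat.mod_mod_of_dvd _ (pow_dvd_pow 2 (Nat.le_add_left _ _))]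

theorem wordOf_of_lt {y j : ℕ} (h : y < 2 ^ (d * j)) : wordOf d y j = 0 := by
  simp [wordOf, Nat.div_eq_of_lt h]

theorem val_wordOf {s : ℕ → BitVec d} {x y len : ℕ} (h : ∀ i < len, s (x + i) = wordOf d y i) :
    val s x len = y % 2 ^ (d * len) := by
  induction len with
  | zero => simp [val, Nat.mod_one]
  | succ len ih =>
    rw [val_succ_last, ih fun i hi => h i (by omega), h len (by omega), toNat_wordOf, mul_add,
      mul_one, pow_add, Nat.mod_mul]

/-- Replace `n` consecutive registers from `x` on by the lowest `n` words of `y`. -/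
def setWords (s : ℕ → BitVec d) (x y : ℕ) : ℕ → (ℕ → BitVec d)
  | 0 => s
  | n + 1 => Function.update (setWords s x y n) (x + n) (wordOf d y n)

theorem setWords_mod (s : ℕ → BitVec d) (x y : ℕ) {n m : ℕ} (h : n ≤ m) :
    setWords s x (y % 2 ^ (d * m)) n = setWords s x y n := by
  induction n with
  | zero => rfl
  | succ n ih => rw [setWords, setWords, ih (by omega), wordOf_mod _ (by omega)]

theorem setWords_of_ne (s : ℕ → BitVec d) (x y n i : ℕ) (h : ∀ j < n, i ≠ x + j) :
    setWords s x y n i = s i := by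
  induction n with
  | zero => rfl
  | succ n ih =>
    rw [setWords, Function.update_of_ne (h n (by omega)), ih fun j hj => h j (by omega)]

theorem setWords_apply (s : ℕ → BitVec d) (x y : ℕ) {n i : ℕ} (h : i < n) :
    setWords s x y n (x + i) = wordOf d y i := by
  induction n with
  | zero => omega
  | succ n ih =>
    rw [setWords]
    by_cases hi : i = n
    · subst hi; simp
    · rw [Function.update_of_ne (by omega), ih (by omega)]

theorem sum_range_mul {M : Type*} [AddCommMonoid M] (f : ℕ → M) (A B : ℕ) :
    ∑ x ∈ Finset.range (A * B), f x =
      ∑ y ∈ Finset.range A, ∑ w ∈ Finset.range B, f (y + A * w) := by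
  induction B with
  | zero => simp
  | succ B ih =>
    rw [Nat.mul_succ, Finset.sum_range_add, ih, ← Finset.sum_add_distrib]
    refine Finset.sum_congr rfl fun y _ => ?_
    rw [Finset.sum_range_succ, add_comm y]

theorem two_pow_ne_zero' (n : ℕ) : (2 : ℝ≥0∞) ^ n ≠ 0 := pow_ne_zero _ (by norm_num)

theorem two_pow_ne_top' (n : ℕ) : (2 : ℝ≥0∞) ^ n ≠ ∞ := ENNReal.pow_ne_top (by norm_num)

theorem bound_randWords (τ : ℝ≥0∞) (x n : ℕ) (f : (ℕ → BitVec d) → ℝ≥0∞) (s : ℕ → BitVec d) :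
    Bound τ (forUp (fun j => .instr (.rand (x + j))) n) f s
      (τ * (2 * n + 1) +
        (∑ y ∈ Finset.range (2 ^ (d * n)), f (setWords s x y n)) / 2 ^ (d * n)) := by
  induction n generalizing f with
  | zero =>
    refine bound_skip.mono (fun _ => le_rfl) ?_
    simp [setWords]
  | succ n ih =>
    refine (bound_seq (ih _) fun r => bound_rand (x + n)).mono (fun _ => le_rfl) (le_of_eq ?_)
    have hset : ∀ y ∈ Finset.range (2 ^ (d * n)), ∀ w,
        Function.update (setWords s x y n) (x + n) (BitVec.ofNat d w) =
          setWords s x (y + 2 ^ (d * n) * w) (n + 1) := by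
      intro y hy w
      have hy' := Finset.mem_range.mp hy
      rw [setWords, ← setWords_mod s x (y + 2 ^ (d * n) * w) le_rfl, Nat.add_mul_mod_self_left,
        Nat.mod_eq_of_lt hy', wordOf, Nat.add_mul_div_left _ _ (by positivity),
        Nat.div_eq_of_lt hy', zero_add]
    have hsum : ∑ y ∈ Finset.range (2 ^ (d * n)), (τ + (∑ w ∈ Finset.range (2 ^ d),
        f (Function.update (setWords s x y n) (x + n) (BitVec.ofNat d w))) / 2 ^ d) =
        2 ^ (d * n) * τ + (∑ y ∈ Finset.range (2 ^ (d * (n + 1))),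
          f (setWords s x y (n + 1))) / 2 ^ d := by
      rw [Finset.sum_add_distrib, Finset.sum_const, Finset.card_range, nsmul_eq_mul,
        mul_add d, mul_one, pow_add, sum_range_mul]
      simp only [div_eq_mul_inv, ← Finset.sum_mul]
      congr 2
      · push_cast; rfl
      · exact Finset.sum_congr rfl fun y hy => Finset.sum_congr rfl fun w _ => by rw [hset y hy]
    rw [hsum, ENNReal.add_div, mul_comm _ τ, ENNReal.mul_div_cancel_right (two_pow_ne_zero' _)
      (two_pow_ne_top' _), mul_add d, mul_one, pow_add (2 : ℝ≥0∞), ENNReal.div_eq_inv_mul,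
      ENNReal.div_eq_inv_mul, ENNReal.div_eq_inv_mul, ENNReal.mul_inv
        (Or.inl (two_pow_ne_zero' _)) (Or.inl (two_pow_ne_top' _))]
    push_cast
    ring

end Words

/-- `z` becomes a random number, masked by `w`. -/
def randMask (k z w : ℕ) : Cmd :=
  .seq (forUp (fun j => .instr (.rand (reg k z 0 + j))) (k + 2)) (and k z w)

/-- Read an input number of `k` words from the registers from `x` on into the variable `v`. -/
def loadVar (k v x : ℕ) : Cmd := forUp (fun j => .instr (.move (reg k v j) (x + j))) k

/-- Read the input into the variables `3`, `4`, `5` and set the variable `2` to `1`. -/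
def input (k : ℕ) : Cmd :=
  .seq (loadVar k 3 0) (.seq (loadVar k 4 k) (.seq (loadVar k 5 (2 * k))
    (.instr (.const (reg k 2 0) 1))))

/-- Write the variable `v` to the output registers. -/
def output (k v : ℕ) : Cmd := forUp (fun j => .instr (.move j (reg k v j))) k

theorem input_simple (k : ℕ) : (input k).Simple := by
  refine ⟨?_, ?_, ?_, ?_⟩ <;> first | exact forUp_simple (fun j => by simp [Cmd.Simple]) _ | trivial

theorem output_simple (k v : ℕ) : (output k v).Simple :=
  forUp_simple (fun j => by simp [Cmd.Simple]) _

section Spec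

variable {k d z v w : ℕ} {τ : ℝ≥0∞}

theorem size_randWords (x n : ℕ) :
    (forUp (fun j => .instr (.rand (x + j))) n).size = 2 * n + 1 := by
  induction n with
  | zero => rfl
  | succ n ih => simp only [forUp, Cmd.size, ih]; ring

theorem bound_randMask (hzw : z ≠ w) (F : (ℕ → ℕ) → ℝ≥0∞) {e : ℕ} (s : ℕ → BitVec d)
    (hw : env k s w + 1 = 2 ^ e) :
    Bound τ (randMask k z w) (fun s => F (env k s)) s (τ * (randMask k z w).size +
      (∑ r ∈ Finset.range (2 ^ e), F (Function.update (env k s) z r)) / 2 ^ e) := by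
  refine (bound_seq (bound_randWords τ _ _ _ s)
    fun r => bound_det (and_simple k z w) _ r).mono (fun _ => le_rfl) (le_of_eq ?_)
  have he : e ≤ d * (k + 2) := by
    have : 2 ^ e ≤ 2 ^ (d * (k + 2)) := hw ▸ env_lt s w
    exact (Nat.pow_le_pow_iff_right (by norm_num)).mp this
  obtain ⟨e', he'⟩ := Nat.exists_eq_add_of_le he
  have hset : ∀ y, F (env k ((and k z w).det (setWords s (reg k z 0) y (k + 2)))) =
      F (Function.update (env k s) z (y % 2 ^ e)) := by
    intro y
    have h1 : env k (setWords s (reg k z 0) y (k + 2)) =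
        Function.update (env k s) z (y % 2 ^ (d * (k + 2))) := by
      rw [env_eq_update (s := s) (v := z)]
      · congr 1
        exact val_wordOf fun i hi => setWords_apply s _ y hi
      · intro u hu j hj
        refine setWords_of_ne _ _ _ _ _ fun i hi h => ?_
        rw [reg_add] at h
        exact hu ((reg_inj hj hi).mp h).1
    rw [env_and hzw (e := e), h1]
    · simp only [Function.update_self, Function.update_idem]
      rw [Nat.mod_mod_of_dvd _ (pow_dvd_pow 2 he)]
    · rw [h1, Function.update_of_ne hzw.symm, hw]
  simp only [hset]
  rw [Finset.sum_add_distrib, Finset.sum_const, Finset.card_range, nsmul_eq_mul,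
    he', pow_add, pow_add, sum_range_mul]
  have hsum : ∀ y ∈ Finset.range (2 ^ e), ∑ w ∈ Finset.range (2 ^ e'),
      F (Function.update (env k s) z ((y + 2 ^ e * w) % 2 ^ e)) =
        2 ^ e' * F (Function.update (env k s) z y) := by
    intro y hy
    simp [Nat.mod_eq_of_lt (Finset.mem_range.mp hy)]
  rw [Finset.sum_congr rfl hsum, ← Finset.mul_sum, ENNReal.add_div]
  push_cast
  rw [← pow_add, mul_comm _ (τ * _), ENNReal.mul_div_cancel_right (two_pow_ne_zero' _)
      (two_pow_ne_top' _), pow_add, mul_comm ((2 : ℝ≥0∞) ^ e),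
      ENNReal.mul_div_mul_left _ _ (two_pow_ne_zero' _) (two_pow_ne_top' _),
      randMask, Cmd.size, size_randWords]
  push_cast
  ring

theorem loadVar_spec {x : ℕ} (hx : x + k ≤ 3 * k) (s : ℕ → BitVec d) :
    (∀ u, ∀ j < k + 2, (loadVar k v x).det s (reg k u j) =
      if u = v ∧ j < k then s (x + j) else s (reg k u j)) ∧
    ∀ i < 3 * k, (loadVar k v x).det s i = s i := by
  have key : ∀ n ≤ k, (∀ u, ∀ j < k + 2,
      (forUp (fun j => .instr (.move (reg k v j) (x + j))) n).det s (reg k u j) =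
        if u = v ∧ j < n then s (x + j) else s (reg k u j)) ∧
      ∀ i < 3 * k, (forUp (fun j => .instr (.move (reg k v j) (x + j))) n).det s i = s i := by
    intro n hn
    induction n with
    | zero => simp [forUp, Cmd.det]
    | succ n ih =>
      obtain ⟨h1, h2⟩ := ih (by omega)
      simp only [forUp, Cmd.det, Instr.det]
      refine ⟨fun u j hj => ?_, fun i hi => ?_⟩
      · rw [Function.update_apply, h2 _ (by omega), h1 u j hj]
        simp only [reg_inj hj (show n < k + 2 by omega)]
        grind
      · rw [Function.update_of_ne (by have := reg_ge (k := k) (v := v) (j := n); omega), h2 i hi]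
  exact key k le_rfl

/-- The values of the variables when the input has been read. -/
def inputEnv (a b n : ℕ) : ℕ → ℕ := fun v =>
  if v = 2 then 1 else if v = 3 then a else if v = 4 then b else if v = 5 then n else 0

theorem env_input (hd : 1 ≤ d) {a b n : ℕ} (ha : a < 2 ^ (k * d)) (hb : b < 2 ^ (k * d))
    (hn : n < 2 ^ (k * d)) (P : Cmd) :
    env k ((input k).det (P.start d k a b n).regs) = inputEnv a b n := by
  set s := (P.start d k a b n).regs with hs
  obtain ⟨h1, g1⟩ := loadVar_spec (k := k) (v := 3) (x := 0) (by omega) s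
  set s₁ := (loadVar k 3 0).det s
  obtain ⟨h2, g2⟩ := loadVar_spec (k := k) (v := 4) (x := k) (by omega) s₁
  set s₂ := (loadVar k 4 k).det s₁
  obtain ⟨h3, -⟩ := loadVar_spec (k := k) (v := 5) (x := 2 * k) (by omega) s₂
  set s₃ := (loadVar k 5 (2 * k)).det s₂
  have hdet : (input k).det s = Function.update s₃ (reg k 2 0) (BitVec.ofNat d 1) := rfl
  have hs0 : ∀ u j, s (reg k u j) = 0 := by
    intro u j
    have := reg_ge (k := k) (v := u) (j := j)
    simp only [hs, Cmd.start]
    rw [if_neg (by omega), if_neg (by omega), if_neg (by omega)]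
  have hword : ∀ y < 2 ^ (k * d), ∀ j, k ≤ j → wordOf d y j = 0 := by
    intro y hy j hj
    refine wordOf_of_lt (hy.trans_le (Nat.pow_le_pow_right (by norm_num) ?_))
    rw [mul_comm]
    exact Nat.mul_le_mul_left _ hj
  have hlt : ∀ y < 2 ^ (k * d), y % 2 ^ (d * (k + 2)) = y := by
    intro y hy
    refine Nat.mod_eq_of_lt (hy.trans_le (Nat.pow_le_pow_right (by norm_num) ?_))
    rw [mul_comm]
    exact Nat.mul_le_mul_left _ (by omega)
  have hregs : ∀ u, ∀ j < k + 2, (input k).det s (reg k u j) =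
      wordOf d (inputEnv a b n u) j := by
    intro u j hj
    rw [hdet, Function.update_apply, h3 u j hj, h2 u j hj, h1 u j hj]
    simp only [reg_inj hj (show 0 < k + 2 by omega)]
    by_cases hu2 : u = 2
    · subst hu2
      by_cases hj0 : j = 0
      · subst hj0; simp [inputEnv, wordOf]
      · have h2 : (1 : ℕ) < 2 ^ (d * j) := Nat.one_lt_two_pow (by positivity)
        simp [inputEnv, hj0, hs0, wordOf_of_lt h2]
    by_cases hu3 : u = 3
    · subst hu3
      by_cases hjk : j < k
      · simp [inputEnv, hjk, hs, Cmd.start]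
      · simp [inputEnv, hjk, hs0, hword a ha j (by omega)]
    by_cases hu4 : u = 4
    · subst hu4
      by_cases hjk : j < k
      · have : ¬ k + j < k := by omega
        simp [inputEnv, hjk, g1 (k + j) (by omega), hs, Cmd.start,
          show k + j < 2 * k by omega]
      · simp [inputEnv, hjk, hs0, hword b hb j (by omega)]
    by_cases hu5 : u = 5
    · subst hu5
      by_cases hjk : j < k
      · have : ¬ 2 * k + j < k := by omega
        simp [inputEnv, hjk, g2 (2 * k + j) (by omega), g1 (2 * k + j) (by omega), hs, Cmd.start,
          show 2 * k + j < 3 * k by omega, this]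
      · simp [inputEnv, hjk, hs0, hword n hn j (by omega)]
    · simp [inputEnv, hu2, hu3, hu4, hu5, hs0, wordOf]
  funext u
  rw [env, val_wordOf (y := inputEnv a b n u)]
  · unfold inputEnv
    have h1 : 1 < 2 ^ (d * (k + 2)) := Nat.one_lt_two_pow (by positivity)
    split_ifs
    · exact Nat.mod_eq_of_lt h1
    · exact hlt a ha
    · exact hlt b hb
    · exact hlt n hn
    · simp
  · intro i hi
    rw [reg_add]
    exact hregs u i hi

theorem readNat_range' (s : ℕ → BitVec d) (x len : ℕ) :
    readNat s (List.range' x len) = val s x len := by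
  induction len generalizing x with
  | zero => simp [readNat, val]
  | succ len ih =>
    rw [val, ← ih]
    simp [readNat, List.range'_succ, Nat.ofDigits_cons]

theorem readNat_output (s : ℕ → BitVec d) (hv : env k s v < 2 ^ (k * d)) :
    readNat ((output k v).det s) (List.range k) = env k s v := by
  have key : ∀ n ≤ k, (∀ i < n, (forUp (fun j => .instr (.move j (reg k v j))) n).det s i =
      s (reg k v i)) ∧ ∀ u j, (forUp (fun j => .instr (.move j (reg k v j))) n).det s (reg k u j) =
        s (reg k u j) := by
    intro n hn
    induction n with
    | zero => simp [forUp, Cmd.det]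
    | succ n ih =>
      obtain ⟨h1, h2⟩ := ih (by omega)
      simp only [forUp, Cmd.det, Instr.det]
      refine ⟨fun i hi => ?_, fun u j => ?_⟩
      · by_cases hin : i = n
        · subst hin; simp [h2]
        · rw [Function.update_of_ne hin, h1 i (by omega)]
      · rw [Function.update_of_ne (by have := reg_ge (k := k) (v := u) (j := j); omega), h2]
  rw [List.range_eq_range', readNat_range', val_congr (s' := s) (x' := reg k v 0)]
  · have h1 : env k s v = val s (reg k v 0) k + 2 ^ (d * k) * ((s (reg k v 0 + k)).toNat +
        2 ^ d * (s (reg k v 0 + (k + 1))).toNat) := by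
      rw [env, val_succ_last, val_succ_last]; ring
    have h2 := val_lt s (reg k v 0) k
    rw [← Nat.mod_eq_of_lt hv, h1, mul_comm k, Nat.add_mul_mod_self_left, Nat.mod_eq_of_lt h2]
  · intro i hi
    rw [zero_add, reg_add]
    exact (key k le_rfl).1 i hi

end Spec

end

section

/-! ### Upper bounds in terms of the variables -/

/-- `Bound` for all registers that represent the values `e` of the variables; the cost `F` of what
follows depends on the variables only. -/
def EBound (k d : ℕ) (τ : ℝ≥0∞) (P : Cmd) (F : (ℕ → ℕ) → ℝ≥0∞) (e : ℕ → ℕ) (x : ℝ≥0∞) : Prop :=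
  ∀ s : ℕ → BitVec d, env k s = e → Bound τ P (fun s => F (env k s)) s x

/-- `P` is deterministic, without loops, and takes the values `e` of the variables to `e'`. -/
def Det (k d : ℕ) (P : Cmd) (e e' : ℕ → ℕ) : Prop :=
  P.Simple ∧ ∀ s : ℕ → BitVec d, env k s = e → env k (P.det s) = e'

/-- Equality of two variables that are less than the base `2 ^ d`. -/
def test (k v w : ℕ) : Test := .eq (reg k v 0) (reg k w 0)

variable {k d : ℕ} {τ : ℝ≥0∞} {P Q : Cmd} {F G : (ℕ → ℕ) → ℝ≥0∞} {e e' e'' : ℕ → ℕ} {x y : ℝ≥0∞}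

theorem EBound.mono (h : EBound k d τ P G e x) (hFG : ∀ e, F e ≤ G e) (hxy : x ≤ y) :
    EBound k d τ P F e y :=
  fun s hs => (h s hs).mono (fun _ => hFG _) hxy

theorem EBound.le (h : EBound k d τ P F e x) (hxy : x ≤ y) : EBound k d τ P F e y :=
  h.mono (fun _ => le_rfl) hxy

theorem EBound.top : EBound k d τ P F e ∞ := fun _ _ _ _ _ _ _ => le_top

theorem EBound.skip : EBound k d τ .skip F e (τ + F e) := by
  rintro s rfl
  exact bound_skip

theorem EBound.seq (hP : EBound k d τ P G e x) (hQ : ∀ e', EBound k d τ Q F e' (G e')) :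
    EBound k d τ (.seq P Q) F e (τ + x) :=
  fun s hs => bound_seq (hP s hs) fun r => hQ _ r rfl

theorem EBound.of_det (h : Det k d P e e') : EBound k d τ P F e (τ * P.size + F e') := by
  intro s hs
  rw [← h.2 s hs]
  exact bound_det h.1 _ s

theorem EBound.seq_det (hP : Det k d P e e') (hQ : EBound k d τ Q F e' x) :
    EBound k d τ (.seq P Q) F e (τ * (P.size + 1) + x) := by
  classical
  have h := EBound.seq (k := k) (d := d) (τ := τ) (P := P) (Q := Q) (F := F) (e := e)
    (G := fun e₁ => if e₁ = e' then x else ∞) (EBound.of_det hP) (fun e₁ => by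
      by_cases h : e₁ = e'
      · subst h; simpa using hQ
      · simp only [h, if_false]; exact EBound.top)
  refine h.le (le_of_eq ?_)
  simp only [if_true]
  ring

theorem EBound.ite {v w : ℕ}
    (h : EBound k d τ (if e v % 2 ^ d = e w % 2 ^ d then P else Q) F e x) :
    EBound k d τ (.ite (test k v w) P Q) F e (τ + x) := by
  rintro s rfl
  refine bound_ite ?_
  have := h s rfl
  simp only [env_mod] at this
  simpa only [test, Test.eval, decide_eq_true_eq, ← BitVec.toNat_inj] using this

theorem EBound.ite_pos {v w : ℕ} (hvw : e v % 2 ^ d = e w % 2 ^ d) (h : EBound k d τ P F e x) :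
    EBound k d τ (.ite (test k v w) P Q) F e (τ + x) :=
  EBound.ite (by rwa [if_pos hvw])

theorem EBound.ite_neg {v w : ℕ} (hvw : e v % 2 ^ d ≠ e w % 2 ^ d) (h : EBound k d τ Q F e x) :
    EBound k d τ (.ite (test k v w) P Q) F e (τ + x) :=
  EBound.ite (by rwa [if_neg hvw])

theorem EBound.loop {v w : ℕ} (I : (ℕ → ℕ) → ℝ≥0∞)
    (htrue : ∀ e, e v % 2 ^ d = e w % 2 ^ d → I e ≠ ∞ → ∃ y, EBound k d τ P I e y ∧ τ + y ≤ I e)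
    (hfalse : ∀ e, e v % 2 ^ d ≠ e w % 2 ^ d → τ + F e ≤ I e) (e : ℕ → ℕ) :
    EBound k d τ (.loop (test k v w) P) F e (I e) := by
  rintro s rfl
  refine bound_loop (fun s => I (env k s)) (fun r hr => ?_) (fun r hr => ?_) s
  · by_cases hI : I (env k r) = ∞
    · exact ⟨∞, fun _ _ _ _ _ => le_top, by simp [hI]⟩
    · obtain ⟨y, hy, hyI⟩ := htrue (env k r) (by
        rw [env_mod, env_mod]
        simpa [test, Test.eval, ← BitVec.toNat_inj] using hr) hI
      exact ⟨y, hy r rfl, hyI⟩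
  · refine hfalse (env k r) ?_
    rw [env_mod, env_mod]
    simpa [test, Test.eval, ← BitVec.toNat_inj] using hr

theorem Det.seq (hP : Det k d P e e') (hQ : Det k d Q e' e'') : Det k d (.seq P Q) e e'' :=
  ⟨⟨hP.1, hQ.1⟩, fun s hs => hQ.2 _ (hP.2 s hs)⟩

theorem Det.skip : Det k d .skip e e := ⟨trivial, fun _ hs => hs⟩

theorem Det.ite_pos {v w : ℕ} (h : e v % 2 ^ d = e w % 2 ^ d) (hP : Det k d P e e')
    (hQ : Q.Simple) : Det k d (.ite (test k v w) P Q) e e' := by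
  refine ⟨⟨hP.1, hQ⟩, fun s hs => ?_⟩
  have ht : (test k v w).eval s = true := by
    subst hs
    simpa [test, Test.eval, ← BitVec.toNat_inj, env_mod] using h
  simp only [Cmd.det, ht, if_true]
  exact hP.2 s hs

theorem Det.ite_neg {v w : ℕ} (h : e v % 2 ^ d ≠ e w % 2 ^ d) (hP : P.Simple)
    (hQ : Det k d Q e e') : Det k d (.ite (test k v w) P Q) e e' := by
  refine ⟨⟨hP, hQ.1⟩, fun s hs => ?_⟩
  have ht : (test k v w).eval s = false := by
    subst hs
    simpa [test, Test.eval, ← BitVec.toNat_inj, env_mod] using h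
  simp only [Cmd.det, ht, Bool.false_eq_true, if_false]
  exact hQ.2 s hs

/-- The values of the variables after `sub k z v w`. -/
def subEnv (k d z v w : ℕ) (e : ℕ → ℕ) : ℕ → ℕ :=
  Function.update (Function.update e z (if e v < e w then e v + 2 ^ (d * (k + 2)) - e w
    else e v - e w)) 0 (if e v < e w then 1 else 0)

theorem det_sub (hd : 1 ≤ d) (z v w : ℕ) : Det k d (sub k z v w) e (subEnv k d z v w e) := by
  refine ⟨sub_simple _ _ _ _, ?_⟩
  rintro s rfl
  exact env_sub hd s

/-- `z := v`, by subtraction of the variable `1`, which is always zero. -/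
def copy (k z v : ℕ) : Cmd := sub k z v 1

theorem det_copy (hd : 1 ≤ d) (z v : ℕ) (h1 : e 1 = 0) :
    Det k d (copy k z v) e (Function.update (Function.update e z (e v)) 0 0) := by
  have h := det_sub (k := k) (e := e) hd z v 1
  simpa [subEnv, h1, copy] using h

/-- `z := x + y`, provided that `y` is not the variable `22`. -/
def add (k z x y : ℕ) : Cmd := .seq (sub k 22 1 y) (sub k z x 22)

theorem det_add (hd : 1 ≤ d) {z x y : ℕ} (h1 : e 1 = 0) (hx : x ≠ 0 ∧ x ≠ 22)
    (hlt : e x + e y < 2 ^ (d * (k + 2))) :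
    ∃ f, Det k d (add k z x y) e f ∧ f z = (if z = 0 then f 0 else e x + e y) ∧
      ∀ v, v ≠ 0 → v ≠ 22 → v ≠ z → f v = e v := by
  refine ⟨_, (det_sub hd _ _ _).seq (det_sub hd _ _ _), ?_, ?_⟩
  · split_ifs with hz
    · subst hz; rfl
    · rcases Nat.eq_zero_or_pos (e y) with hy | hy
      · simp [subEnv, h1, hy, hz, hx]
      · simp only [subEnv, h1, hy, if_true, zero_add]
        simp only [Function.update_apply, hz, hx.1, hx.2, if_false, if_true]
        simp only [OfNat.ofNat_ne_zero, if_false]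
        rw [if_pos (by omega)]
        omega
  · intro v hv0 hv22 hvz
    simp [subEnv, hv0, hv22, hvz]

/-- The variables `1, …, n - 1` have the same values. -/
def Agree (n : ℕ) (e e' : ℕ → ℕ) : Prop := ∀ v, 1 ≤ v → v < n → e' v = e v

theorem Agree.refl (n : ℕ) (e : ℕ → ℕ) : Agree n e e := fun _ _ _ => rfl

theorem Agree.trans {n : ℕ} (h : Agree n e e') (h' : Agree n e' e'') : Agree n e e'' :=
  fun v h1 h2 => (h' v h1 h2).trans (h v h1 h2)

theorem Agree.of_le {n m : ℕ} (h : Agree m e e') (hnm : n ≤ m) : Agree n e e' :=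
  fun v h1 h2 => h v h1 (h2.trans_le hnm)

/-! ### Bernoulli variables with rational parameter -/

/-- The deterministic part of a round of `coin`: compute the next binary digit of a fraction whose
numerator is the variable `19` and whose denominator is `y`. -/
def coinDigit (k y : ℕ) : Cmd :=
  .seq (add k 19 19 19) (.seq (sub k 22 19 y)
    (.ite (test k 0 1) (.seq (copy k 19 22) (copy k 20 2)) (copy k 20 1)))

/-- Set the variable `20` to `1` with probability `x / y` and to `0` otherwise: a uniformly random
real number is compared with `x / y` digit by digit, in base two. -/
def coin (k x y : ℕ) : Cmd :=
  .seq (copy k 19 x) (.seq (copy k 20 1) (.seq (copy k 21 1)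
    (.loop (test k 21 20) (.seq (coinDigit k y) (randMask k 21 2)))))

theorem coinDigit_spec (hd : 1 ≤ d) {y : ℕ} (hy1 : 1 ≤ y) (hy : y < 19) (h1 : e 1 = 0)
    (h2 : e 2 = 1) (hx : e 19 ≤ e y) (hlt : 2 * e y < 2 ^ (d * (k + 2))) :
    ∃ f, Det k d (coinDigit k y) e f ∧ Agree 19 e f ∧
      ((2 * e 19 < e y ∧ f 19 = 2 * e 19 ∧ f 20 = 0) ∨
        (e y ≤ 2 * e 19 ∧ f 19 = 2 * e 19 - e y ∧ f 20 = 1)) := by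
  obtain ⟨f, hf, hfz, hfv⟩ := det_add (k := k) (e := e) hd (z := 19) (x := 19) (y := 19) h1
    (by norm_num) (by omega)
  simp only [OfNat.ofNat_ne_zero, if_false] at hfz
  have hf1 : f 1 = 0 := by rw [hfv 1 (by norm_num) (by norm_num) (by norm_num), h1]
  have hf2 : f 2 = 1 := by rw [hfv 2 (by norm_num) (by norm_num) (by norm_num), h2]
  have hfy : f y = e y := hfv y (by omega) (by omega) (by omega)
  have hdet := hf.seq ((det_sub (k := k) hd 22 19 y))
  by_cases hlt' : 2 * e 19 < e y
  · refine ⟨_, hf.seq ((det_sub hd _ _ _).seq (Det.ite_neg ?_ ?_ (det_copy hd _ _ ?_))), ?_,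
      Or.inl ⟨hlt', ?_, ?_⟩⟩
    · simp only [subEnv, hfz, hfy]
      rw [if_pos (by omega), if_pos (by omega)]
      simp [hf1, show d ≠ 0 by omega]
    · exact ⟨sub_simple _ _ _ _, sub_simple _ _ _ _⟩
    · simp [subEnv, hf1]
    · intro v hv1 hv2
      simp [subEnv, show v ≠ 0 by omega, show v ≠ 20 by omega, show v ≠ 22 by omega,
        hfv v (by omega) (by omega) (by omega)]
    · simp [subEnv, hfz]; ring
    · simp [subEnv, hf1]
  · refine ⟨_, hf.seq ((det_sub hd _ _ _).seq (Det.ite_pos ?_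
      ((det_copy hd _ _ ?_).seq (det_copy hd _ _ ?_)) (sub_simple _ _ _ _))), ?_,
      Or.inr ⟨by omega, ?_, ?_⟩⟩
    · simp only [subEnv, hfz, hfy]
      rw [if_neg (by omega), if_neg (by omega)]
      simp [hf1]
    · simp [subEnv, hf1]
    · simp [subEnv, hf1]
    · intro v hv1 hv2
      simp [subEnv, show v ≠ 0 by omega, show v ≠ 20 by omega, show v ≠ 19 by omega,
        show v ≠ 22 by omega, hfv v (by omega) (by omega) (by omega)]
    · simp [subEnv, hfz, hfy]
      rw [if_neg (by omega)]; omega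
    · simp [subEnv, hf2]

theorem ebound_randMask {z w : ℕ} (hzw : z ≠ w) {t : ℕ} (hw : e w + 1 = 2 ^ t) :
    EBound k d τ (randMask k z w) F e (τ * (randMask k z w).size +
      (∑ r ∈ Finset.range (2 ^ t), F (Function.update e z r)) / 2 ^ t) := by
  rintro s rfl
  exact bound_randMask hzw F s hw

theorem div_two_eq_iff {a b : ℝ≥0∞} : a / 2 = b ↔ a = 2 * b := by
  rw [eq_comm, ENNReal.eq_div_iff (by norm_num) (by norm_num), eq_comm]

/-- The probability `x / y` is halved after subtracting the first binary digit. -/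
theorem coin_average {X X' Y : ℕ} (hY : 0 < Y) (A B C : ℝ≥0∞)
    (h : (2 * X = X' ∧ X' ≤ Y ∧ C = B) ∨ (2 * X = X' + Y ∧ X' ≤ Y ∧ C = A)) :
    ((X' * A + (Y - X' : ℕ) * B) / Y + C) / 2 = (X * A + (Y - X : ℕ) * B) / Y := by
  have hY0 : (Y : ℝ≥0∞) ≠ 0 := by exact_mod_cast hY.ne'
  have hYt : (Y : ℝ≥0∞) ≠ ∞ := ENNReal.natCast_ne_top Y
  have hC : C = C * Y / Y := (ENNReal.mul_div_cancel_right hY0 hYt).symm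
  rw [hC, ← ENNReal.add_div, ENNReal.div_right_comm]
  congr 1
  rw [div_two_eq_iff]
  rcases h with ⟨h, hX, rfl⟩ | ⟨h, hX, rfl⟩
  · have e1 : (X' : ℝ≥0∞) = 2 * X := by exact_mod_cast h.symm
    have e2 : ((Y - X' : ℕ) : ℝ≥0∞) + Y = 2 * (Y - X : ℕ) := by
      exact_mod_cast (by omega : Y - X' + Y = 2 * (Y - X))
    rw [add_assoc, mul_comm C, ← add_mul, e1, e2]
    ring
  · have e1 : (X' : ℝ≥0∞) + Y = 2 * X := by exact_mod_cast h.symm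
    have e2 : ((Y - X' : ℕ) : ℝ≥0∞) = 2 * (Y - X : ℕ) := by
      exact_mod_cast (by omega : Y - X' = 2 * (Y - X))
    rw [add_right_comm, mul_comm C, ← add_mul, e1, e2]
    ring

/-- A bound for the expected time of `coin`. -/
def coinTime (k x y : ℕ) : ℕ :=
  (copy k 19 x).size + (copy k 20 1).size + (copy k 21 1).size + 3 +
    (2 * ((coinDigit k y).size + 1 + (randMask k 21 2).size) + 3)

theorem mod_two_pow_of_le_one (hd : 1 ≤ d) {x : ℕ} (hx : x ≤ 1) : x % 2 ^ d = x :=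
  Nat.mod_eq_of_lt (hx.trans_lt (two_le_two_pow hd))

theorem natCast_weights {X Y : ℕ} (hXY : X ≤ Y) (hY : 0 < Y) (A B : ℝ≥0∞) :
    (X * A + (Y - X : ℕ) * B) / Y = (X / Y : ℝ≥0∞) * A + (1 - X / Y) * B := by
  have hY0 : (Y : ℝ≥0∞) ≠ 0 := by exact_mod_cast hY.ne'
  have hYt : (Y : ℝ≥0∞) ≠ ∞ := ENNReal.natCast_ne_top Y
  have h : ((Y - X : ℕ) : ℝ≥0∞) / Y = 1 - X / Y := by
    refine ENNReal.eq_sub_of_add_eq (ENNReal.div_ne_top (ENNReal.natCast_ne_top X) hY0) ?_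
    rw [← ENNReal.add_div, ← Nat.cast_add, Nat.sub_add_cancel hXY, ENNReal.div_self hY0 hYt]
  rw [← h, ENNReal.add_div]
  simp only [div_eq_mul_inv]
  ring

theorem ebound_coin (hd : 1 ≤ d) {x y : ℕ} (hy : 1 ≤ y ∧ y < 19)
    (h1 : e 1 = 0) (h2 : e 2 = 1) (hxy : e x ≤ e y) (hy0 : 0 < e y)
    (hlt : 2 * e y < 2 ^ (d * (k + 2))) {A B : ℝ≥0∞}
    (hA : ∀ f, Agree 19 e f → f 20 = 1 → F f ≤ A) (hB : ∀ f, Agree 19 e f → f 20 = 0 → F f ≤ B) :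
    EBound k d τ (coin k x y) F e
      (τ * coinTime k x y + ((e x / e y : ℝ≥0∞) * A + (1 - e x / e y) * B)) := by
  classical
  set c : ℕ := 2 * ((coinDigit k y).size + 1 + (randMask k 21 2).size) + 3 with hc
  -- The expected cost: `19` holds the numerator of what remains of `x / y`, and the loop stops
  -- when the random digit `21` differs from the digit `20` of `x / y`.
  let I : (ℕ → ℕ) → ℝ≥0∞ := fun f =>
    if Agree 19 e f ∧ f 19 ≤ e y ∧ f 20 ≤ 1 ∧ f 21 ≤ 1 then
      if f 21 = f 20 then τ * c + (f 19 * A + (e y - f 19 : ℕ) * B) / e y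
      else τ + if f 20 = 1 then A else B
    else ∞
  have hloop := EBound.loop (k := k) (d := d) (τ := τ)
    (P := .seq (coinDigit k y) (randMask k 21 2)) (F := F) (v := 21) (w := 20) I ?_ ?_
  · refine (EBound.seq_det (det_copy hd 19 x h1) (EBound.seq_det (det_copy hd 20 1 ?_)
      (EBound.seq_det (det_copy hd 21 1 ?_) (hloop _)))).le (le_of_eq ?_)
    · simp [h1]
    · simp [h1]
    · rw [← natCast_weights hxy hy0]
      simp only [I]
      rw [if_pos]
      · simp [coinTime, hc, h1]
        ring
      · refine ⟨fun v hv1 hv2 => ?_, ?_⟩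
        · simp [show v ≠ 0 by omega, show v ≠ 19 by omega, show v ≠ 20 by omega,
            show v ≠ 21 by omega]
        · simp [hxy, h1]
  · intro f hf hI
    have hinv : Agree 19 e f ∧ f 19 ≤ e y ∧ f 20 ≤ 1 ∧ f 21 ≤ 1 := by
      by_contra h
      exact hI (if_neg h)
    obtain ⟨hag, hX, h20, h21⟩ := hinv
    rw [mod_two_pow_of_le_one hd h20, mod_two_pow_of_le_one hd h21] at hf
    have hfy : f y = e y := hag y hy.1 hy.2
    obtain ⟨g, hg, hgag, hcase⟩ := coinDigit_spec (k := k) (e := f) hd hy.1 hy.2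
      (by rw [hag 1 (by norm_num) (by norm_num), h1])
      (by rw [hag 2 (by norm_num) (by norm_num), h2])
      (by rw [hfy]; exact hX) (by rw [hfy]; exact hlt)
    have hag' := hag.trans hgag
    rw [hfy] at hcase
    have hIg : ∀ r ≤ 1, I (Function.update g 21 r) =
        if r = g 20 then τ * c + (g 19 * A + (e y - g 19 : ℕ) * B) / e y
        else τ + if g 20 = 1 then A else B := by
      intro r hr
      simp only [I]
      rw [if_pos]
      · simp
      · refine ⟨fun v hv1 hv2 => ?_, ?_⟩
        · rw [Function.update_of_ne (by omega), hag' v hv1 hv2]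
        · simp only [Function.update_self]
          simp only [Function.update_apply]
          simp only [Nat.reduceEqDiff, if_false]
          omega
    refine ⟨_, EBound.seq_det hg (ebound_randMask (t := 1) (by norm_num) (by
      rw [hag' 2 (by norm_num) (by norm_num), h2]; norm_num)), ?_⟩
    have hsum : ∑ r ∈ Finset.range (2 ^ 1), I (Function.update g 21 r) = τ * (c + 1) +
        ((g 19 * A + (e y - g 19 : ℕ) * B) / e y + if g 20 = 1 then A else B) := by
      rw [pow_one, Finset.sum_range_succ, Finset.sum_range_one, hIg 0 (by norm_num),
        hIg 1 le_rfl]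
      rcases hcase with ⟨-, -, h⟩ | ⟨-, -, h⟩ <;> simp [h] <;> ring
    have hIf : I f = τ * c + (f 19 * A + (e y - f 19 : ℕ) * B) / e y := by
      simp only [I]
      rw [if_pos ⟨hag, hX, h20, h21⟩, if_pos hf]
    rw [hsum, hIf, pow_one, ENNReal.add_div, coin_average (X := f 19) hy0]
    · apply le_of_eq
      have hhalf : τ * (c + 1) / 2 =
          τ * ((coinDigit k y).size + 1 + (randMask k 21 2).size + 2 : ℕ) := by
        rw [mul_div_assoc]
        congr 1
        rw [div_two_eq_iff]
        exact_mod_cast (by omega)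
      rw [hhalf, hc]
      push_cast
      ring
    · rcases hcase with ⟨h, h', h''⟩ | ⟨h, h', h''⟩
      · left; refine ⟨h'.symm, by omega, by simp [h'']⟩
      · right; refine ⟨by omega, by omega, by simp [h'']⟩
  · intro f hf
    simp only [I]
    split_ifs with h heq h20
    · exact absurd (by rw [heq]) hf
    · gcongr; exact hA f h.1 h20
    · gcongr; exact hB f h.1 (by omega)
    · exact le_top

/-- Run `coin` for all pairs of a list, until one of them fails; if none fails, run `Q`. -/
def coins (k : ℕ) : List (ℕ × ℕ) → Cmd → Cmd
  | [], Q => Q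
  | q :: l, Q => .seq (coin k q.1 q.2) (.ite (test k 20 2) (coins k l Q) .skip)

/-- A bound for the expected time of `coins`, without the time of the last command. -/
def coinsTime (k : ℕ) : List (ℕ × ℕ) → ℕ
  | [] => 0
  | q :: l => coinTime k q.1 q.2 + coinsTime k l + 4

/-- The probability that `coins` runs its last command. -/
noncomputable def coinsProb (e : ℕ → ℕ) : List (ℕ × ℕ) → ℝ≥0∞
  | [] => 1
  | q :: l => e q.1 / e q.2 * coinsProb e l

theorem mix_mix {p q : ℝ≥0∞} (hp : p ≤ 1) (hq : q ≤ 1) (A B : ℝ≥0∞) :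
    p * (q * A + (1 - q) * B) + (1 - p) * B = p * q * A + (1 - p * q) * B := by
  have h : p * (1 - q) + (1 - p) = 1 - p * q := by
    refine ENNReal.eq_sub_of_add_eq (ENNReal.mul_ne_top (hp.trans_lt ENNReal.one_lt_top).ne
      (hq.trans_lt ENNReal.one_lt_top).ne) ?_
    rw [add_right_comm, ← mul_add, tsub_add_cancel_of_le hq, mul_one, add_tsub_cancel_of_le hp]
  rw [← h]; ring

theorem mix_add {p : ℝ≥0∞} (hp : p ≤ 1) (x A B : ℝ≥0∞) :
    p * (x + A) + (1 - p) * (x + B) = x + (p * A + (1 - p) * B) := by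
  calc _ = (p + (1 - p)) * x + (p * A + (1 - p) * B) := by ring
    _ = _ := by rw [add_tsub_cancel_of_le hp, one_mul]

theorem natCast_div_le_one {x y : ℕ} (h : x ≤ y) : (x / y : ℝ≥0∞) ≤ 1 :=
  ENNReal.div_le_of_le_mul (by rw [one_mul]; exact_mod_cast h)

/-- What is needed to run `coins`: the numbers are fractions at most one of variables that are not
changed by `coin`. -/
def CoinsReady (k d : ℕ) (e : ℕ → ℕ) (l : List (ℕ × ℕ)) : Prop :=
  ∀ q ∈ l, (1 ≤ q.1 ∧ q.1 < 19) ∧ (1 ≤ q.2 ∧ q.2 < 19) ∧ e q.1 ≤ e q.2 ∧ 0 < e q.2 ∧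
    2 * e q.2 < 2 ^ (d * (k + 2))

theorem CoinsReady.of_agree {l : List (ℕ × ℕ)} (h : CoinsReady k d e l) (hag : Agree 19 e e') :
    CoinsReady k d e' l := by
  intro q hq
  obtain ⟨h1, h2, h3⟩ := h q hq
  rw [hag _ h1.1 h1.2, hag _ h2.1 h2.2]
  exact ⟨h1, h2, h3⟩

theorem coinsProb_of_agree {l : List (ℕ × ℕ)} (h : CoinsReady k d e l) (hag : Agree 19 e e') :
    coinsProb e' l = coinsProb e l := by
  induction l with
  | nil => rfl
  | cons q l ih =>
    obtain ⟨h1, h2, -⟩ := h q (by simp)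
    rw [coinsProb, coinsProb, hag _ h1.1 h1.2, hag _ h2.1 h2.2,
      ih fun q' hq' => h q' (by simp [hq'])]

theorem coinsProb_le_one {l : List (ℕ × ℕ)} (h : CoinsReady k d e l) : coinsProb e l ≤ 1 := by
  induction l with
  | nil => exact le_rfl
  | cons q l ih =>
    exact mul_le_one' (natCast_div_le_one (h q (by simp)).2.2.1)
      (ih fun q' hq' => h q' (by simp [hq']))

theorem ebound_coins (hd : 1 ≤ d) {l : List (ℕ × ℕ)} (h1 : e 1 = 0) (h2 : e 2 = 1)
    (hl : CoinsReady k d e l) {A B : ℝ≥0∞} (hQ : ∀ f, Agree 19 e f → EBound k d τ Q F f A)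
    (hB : ∀ f, Agree 19 e f → F f ≤ B) :
    EBound k d τ (coins k l Q) F e
      (τ * coinsTime k l + (coinsProb e l * A + (1 - coinsProb e l) * B)) := by
  classical
  induction l generalizing e with
  | nil =>
    refine (hQ e (Agree.refl _ _)).le ?_
    simp [coinsTime, coinsProb]
  | cons q l ih =>
    obtain ⟨-, hq2, hle, hpos, hlt⟩ := hl q (by simp)
    have hl' : CoinsReady k d e l := fun q' hq' => hl q' (by simp [hq'])
    set p := coinsProb e l with hp
    let G : (ℕ → ℕ) → ℝ≥0∞ := fun f =>
      if Agree 19 e f ∧ f 20 = 1 then τ + (τ * coinsTime k l + (p * A + (1 - p) * B))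
      else if Agree 19 e f ∧ f 20 = 0 then τ + (τ + B) else ∞
    have hcoin := ebound_coin (k := k) (d := d) (τ := τ) (F := G) hd hq2 h1 h2 hle hpos hlt
      (A := τ + (τ * coinsTime k l + (p * A + (1 - p) * B))) (B := τ + (τ + B))
      (fun f hf h => by simp [G, hf, h]) (fun f hf h => by simp [G, hf, h])
    refine (EBound.seq hcoin fun f => ?_).le ?_
    · simp only [G]
      split_ifs with hf hf
      · refine EBound.ite ?_
        have hf2 : f 2 = 1 := by rw [hf.1 2 (by norm_num) (by norm_num), h2]
        rw [hf.2, hf2, if_pos rfl, hp, ← coinsProb_of_agree hl' hf.1]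
        exact ih (by rw [hf.1 1 (by norm_num) (by norm_num), h1]) hf2 (hl'.of_agree hf.1)
          (fun g hg => hQ g (hf.1.trans hg)) fun g hg => hB g (hf.1.trans hg)
      · refine EBound.ite ?_
        have hf2 : f 2 = 1 := by rw [hf.1 2 (by norm_num) (by norm_num), h2]
        rw [hf.2, hf2, mod_two_pow_of_le_one hd le_rfl, if_neg (by simp)]
        refine EBound.skip.le ?_
        gcongr
        exact hB f hf.1
      · exact EBound.top
    · have hle1 := natCast_div_le_one hle
      have hple : p ≤ 1 := coinsProb_le_one hl'
      set r : ℝ≥0∞ := e q.1 / e q.2 with hr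
      have hprob : coinsProb e (q :: l) = r * p := rfl
      rw [hprob, ← mix_mix hle1 hple]
      calc _ ≤ τ + (τ * coinTime k q.1 q.2 + (r * ((τ * (coinsTime k l + 3)) +
            (p * A + (1 - p) * B)) + (1 - r) * ((τ * (coinsTime k l + 3)) + B))) := by
            have e1 : τ + (τ * coinsTime k l + (p * A + (1 - p) * B)) ≤
                τ * (coinsTime k l + 3) + (p * A + (1 - p) * B) := by
              calc _ = τ * (coinsTime k l + 1) + (p * A + (1 - p) * B) := by ring
                _ ≤ _ := by gcongr; norm_num
            have e2 : τ + (τ + B) ≤ τ * (coinsTime k l + 3) + B := by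
              calc _ = τ * (0 + 2) + B := by ring
                _ ≤ _ := by gcongr <;> norm_num
            gcongr
        _ = _ := by
            rw [mix_add hle1, coinsTime]
            push_cast
            ring

end

section

/-! ### Bernoulli variables with parameter a power of `1 - p` -/

/-- The alternating sum `∑ i, (-θ) ^ i * (r * (r - 1) * ⋯ * (r - i + 1)) / ((j + 1) * ⋯ * (j + i))`
in nested form. -/
noncomputable def altSum (θ : ℝ≥0∞) : ℕ → ℕ → ℝ≥0∞
  | 0, _ => 1
  | r + 1, j => 1 - (r + 1 : ℕ) / (j + 1 : ℕ) * θ * altSum θ r (j + 1)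

theorem altSum_le_one (θ : ℝ≥0∞) (r j : ℕ) : altSum θ r j ≤ 1 := by
  cases r with
  | zero => exact le_rfl
  | succ r => exact tsub_le_self

/-- The factors `1 / j`, `r / m`, `S / b`, `a / T` of a probability in `powCoin`. -/
def powFactors : List (ℕ × ℕ) := [(2, 15), (16, 8), (6, 4), (3, 7)]

/-- What `powCoin` does after a successful trial. -/
def powSucc (k : ℕ) : Cmd := .seq (sub k 16 16 2) (.seq (sub k 17 2 17) (copy k 18 2))

/-- Set the variable `17` to `1` with probability `(1 - p) ^ r`, where `r` is the variable `12`, and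
to `0` otherwise. Trials with the success probabilities `(r - j) * p / (j + 1)`, `j = 0, 1, …`, are
run until one fails, and `17` becomes `1` if the number of successes is even. The variables `15`
and `16` hold `j` and `r - j`, and `18` is `1` as long as no trial has failed. -/
def powCoin (k : ℕ) : Cmd :=
  .seq (copy k 15 1) (.seq (copy k 16 12) (.seq (copy k 17 2) (.seq (copy k 18 2)
    (.loop (test k 18 2) (.seq (add k 15 15 2) (.seq (copy k 18 1)
      (coins k powFactors (powSucc k))))))))

/-- A bound for the expected time of a trial in `powCoin`. -/
def trialTime (k : ℕ) : ℕ :=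
  (add k 15 15 2).size + (copy k 18 1).size + coinsTime k powFactors + (powSucc k).size + 4

/-- A bound for the expected time of `powCoin`. -/
def powCoinTime (k : ℕ) : ℕ :=
  (copy k 15 1).size + (copy k 16 12).size + (copy k 17 2).size + (copy k 18 2).size + 4 +
    3 * trialTime k

/-- The variables `1` and `2` have the values `0` and `1`, and the variables `6 / 4` and `3 / 7` are
fractions at most one. -/
structure Ready (k d : ℕ) (e : ℕ → ℕ) : Prop where
  zero : e 1 = 0
  one : e 2 = 1
  pos₈ : 0 < e 8
  lt₈ : 2 * e 8 < 2 ^ (d * (k + 2))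
  le₆ : e 6 ≤ e 4
  pos₄ : 0 < e 4
  lt₄ : 2 * e 4 < 2 ^ (d * (k + 2))
  le₃ : e 3 ≤ e 7
  pos₇ : 0 < e 7
  lt₇ : 2 * e 7 < 2 ^ (d * (k + 2))

/-- The success probability `p` of the geometric distribution, divided into factors. -/
noncomputable def theta (e : ℕ → ℕ) : ℝ≥0∞ := e 6 / e 4 * (e 3 / e 7) / e 8

variable {k d : ℕ} {τ : ℝ≥0∞} {F : (ℕ → ℕ) → ℝ≥0∞} {e f : ℕ → ℕ}

theorem Ready.of_agree (h : Ready k d e) {n : ℕ} (hn : 9 ≤ n) (hag : Agree n e f) :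
    Ready k d f := by
  have hv : ∀ v, 1 ≤ v → v < 9 → f v = e v := fun v h1 h2 => hag v h1 (by omega)
  constructor
  · rw [hv 1 (by norm_num) (by norm_num), h.zero]
  · rw [hv 2 (by norm_num) (by norm_num), h.one]
  · rw [hv 8 (by norm_num) (by norm_num)]; exact h.pos₈
  · rw [hv 8 (by norm_num) (by norm_num)]; exact h.lt₈
  · rw [hv 6 (by norm_num) (by norm_num), hv 4 (by norm_num) (by norm_num)]; exact h.le₆
  · rw [hv 4 (by norm_num) (by norm_num)]; exact h.pos₄
  · rw [hv 4 (by norm_num) (by norm_num)]; exact h.lt₄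
  · rw [hv 3 (by norm_num) (by norm_num), hv 7 (by norm_num) (by norm_num)]; exact h.le₃
  · rw [hv 7 (by norm_num) (by norm_num)]; exact h.pos₇
  · rw [hv 7 (by norm_num) (by norm_num)]; exact h.lt₇

theorem theta_of_agree {n : ℕ} (hn : 9 ≤ n) (hag : Agree n e f) : theta f = theta e := by
  have hv : ∀ v, 1 ≤ v → v < 9 → f v = e v := fun v h1 h2 => hag v h1 (by omega)
  rw [theta, theta, hv 6 (by norm_num) (by norm_num), hv 4 (by norm_num) (by norm_num),
    hv 3 (by norm_num) (by norm_num), hv 7 (by norm_num) (by norm_num),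
    hv 8 (by norm_num) (by norm_num)]

theorem coinsProb_powFactors (h2 : e 2 = 1) :
    coinsProb e powFactors = e 16 / e 15 * theta e := by
  simp only [powFactors, coinsProb, theta, h2, div_eq_mul_inv, mul_one, Nat.cast_one, one_mul]
  ring

theorem coinsProb_powFactors_le (h : Ready k d e) (h16 : e 16 ≤ e 8) :
    coinsProb e powFactors ≤ 1 / e 15 := by
  simp only [powFactors, coinsProb, h.one, Nat.cast_one, mul_one]
  refine mul_le_of_le_one_right' (mul_le_one' (natCast_div_le_one h16)
    (mul_le_one' (natCast_div_le_one h.le₆) (natCast_div_le_one h.le₃)))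

theorem powFactors_ready (h : Ready k d e) (h15 : 0 < e 15) (h16 : e 16 ≤ e 8)
    (hlt : e 15 ≤ e 8 + 1) (hroom : 2 * (e 8 + 1) < 2 ^ (d * (k + 2))) :
    CoinsReady k d e powFactors := by
  intro q hq
  simp only [powFactors, List.mem_cons, List.not_mem_nil, or_false] at hq
  rcases hq with rfl | rfl | rfl | rfl
  · exact ⟨by norm_num, by norm_num, by rw [h.one]; exact h15, h15, by dsimp only; omega⟩
  · exact ⟨by norm_num, by norm_num, h16, h.pos₈, h.lt₈⟩
  · exact ⟨by norm_num, by norm_num, h.le₆, h.pos₄, h.lt₄⟩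
  · exact ⟨by norm_num, by norm_num, h.le₃, h.pos₇, h.lt₇⟩

theorem powSucc_det (hd : 1 ≤ d) (h1 : e 1 = 0) (h2 : e 2 = 1) (h16 : 0 < e 16) (h17 : e 17 ≤ 1) :
    ∃ f, Det k d (powSucc k) e f ∧ Agree 16 e f ∧ f 16 = e 16 - 1 ∧ f 17 = 1 - e 17 ∧ f 18 = 1 := by
  refine ⟨_, (det_sub hd 16 16 2).seq ((det_sub hd 17 2 17).seq (det_copy hd 18 2 ?_)), ?_, ?_⟩
  · simp [subEnv, h1]
  · intro v hv1 hv2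
    simp [subEnv, show v ≠ 0 by omega, show v ≠ 16 by omega, show v ≠ 17 by omega,
      show v ≠ 18 by omega]
  · have h : ¬ e 16 < 1 := by omega
    have h' : ¬ 1 < e 17 := by omega
    simp [subEnv, h2, h, h']

/-- A trial of `powCoin` turns the weights for `j + 1` into those for `j`. -/
theorem altSum_step {w h : ℝ≥0∞} (hw : w ≤ 1) (hh : h ≤ 1) (A B : ℝ≥0∞) :
    w * (h * B + (1 - h) * A) + (1 - w) * A = (1 - w * h) * A + (1 - (1 - w * h)) * B := by
  rw [mix_mix hw hh, ENNReal.sub_sub_cancel ENNReal.one_ne_top (mul_le_one' hw hh), add_comm]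

theorem ebound_powCoin (hd : 1 ≤ d) (h : Ready k d e) (h12 : e 12 ≤ e 8)
    (hroom : 2 * (e 8 + 1) < 2 ^ (d * (k + 2))) {A B : ℝ≥0∞}
    (hA : ∀ f, Agree 15 e f → f 17 = 1 → F f ≤ A) (hB : ∀ f, Agree 15 e f → f 17 = 0 → F f ≤ B) :
    EBound k d τ (powCoin k) F e (τ * powCoinTime k +
      (altSum (theta e) (e 12) 0 * A + (1 - altSum (theta e) (e 12) 0) * B)) := by
  classical
  set c := trialTime k with hc
  -- In the invariant, `17` is the current parity. A trial succeeds with probability at most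
  -- `1 / (j + 1)`, so from the second one on the expected time is at most `2 * c`.
  let D : ℕ → ℝ≥0∞ := fun i => if i = 1 then A else B
  let I : (ℕ → ℕ) → ℝ≥0∞ := fun f =>
    if Agree 15 e f ∧ f 17 ≤ 1 ∧ f 18 ≤ 1 ∧ (f 18 = 1 → f 15 + f 16 ≤ e 8) then
      if f 18 = 1 then τ * (if f 15 = 0 then 3 * c else 2 * c : ℕ) +
        (altSum (theta e) (f 16) (f 15) * D (f 17) +
          (1 - altSum (theta e) (f 16) (f 15)) * D (1 - f 17))
      else τ + D (f 17)
    else ∞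
  have hloop := EBound.loop (k := k) (d := d) (τ := τ) (P := .seq (add k 15 15 2)
    (.seq (copy k 18 1) (coins k powFactors (powSucc k)))) (F := F) (v := 18) (w := 2) I ?_ ?_
  · refine (EBound.seq_det (det_copy hd 15 1 h.zero) (EBound.seq_det (det_copy hd 16 12 ?_)
      (EBound.seq_det (det_copy hd 17 2 ?_) (EBound.seq_det (det_copy hd 18 2 ?_)
        (hloop _))))).le (le_of_eq ?_)
    · simp [h.zero]
    · simp [h.zero]
    · simp [h.zero]
    · simp only [I]
      rw [if_pos]
      · simp [D, h.zero, h.one, powCoinTime]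
        ring
      · refine ⟨fun v hv1 hv2 => ?_, ?_⟩
        · simp [show v ≠ 0 by omega, show v ≠ 15 by omega, show v ≠ 16 by omega,
            show v ≠ 17 by omega, show v ≠ 18 by omega]
        · simp [h.zero, h.one, h12]
  · intro f hf hI
    have hinv : Agree 15 e f ∧ f 17 ≤ 1 ∧ f 18 ≤ 1 ∧ (f 18 = 1 → f 15 + f 16 ≤ e 8) := by
      by_contra h
      exact hI (if_neg h)
    obtain ⟨hag, h17, h18, hsum⟩ := hinv
    have hr := h.of_agree (by norm_num) hag
    rw [hr.one, mod_two_pow_of_le_one hd h18, mod_two_pow_of_le_one hd le_rfl] at hf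
    have hsum := hsum hf
    have h8 : f 8 = e 8 := hag 8 (by norm_num) (by norm_num)
    obtain ⟨g, hg, hg15, hgv⟩ := det_add (k := k) (e := f) hd (z := 15) (x := 15) (y := 2) hr.zero
      (by norm_num) (by rw [hr.one]; omega)
    simp only [OfNat.ofNat_ne_zero, if_false, hr.one] at hg15
    have hg1 : g 1 = 0 := by rw [hgv 1 (by norm_num) (by norm_num) (by norm_num), hr.zero]
    obtain ⟨g', hg'⟩ : ∃ g', g' = Function.update (Function.update g 18 (g 1)) 0 0 := ⟨_, rfl⟩
    have hg'v : ∀ v, v ≠ 0 → v ≠ 22 → v ≠ 15 → v ≠ 18 → g' v = f v := by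
      intro v h0 h22 h15 h18
      rw [hg', Function.update_of_ne h0, Function.update_of_ne h18, hgv v h0 h22 h15]
    have hg'ag : Agree 15 f g' := fun v h1 h2 =>
      hg'v v (by omega) (by omega) (by omega) (by omega)
    have hr' := hr.of_agree (by norm_num) hg'ag
    have h15' : g' 15 = f 15 + 1 := by rw [hg']; simpa using hg15
    have h16' : g' 16 = f 16 := hg'v 16 (by norm_num) (by norm_num) (by norm_num) (by norm_num)
    have h17' : g' 17 = f 17 := hg'v 17 (by norm_num) (by norm_num) (by norm_num) (by norm_num)
    have h18' : g' 18 = 0 := by rw [hg']; simp [hg1]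
    have h8' : g' 8 = e 8 := by rw [hg'ag 8 (by norm_num) (by norm_num), h8]
    have hθ : theta g' = theta e := by
      rw [theta_of_agree (by norm_num) hg'ag, theta_of_agree (by norm_num) hag]
    have hcr := powFactors_ready hr' (by omega) (by omega) (by omega) (by rw [h8']; exact hroom)
    have hw : coinsProb g' powFactors = f 16 / (f 15 + 1 : ℕ) * theta e := by
      rw [coinsProb_powFactors hr'.one, h15', h16', hθ]
    have hw1 : coinsProb g' powFactors ≤ 1 := coinsProb_le_one hcr
    have hwj : coinsProb g' powFactors ≤ 1 / (f 15 + 1 : ℕ) := by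
      rw [← h15']; exact coinsProb_powFactors_le hr' (by omega)
    have hfail : ∀ g₂, Agree 19 g' g₂ → I g₂ ≤ τ + D (f 17) := by
      intro g₂ hg₂
      have e17 : g₂ 17 = f 17 := by rw [hg₂ 17 (by norm_num) (by norm_num), h17']
      have e18 : g₂ 18 = 0 := by rw [hg₂ 18 (by norm_num) (by norm_num), h18']
      simp only [I]
      rw [if_pos, if_neg (by omega), e17]
      exact ⟨(hag.trans hg'ag).trans (hg₂.of_le (by norm_num)), by omega, by omega, by omega⟩
    have hIf : I f = τ * (if f 15 = 0 then 3 * c else 2 * c : ℕ) +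
        (altSum (theta e) (f 16) (f 15) * D (f 17) +
          (1 - altSum (theta e) (f 16) (f 15)) * D (1 - f 17)) := by
      simp only [I]
      rw [if_pos ⟨hag, h17, h18, fun _ => hsum⟩, if_pos hf]
    have hcopy : Det k d (copy k 18 1) g g' := by
      rw [hg']; exact det_copy hd 18 1 hg1
    cases h16 : f 16 with
    | zero =>
      have hw0 : coinsProb g' powFactors = 0 := by rw [hw, h16]; simp
      refine ⟨_, EBound.seq_det hg (EBound.seq_det hcopy (ebound_coins (A := ∞)
        (B := τ + D (f 17)) hd hr'.zero hr'.one hcr (fun _ _ => EBound.top) hfail)), ?_⟩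
      rw [hw0, hIf, h16, altSum]
      simp only [zero_mul, tsub_zero, one_mul, zero_add, tsub_self, add_zero]
      calc _ = τ * ((add k 15 15 2).size + (copy k 18 1).size + coinsTime k powFactors + 0 + 4 : ℕ)
              + D (f 17) := by push_cast; ring
        _ ≤ τ * c + D (f 17) := by
            rw [hc, trialTime]
            gcongr
            exact Nat.zero_le _
        _ ≤ _ := by
            gcongr
            split_ifs <;> omega
    | succ r =>
      set H := altSum (theta e) r (f 15 + 1) with hH
      have hsucc : ∀ g₂, Agree 19 g' g₂ → EBound k d τ (powSucc k) I g₂ (τ * (powSucc k).size +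
          (τ * (2 * c : ℕ) + (H * D (1 - f 17) + (1 - H) * D (f 17)))) := by
        intro g₂ hg₂
        have e16 : g₂ 16 = r + 1 := by rw [hg₂ 16 (by norm_num) (by norm_num), h16', h16]
        have e17 : g₂ 17 = f 17 := by rw [hg₂ 17 (by norm_num) (by norm_num), h17']
        have e15 : g₂ 15 = f 15 + 1 := by rw [hg₂ 15 (by norm_num) (by norm_num), h15']
        have hr₂ := hr'.of_agree (by norm_num) hg₂
        obtain ⟨g₃, hg₃, hag₃, a16, a17, a18⟩ := powSucc_det (k := k) (e := g₂) hd hr₂.zero hr₂.one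
          (by omega) (by omega)
        have a15 : g₃ 15 = f 15 + 1 := by rw [hag₃ 15 (by norm_num) (by norm_num), e15]
        refine (EBound.of_det hg₃).le (le_of_eq ?_)
        congr 1
        simp only [I]
        rw [if_pos, if_pos a18, a15, if_neg (by omega), a16, a17, e16, e17, Nat.add_sub_cancel,
          show 1 - (1 - f 17) = f 17 by omega]
        refine ⟨((hag.trans hg'ag).trans (hg₂.of_le (by norm_num))).trans
          (hag₃.of_le (by norm_num)), by omega, by omega, fun _ => ?_⟩
        rw [a15, a16, e16]
        omega
      refine ⟨_, EBound.seq_det hg (EBound.seq_det hcopy (ebound_coins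
        (B := τ + D (f 17)) hd hr'.zero hr'.one hcr hsucc hfail)), ?_⟩
      set w := coinsProb g' powFactors with hwdef
      have halt : altSum (theta e) (r + 1) (f 15) = 1 - w * H := by
        rw [altSum, ← hH, hw, h16]
      rw [hIf, h16, halt, ← altSum_step hw1 (altSum_le_one _ _ _)]
      have htime : w * (τ * (2 * c : ℕ)) + τ * c ≤ τ * (if f 15 = 0 then 3 * c else 2 * c : ℕ) := by
        by_cases h0 : f 15 = 0
        · rw [if_pos h0]
          calc _ ≤ 1 * (τ * (2 * c : ℕ)) + τ * c := by gcongr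
            _ = _ := by push_cast; ring
        · rw [if_neg h0]
          have hhalf : w ≤ 1 / 2 := hwj.trans (by
            gcongr
            exact_mod_cast (by omega : 2 ≤ f 15 + 1))
          calc _ ≤ 1 / 2 * (τ * (2 * c : ℕ)) + τ * c := by gcongr
            _ = (2 * (1 / 2)) * (τ * c) + τ * c := by push_cast; ring
            _ = _ := by
              rw [ENNReal.mul_div_cancel (by norm_num) (by norm_num)]
              push_cast; ring
      set X := H * D (1 - f 17) + (1 - H) * D (f 17)
      calc _ ≤ τ + (τ * ((add k 15 15 2).size + 1) + (τ * ((copy k 18 1).size + 1) +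
            (τ * coinsTime k powFactors + (w * (τ * ((powSucc k).size + 1) +
              (τ * (2 * c : ℕ) + X)) + (1 - w) * (τ * ((powSucc k).size + 1) + D (f 17)))))) := by
            gcongr
            · exact le_self_add
            · calc τ = τ * (0 + 1) := by ring
                _ ≤ _ := by gcongr; exact zero_le
        _ = (w * (τ * (2 * c : ℕ)) + τ * c) + (w * X + (1 - w) * D (f 17)) := by
            rw [mix_add hw1, hc, trialTime]
            push_cast
            ring
        _ ≤ _ := by gcongr
  · intro f hf
    by_cases h' : Agree 15 e f ∧ f 17 ≤ 1 ∧ f 18 ≤ 1 ∧ (f 18 = 1 → f 15 + f 16 ≤ e 8)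
    · have h18 : f 18 ≠ 1 := fun h18 =>
        hf (by rw [h18, h'.1 2 (by norm_num) (by norm_num), h.one])
      simp only [I]
      rw [if_pos h', if_neg h18]
      gcongr
      simp only [D]
      split_ifs with h17
      · exact hA f h'.1 h17
      · exact hB f h'.1 (by omega)
    · simp only [I]
      rw [if_neg h']
      exact le_top

end

section

/-! ### The rejection loop -/

/-- `z := (x + y) mod n` for numbers `x`, `y` less than `n`, which is the variable `5`. -/
def addMod (k z x y : ℕ) : Cmd :=
  .seq (add k z x y) (.seq (sub k 22 z 5) (.ite (test k 0 1) (copy k z 22) .skip))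

/-- Accept the proposal: the output `13` becomes `(base + proposal) mod n + 1`, and the variable
`14` is cleared to stop the loop. -/
def accept (k : ℕ) : Cmd := .seq (addMod k 13 11 12) (.seq (add k 13 13 2) (copy k 14 1))

/-- The factors `S / b`, `a / T` of the probability to consider a proposal. -/
def propFactors : List (ℕ × ℕ) := [(6, 4), (3, 7)]

/-- Accept the proposal with probability `(1 - p) ^ proposal`. -/
def powTrial (k : ℕ) : Cmd := .seq (powCoin k) (.ite (test k 17 2) (accept k) .skip)

/-- Decide about a proposal less than `n`. The variable `10` tells whether `m < n`. -/
def decideProposal (k : ℕ) : Cmd :=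
  .ite (test k 10 2) (coins k propFactors (powTrial k)) (powTrial k)

/-- Unless the proposal has been accepted, increase the base `11` by `m`, if `m < n`. -/
def advance (k : ℕ) : Cmd := .ite (test k 14 2) (.ite (test k 10 2) (addMod k 11 11 8) .skip) .skip

/-- A round of the rejection loop: propose a number, accept or reject it. -/
def round (k : ℕ) : Cmd :=
  .seq (randMask k 12 9) (.seq (sub k 22 12 5)
    (.seq (.ite (test k 0 2) (decideProposal k) .skip) (advance k)))

/-- A bound for the expected time of `powTrial`. -/
def powTrialTime (k : ℕ) : ℕ := powCoinTime k + (accept k).size + 3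

/-- A bound for the expected time of `decideProposal`. -/
def decideTime (k : ℕ) : ℕ := coinsTime k propFactors + powTrialTime k + 1

/-- A bound for the expected time of `round`. -/
def roundTime (k : ℕ) : ℕ :=
  (randMask k 12 9).size + (sub k 22 12 5).size + decideTime k + (advance k).size + 10

/-- The probability that a proposal `r < n` is accepted. -/
noncomputable def acceptProb (e : ℕ → ℕ) (r : ℕ) : ℝ≥0∞ :=
  (if e 8 < e 5 then coinsProb e propFactors else 1) * altSum (theta e) r 0

/-- The expected value of a proposal `r`, if acceptance has value `A` and rejection `B`. -/
noncomputable def proposalValue (e : ℕ → ℕ) (r : ℕ) (A B : ℝ≥0∞) : ℝ≥0∞ :=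
  if r < e 5 then acceptProb e r * A + (1 - acceptProb e r) * B else B

/-- The base after a rejection. -/
def nextBase (e : ℕ → ℕ) (β : ℕ) : ℕ := if e 8 < e 5 then (β + e 8) % e 5 else β

/-- The state in which the rejection loop is run. Here `8` is `m`, `9` is the mask for proposals,
`5` is `n`, and `10` tells whether `m < n`. -/
structure LoopReady (k d t : ℕ) (e : ℕ → ℕ) : Prop extends Ready k d e where
  room : 2 * (e 8 + 1) < 2 ^ (d * (k + 2))
  mask : e 9 + 1 = 2 ^ t
  mask_le : 2 ^ t ≤ e 8
  pos₅ : 0 < e 5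
  lt₅ : 2 * e 5 < 2 ^ (d * (k + 2))
  flag : e 10 = if e 8 < e 5 then 1 else 0

variable {k d t : ℕ} {τ : ℝ≥0∞} {F : (ℕ → ℕ) → ℝ≥0∞} {e f : ℕ → ℕ}

theorem LoopReady.of_agree (h : LoopReady k d t e) {n : ℕ} (hn : 11 ≤ n) (hag : Agree n e f) :
    LoopReady k d t f := by
  have hv : ∀ v, 1 ≤ v → v < 11 → f v = e v := fun v h1 h2 => hag v h1 (by omega)
  refine ⟨h.toReady.of_agree (by omega) hag, ?_, ?_, ?_, ?_, ?_, ?_⟩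
  · rw [hv 8 (by norm_num) (by norm_num)]; exact h.room
  · rw [hv 9 (by norm_num) (by norm_num)]; exact h.mask
  · rw [hv 8 (by norm_num) (by norm_num)]; exact h.mask_le
  · rw [hv 5 (by norm_num) (by norm_num)]; exact h.pos₅
  · rw [hv 5 (by norm_num) (by norm_num)]; exact h.lt₅
  · rw [hv 5 (by norm_num) (by norm_num), hv 8 (by norm_num) (by norm_num),
      hv 10 (by norm_num) (by norm_num)]
    exact h.flag

theorem propFactors_ready (h : Ready k d e) : CoinsReady k d e propFactors := by
  intro q hq
  simp only [propFactors, List.mem_cons, List.not_mem_nil, or_false] at hq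
  rcases hq with rfl | rfl
  · exact ⟨by norm_num, by norm_num, h.le₆, h.pos₄, h.lt₄⟩
  · exact ⟨by norm_num, by norm_num, h.le₃, h.pos₇, h.lt₇⟩

theorem acceptProb_le_one (h : Ready k d e) (r : ℕ) : acceptProb e r ≤ 1 := by
  refine mul_le_one' ?_ (altSum_le_one _ _ _)
  split_ifs
  · exact coinsProb_le_one (propFactors_ready h)
  · exact le_rfl

theorem det_addMod (hd : 1 ≤ d) {z x y : ℕ} (h1 : e 1 = 0) (hx : x ≠ 0 ∧ x ≠ 22)
    (hz : z ≠ 0 ∧ z ≠ 1 ∧ z ≠ 5 ∧ z ≠ 22) (hxn : e x < e 5) (hyn : e y < e 5)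
    (hlt : 2 * e 5 < 2 ^ (d * (k + 2))) :
    ∃ f, Det k d (addMod k z x y) e f ∧ f z = (e x + e y) % e 5 ∧
      ∀ v, v ≠ 0 → v ≠ 22 → v ≠ z → f v = e v := by
  obtain ⟨f, hf, hfz, hfv⟩ := det_add (k := k) (e := e) hd (z := z) (x := x) (y := y) h1 hx
    (by omega)
  rw [if_neg hz.1] at hfz
  have hf1 : f 1 = 0 := by rw [hfv 1 (by norm_num) (by norm_num) hz.2.1.symm, h1]
  have hf5 : f 5 = e 5 := hfv 5 (by norm_num) (by norm_num) hz.2.2.1.symm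
  by_cases h : e x + e y < e 5
  · refine ⟨_, hf.seq ((det_sub hd 22 z 5).seq (Det.ite_neg ?_ (sub_simple _ _ _ _) Det.skip)),
      ?_, ?_⟩
    · simp only [subEnv, hfz, hf5]
      rw [if_pos h, if_pos h]
      simp [hf1, show d ≠ 0 by omega]
    · rw [Nat.mod_eq_of_lt h, ← hfz]
      simp [subEnv, hz.1, hz.2.2.2]
    · intro v h0 h22 hvz
      simp [subEnv, h0, h22, hfv v h0 h22 hvz]
  · refine ⟨_, hf.seq ((det_sub hd 22 z 5).seq (Det.ite_pos ?_ (det_copy hd z 22 ?_) trivial)),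
      ?_, ?_⟩
    · simp only [subEnv, hfz, hf5]
      rw [if_neg h, if_neg h]
      simp [hf1]
    · simp [subEnv, hf1]
    · rw [Nat.mod_eq_sub_mod (by omega), Nat.mod_eq_of_lt (by omega)]
      simp [subEnv, hz.1, hfz, hf5, h]
    · intro v h0 h22 hvz
      simp [subEnv, h0, h22, hvz, hfv v h0 h22 hvz]

theorem accept_det (hd : 1 ≤ d) (h : LoopReady k d t e) (h11 : e 11 < e 5) (h12 : e 12 < e 5) :
    ∃ f, Det k d (accept k) e f ∧ Agree 11 e f ∧ f 13 = (e 11 + e 12) % e 5 + 1 ∧ f 14 = 0 := by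
  obtain ⟨f, hf, hfz, hfv⟩ := det_addMod (k := k) (e := e) hd (z := 13) (x := 11) (y := 12) h.zero
    (by norm_num) (by norm_num) h11 h12 h.lt₅
  have hf1 : f 1 = 0 := by rw [hfv 1 (by norm_num) (by norm_num) (by norm_num), h.zero]
  have hf2 : f 2 = 1 := by rw [hfv 2 (by norm_num) (by norm_num) (by norm_num), h.one]
  have hmod := Nat.mod_lt (e 11 + e 12) h.pos₅
  have hlt := h.lt₅
  obtain ⟨g, hg, hgz, hgv⟩ := det_add (k := k) (e := f) hd (z := 13) (x := 13) (y := 2) hf1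
    (by norm_num) (by omega)
  simp only [OfNat.ofNat_ne_zero, if_false, hf2, hfz] at hgz
  have hg1 : g 1 = 0 := by rw [hgv 1 (by norm_num) (by norm_num) (by norm_num), hf1]
  refine ⟨_, hf.seq (hg.seq (det_copy hd 14 1 hg1)), ?_, ?_, ?_⟩
  · intro v h1 h2
    rw [Function.update_of_ne (by omega), Function.update_of_ne (by omega),
      hgv v (by omega) (by omega) (by omega), hfv v (by omega) (by omega) (by omega)]
  · simp [hgz]
  · simp [hg1]

section Value

variable {G : (ℕ → ℕ) → ℝ≥0∞} {A B : ℝ≥0∞}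

theorem ebound_powTrial (hd : 1 ≤ d) (h : LoopReady k d t e) (h11 : e 11 < e 5) (h12 : e 12 < e 5)
    (h12' : e 12 ≤ e 8)
    (hA : ∀ f, Agree 11 e f → f 13 = (e 11 + e 12) % e 5 + 1 → f 14 = 0 → G f ≤ A)
    (hB : ∀ f, Agree 15 e f → G f ≤ B) :
    EBound k d τ (powTrial k) G e (τ * powTrialTime k +
      (altSum (theta e) (e 12) 0 * A + (1 - altSum (theta e) (e 12) 0) * B)) := by
  classical
  let G' : (ℕ → ℕ) → ℝ≥0∞ := fun f =>
    if Agree 15 e f ∧ f 17 = 1 then τ * ((accept k).size + 2) + A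
    else if Agree 15 e f ∧ f 17 = 0 then τ * ((accept k).size + 2) + B else ∞
  have hpow := ebound_powCoin (k := k) (τ := τ) (F := G') hd h.toReady h12' h.room
    (fun f hf h17 => by simp only [G']; rw [if_pos ⟨hf, h17⟩])
    (fun f hf h17 => by simp only [G']; rw [if_neg (by omega), if_pos ⟨hf, h17⟩])
  refine (EBound.seq hpow fun f => ?_).le (le_of_eq ?_)
  · simp only [G']
    split_ifs with hf hf
    · have hr := h.of_agree (by norm_num) hf.1
      have e5 := hf.1 5 (by norm_num) (by norm_num)
      have e11 := hf.1 11 (by norm_num) (by norm_num)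
      have e12 := hf.1 12 (by norm_num) (by norm_num)
      obtain ⟨g, hg, hag, h13, h14⟩ := accept_det (k := k) (e := f) hd hr (by omega) (by omega)
      rw [e5, e11, e12] at h13
      refine (EBound.ite (x := τ * (accept k).size + G g) ?_).le ?_
      · rw [hf.2, hr.one, if_pos rfl]
        exact EBound.of_det hg
      · calc _ = τ * ((accept k).size + 1) + G g := by ring
          _ ≤ _ := by
            gcongr
            · norm_num
            · exact hA g ((hf.1.of_le (by norm_num)).trans hag) h13 h14
    · have hr := h.of_agree (by norm_num) hf.1
      refine (EBound.ite (x := τ + G f) ?_).le ?_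
      · rw [hf.2, hr.one, mod_two_pow_of_le_one hd le_rfl, if_neg (by simp)]
        exact EBound.skip
      · calc _ = τ * (0 + 2) + G f := by ring
          _ ≤ _ := by
            gcongr
            · exact zero_le
            · exact hB f hf.1
    · exact EBound.top
  · rw [mix_add (altSum_le_one _ _ _), powTrialTime]
    push_cast
    ring

theorem ebound_decideProposal (hd : 1 ≤ d) (h : LoopReady k d t e) (h11 : e 11 < e 5)
    (h12 : e 12 < e 5) (h12' : e 12 ≤ e 8)
    (hA : ∀ f, Agree 11 e f → f 13 = (e 11 + e 12) % e 5 + 1 → f 14 = 0 → G f ≤ A)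
    (hB : ∀ f, Agree 15 e f → G f ≤ B) :
    EBound k d τ (decideProposal k) G e (τ * decideTime k +
      (acceptProb e (e 12) * A + (1 - acceptProb e (e 12)) * B)) := by
  set q := altSum (theta e) (e 12) 0 with hq
  have hq1 : q ≤ 1 := altSum_le_one _ _ _
  have htrial : ∀ f, Agree 19 e f → EBound k d τ (powTrial k) G f (τ * powTrialTime k +
      (q * A + (1 - q) * B)) := by
    intro f hf
    have hr := h.of_agree (by norm_num) hf
    have e5 := hf 5 (by norm_num) (by norm_num)
    have e8 := hf 8 (by norm_num) (by norm_num)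
    have e11 := hf 11 (by norm_num) (by norm_num)
    have e12 := hf 12 (by norm_num) (by norm_num)
    rw [hq, ← theta_of_agree (by norm_num) hf, ← e12]
    refine ebound_powTrial hd hr (by omega) (by omega) (by omega) (fun g hg => ?_) fun g hg => ?_
    · rw [e5, e11, e12]
      exact hA g ((hf.of_le (by norm_num)).trans hg)
    · exact hB g ((hf.of_le (by norm_num)).trans hg)
  by_cases hmn : e 8 < e 5
  · have hp1 := coinsProb_le_one (propFactors_ready h.toReady)
    have hcoins := ebound_coins (k := k) (τ := τ) (F := G) (Q := powTrial k) hd h.zero h.one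
      (propFactors_ready h.toReady) htrial (B := B) fun f hf => hB f (hf.of_le (by norm_num))
    refine (EBound.ite_pos ?_ hcoins).le ?_
    · rw [h.flag, if_pos hmn, h.one]
    · rw [acceptProb, if_pos hmn, ← hq, ← mix_mix hp1 hq1]
      set p := coinsProb e propFactors
      set X := q * A + (1 - q) * B
      calc _ ≤ τ + (τ * coinsTime k propFactors + (p * (τ * powTrialTime k + X) +
            (1 - p) * (τ * powTrialTime k + B))) := by
            gcongr
            exact le_add_self
        _ = _ := by
            rw [mix_add hp1, decideTime]
            push_cast
            ring
  · refine (EBound.ite_neg ?_ (htrial e (Agree.refl _ _))).le ?_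
    · rw [h.flag, if_neg hmn, h.one, mod_two_pow_of_le_one hd le_rfl]; simp
    · rw [acceptProb, if_neg hmn, one_mul, ← hq]
      calc _ = τ * (0 + powTrialTime k + 1 : ℕ) + (q * A + (1 - q) * B) := by push_cast; ring
        _ ≤ _ := by
          rw [decideTime]
          gcongr
          exact Nat.zero_le _

theorem ebound_advance (hd : 1 ≤ d) (h : LoopReady k d t e) (h11 : e 11 < e 5) (h14 : e 14 = 1)
    (hA : ∀ f, Agree 11 e f → f 11 = nextBase e (e 11) → f 14 = 1 → G f ≤ A) :
    EBound k d τ (advance k) G e (τ * (advance k).size + A) := by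
  have hsimple : (addMod k 11 11 8).Simple :=
    ⟨⟨sub_simple _ _ _ _, sub_simple _ _ _ _⟩, sub_simple _ _ _ _, sub_simple _ _ _ _, trivial⟩
  by_cases hmn : e 8 < e 5
  · obtain ⟨f, hf, hfz, hfv⟩ := det_addMod (k := k) (e := e) hd (z := 11) (x := 11) (y := 8) h.zero
      (by norm_num) (by norm_num) h11 hmn h.lt₅
    refine (EBound.of_det (Det.ite_pos ?_ (Det.ite_pos ?_ hf (by trivial)) (by trivial))).le ?_
    · rw [h14, h.one]
    · rw [h.flag, if_pos hmn, h.one]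
    · refine add_le_add le_rfl (hA f ?_ ?_ ?_)
      · exact fun v h1 h2 => hfv v (by omega) (by omega) (by omega)
      · rw [hfz, nextBase, if_pos hmn]
      · rw [hfv 14 (by norm_num) (by norm_num) (by norm_num), h14]
  · refine (EBound.of_det (Det.ite_pos ?_ (Det.ite_neg ?_ hsimple Det.skip) (by trivial))).le ?_
    · rw [h14, h.one]
    · rw [h.flag, if_neg hmn, h.one, mod_two_pow_of_le_one hd le_rfl]; simp
    · refine add_le_add le_rfl (hA e (Agree.refl _ _) ?_ h14)
      rw [nextBase, if_neg hmn]

theorem ebound_advance_accepted (hd : 1 ≤ d) (h : LoopReady k d t e) (h14 : e 14 = 0) :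
    EBound k d τ (advance k) G e (τ * (advance k).size + G e) := by
  have hsimple : (addMod k 11 11 8).Simple :=
    ⟨⟨sub_simple _ _ _ _, sub_simple _ _ _ _⟩, sub_simple _ _ _ _, sub_simple _ _ _ _, trivial⟩
  refine EBound.of_det (Det.ite_neg ?_ ⟨hsimple, trivial⟩ Det.skip)
  rw [h14, h.one, mod_two_pow_of_le_one hd le_rfl]
  simp

/-- The part of a round after the proposal has been drawn. -/
theorem ebound_round_rest (hd : 1 ≤ d) (h : LoopReady k d t e) (h11 : e 11 < e 5) (h14 : e 14 = 1)
    (h12 : e 12 < 2 ^ t)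
    (hA : ∀ f, Agree 11 e f → f 13 = (e 11 + e 12) % e 5 + 1 → f 14 = 0 → G f ≤ A)
    (hB : ∀ f, Agree 11 e f → f 11 = nextBase e (e 11) → f 14 = 1 → G f ≤ B) :
    EBound k d τ (.seq (sub k 22 12 5)
      (.seq (.ite (test k 0 2) (decideProposal k) .skip) (advance k))) G e
      (τ * ((sub k 22 12 5).size + decideTime k + (advance k).size + 5 : ℕ) +
        proposalValue e (e 12) A B) := by
  classical
  set g := subEnv k d 22 12 5 e with hg
  have hgv : ∀ v, v ≠ 0 → v ≠ 22 → g v = e v := fun v h0 h22 => by simp [hg, subEnv, h0, h22]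
  have hag : Agree 15 e g := fun v h1 h2 => hgv v (by omega) (by omega)
  have hr := h.of_agree (by norm_num) hag
  have e5 : g 5 = e 5 := hgv 5 (by norm_num) (by norm_num)
  have e8 : g 8 = e 8 := hgv 8 (by norm_num) (by norm_num)
  have e11 : g 11 = e 11 := hgv 11 (by norm_num) (by norm_num)
  have e12 : g 12 = e 12 := hgv 12 (by norm_num) (by norm_num)
  have e14 : g 14 = 1 := by rw [hgv 14 (by norm_num) (by norm_num), h14]
  have g0 : g 0 = if e 12 < e 5 then 1 else 0 := by simp [hg, subEnv]
  have hbase : ∀ f, Agree 15 g f → nextBase f (f 11) = nextBase e (e 11) := by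
    intro f hf
    simp only [nextBase, hf 5 (by norm_num) (by norm_num), hf 8 (by norm_num) (by norm_num),
      hf 11 (by norm_num) (by norm_num), e5, e8, e11]
  -- `G'` bounds the cost of the command `advance`.
  let G' : (ℕ → ℕ) → ℝ≥0∞ := fun f =>
    if Agree 11 e f ∧ f 13 = (e 11 + e 12) % e 5 + 1 ∧ f 14 = 0 then τ * (advance k).size + A
    else if Agree 15 g f then τ * (advance k).size + B else ∞
  have hadv : ∀ f, EBound k d τ (advance k) G f (G' f) := by
    intro f
    simp only [G']
    split_ifs with hf hf
    · have hrf := h.of_agree le_rfl hf.1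
      exact (ebound_advance_accepted hd hrf hf.2.2).le
        (add_le_add le_rfl (hA f hf.1 hf.2.1 hf.2.2))
    · have hrf := hr.of_agree (by norm_num) hf
      have f5 := hf 5 (by norm_num) (by norm_num)
      have f11 := hf 11 (by norm_num) (by norm_num)
      have f14 := hf 14 (by norm_num) (by norm_num)
      refine ebound_advance hd hrf (by omega) (by omega) fun f' hf' h11' h14' => ?_
      exact hB f' (((hag.trans hf).of_le (by norm_num)).trans hf') (by rw [h11', hbase f hf]) h14'
    · exact EBound.top
  have hA' : ∀ f, Agree 11 g f → f 13 = (g 11 + g 12) % g 5 + 1 → f 14 = 0 →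
      G' f ≤ τ * (advance k).size + A := by
    intro f hf h13 h14'
    rw [e11, e12, e5] at h13
    simp only [G']
    rw [if_pos ⟨(hag.of_le (by norm_num)).trans hf, h13, h14'⟩]
  have hB' : ∀ f, Agree 15 g f → G' f ≤ τ * (advance k).size + B := by
    intro f hf
    simp only [G']
    have f14 := hf 14 (by norm_num) (by norm_num)
    rw [if_neg (by omega), if_pos hf]
  have hmask := h.mask_le
  rw [proposalValue]
  by_cases hlt : e 12 < e 5
  · rw [if_pos hlt]
    have hdec := ebound_decideProposal (k := k) (τ := τ) (e := g) (G := G') hd hr (by omega)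
      (by omega) (by omega) hA' hB'
    have hprob : acceptProb g (g 12) = acceptProb e (e 12) := by
      rw [acceptProb, acceptProb, e5, e8, e12, theta_of_agree (by norm_num) hag,
        show coinsProb g propFactors = coinsProb e propFactors by
          simp only [propFactors, coinsProb, hag 6 (by norm_num) (by norm_num),
            hag 4 (by norm_num) (by norm_num), hag 3 (by norm_num) (by norm_num),
            hag 7 (by norm_num) (by norm_num)]]
    refine (EBound.seq_det (det_sub hd 22 12 5) (EBound.seq (EBound.ite_pos ?_ hdec) hadv)).le ?_
    · rw [← hg, g0, if_pos hlt, hr.one]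
    · rw [hprob, mix_add (acceptProb_le_one h.toReady _)]
      calc _ = τ * ((sub k 22 12 5).size + decideTime k + (advance k).size + 3 : ℕ) +
            (acceptProb e (e 12) * A + (1 - acceptProb e (e 12)) * B) := by push_cast; ring
        _ ≤ _ := by
          gcongr
          norm_num
  · rw [if_neg hlt]
    refine (EBound.seq_det (det_sub hd 22 12 5)
      (EBound.seq (EBound.ite_neg ?_ EBound.skip) hadv)).le ?_
    · rw [← hg, g0, if_neg hlt, hr.one, mod_two_pow_of_le_one hd le_rfl]; simp
    · calc _ ≤ τ * ((sub k 22 12 5).size + 1) + (τ + (τ + (τ + (τ * (advance k).size + B)))) := by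
            gcongr
            exact hB' _ (Agree.refl _ _)
        _ = τ * ((sub k 22 12 5).size + 0 + (advance k).size + 4 : ℕ) + B := by push_cast; ring
        _ ≤ _ := by
          gcongr
          · exact Nat.zero_le _
          · norm_num

end Value

theorem proposalValue_add_le (h : Ready k d e) (r : ℕ) (x y A B : ℝ≥0∞) :
    proposalValue e r (x + A) (y + B) ≤ x + proposalValue e r A B + y * proposalValue e r 0 1 := by
  rw [proposalValue, proposalValue, proposalValue]
  split_ifs
  · have h1 := acceptProb_le_one h r
    set p := acceptProb e r
    calc _ = p * x + (p * A + (1 - p) * B) + y * (p * 0 + (1 - p) * 1) := by ring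
      _ ≤ _ := by
        gcongr
        exact mul_le_of_le_one_left' h1
  · rw [mul_one, add_assoc, add_comm B]
    exact le_add_self

/-- The rejection loop has cost at most `Φ base`, apart from time, if `Φ` is preserved by rounds,
and it has expected time `O(1)` if a constant fraction of proposals is accepted. -/
theorem ebound_mainLoop (hd : 1 ≤ d) (h : LoopReady k d t e) (h11 : e 11 < e 5) (h14 : e 14 = 1)
    (Φ v : ℕ → ℝ≥0∞) (hF : ∀ f, Agree 11 e f → F f ≤ v (f 13))
    (hΦ : ∀ β < e 5, ∑ r ∈ Finset.range (2 ^ t),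
      proposalValue e r (v ((β + r) % e 5 + 1)) (Φ (nextBase e β)) ≤ 2 ^ t * Φ β)
    (htime : 8 * ∑ r ∈ Finset.range (2 ^ t), proposalValue e r 0 1 ≤ 7 * 2 ^ t) :
    EBound k d τ (.loop (test k 14 2) (round k)) F e (τ * (8 * roundTime k : ℕ) + Φ (e 11)) := by
  classical
  set c := roundTime k with hc
  let I : (ℕ → ℕ) → ℝ≥0∞ := fun f =>
    if Agree 11 e f ∧ f 14 ≤ 1 ∧ (f 14 = 1 → f 11 < e 5) then
      if f 14 = 1 then τ * (8 * c : ℕ) + Φ (f 11) else τ + v (f 13)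
    else ∞
  have hIe : I e = τ * (8 * c : ℕ) + Φ (e 11) := by
    simp only [I]
    rw [if_pos ⟨Agree.refl _ _, by omega, fun _ => h11⟩, if_pos h14]
  rw [← hIe]
  refine EBound.loop I ?_ ?_ e
  · intro f hf hI
    have hinv : Agree 11 e f ∧ f 14 ≤ 1 ∧ (f 14 = 1 → f 11 < e 5) := by
      by_contra h
      exact hI (if_neg h)
    obtain ⟨hag, h14', h11'⟩ := hinv
    have hr := h.of_agree le_rfl hag
    rw [hr.one, mod_two_pow_of_le_one hd h14', mod_two_pow_of_le_one hd le_rfl] at hf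
    have h11' := h11' hf
    have f5 : f 5 = e 5 := hag 5 (by norm_num) (by norm_num)
    have f8 : f 8 = e 8 := hag 8 (by norm_num) (by norm_num)
    have hIf : I f = τ * (8 * c : ℕ) + Φ (f 11) := by
      simp only [I]
      rw [if_pos ⟨hag, h14', fun _ => h11'⟩, if_pos hf]
    set β := f 11 with hβ
    have hnb : nextBase f β = nextBase e β := by simp only [nextBase, f5, f8]
    have hnblt : nextBase e β < e 5 := by
      rw [nextBase]
      split_ifs
      · exact Nat.mod_lt _ h.pos₅
      · exact h11'
    have hpv : ∀ r A B, proposalValue f r A B = proposalValue e r A B := by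
      intro r A B
      simp only [proposalValue, acceptProb, f5, f8, theta_of_agree (by norm_num : 9 ≤ 11) hag,
        propFactors, coinsProb, hag 6 (by norm_num) (by norm_num),
        hag 4 (by norm_num) (by norm_num), hag 3 (by norm_num) (by norm_num),
        hag 7 (by norm_num) (by norm_num)]
    set c' := (sub k 22 12 5).size + decideTime k + (advance k).size + 5 with hc'
    let w : ℕ → ℝ≥0∞ := fun r => τ * c' + proposalValue e r (τ + v ((β + r) % e 5 + 1))
      (τ * (8 * c : ℕ) + Φ (nextBase e β))
    let G : (ℕ → ℕ) → ℝ≥0∞ := fun g =>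
      if g 12 < 2 ^ t ∧ g = Function.update f 12 (g 12) then w (g 12) else ∞
    have hrand := ebound_randMask (k := k) (d := d) (τ := τ) (F := G) (e := f) (z := 12) (w := 9)
      (by norm_num) hr.mask
    have hsum : ∑ r ∈ Finset.range (2 ^ t), G (Function.update f 12 r) =
        ∑ r ∈ Finset.range (2 ^ t), w r := by
      refine Finset.sum_congr rfl fun r hr => ?_
      simp only [G]
      rw [Function.update_self, if_pos ⟨Finset.mem_range.mp hr, rfl⟩]
    rw [hsum] at hrand
    refine ⟨_, EBound.seq hrand fun g => ?_, ?_⟩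
    · simp only [G]
      split_ifs with hg
      · have hgv : ∀ v, v ≠ 12 → g v = f v := fun v hv => by
          rw [hg.2, Function.update_of_ne hv]
        have hag' : Agree 11 f g := fun v h1 h2 => hgv v (by omega)
        have hrg := hr.of_agree le_rfl hag'
        have g5 : g 5 = e 5 := by rw [hgv 5 (by norm_num), f5]
        have g8 : g 8 = e 8 := by rw [hgv 8 (by norm_num), f8]
        have g11 : g 11 = β := hgv 11 (by norm_num)
        have g14 : g 14 = 1 := by rw [hgv 14 (by norm_num), hf]
        have hpv' : ∀ r A B, proposalValue g r A B = proposalValue e r A B := by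
          intro r A B
          rw [← hpv]
          simp only [proposalValue, acceptProb, g5, g8, f5, f8,
            theta_of_agree (by norm_num : 9 ≤ 11) hag',
            propFactors, coinsProb, hag' 6 (by norm_num) (by norm_num),
            hag' 4 (by norm_num) (by norm_num), hag' 3 (by norm_num) (by norm_num),
            hag' 7 (by norm_num) (by norm_num)]
        simp only [w]
        rw [← hpv', hc']
        refine ebound_round_rest hd hrg (by omega) g14 hg.1 (fun f' hf' h13 h14 => ?_)
          fun f' hf' h11 h14 => ?_
        · simp only [I]
          rw [if_pos ⟨(hag.trans hag').trans hf', by omega, by omega⟩, if_neg (by omega), h13,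
            g11, g5]
        · have hnb' : nextBase g (g 11) = nextBase e β := by simp only [nextBase, g5, g8, g11]
          rw [hnb'] at h11
          simp only [I]
          rw [if_pos ⟨(hag.trans hag').trans hf', by omega, fun _ => by omega⟩, if_pos h14, h11]
      · exact EBound.top
    · rw [hIf]
      have hle : ∑ r ∈ Finset.range (2 ^ t), w r ≤ (2 ^ t) * (τ * (c' + 1 : ℕ)) + 2 ^ t * Φ β +
          τ * (8 * c : ℕ) * ∑ r ∈ Finset.range (2 ^ t), proposalValue e r 0 1 := by
        calc _ ≤ ∑ r ∈ Finset.range (2 ^ t), (τ * c' + (τ +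
              proposalValue e r (v ((β + r) % e 5 + 1)) (Φ (nextBase e β)) +
              τ * (8 * c : ℕ) * proposalValue e r 0 1)) := by
              refine Finset.sum_le_sum fun r _ => ?_
              simp only [w]
              gcongr
              exact proposalValue_add_le h.toReady _ _ _ _ _
          _ = (2 ^ t) * (τ * (c' + 1 : ℕ)) + (∑ r ∈ Finset.range (2 ^ t),
                proposalValue e r (v ((β + r) % e 5 + 1)) (Φ (nextBase e β))) +
              τ * (8 * c : ℕ) * ∑ r ∈ Finset.range (2 ^ t), proposalValue e r 0 1 := by
              simp only [Finset.sum_add_distrib, ← Finset.mul_sum, Finset.sum_const,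
                Finset.card_range, nsmul_eq_mul]
              push_cast
              ring
          _ ≤ _ := by
              gcongr
              exact hΦ β h11'
      have hle' : (∑ r ∈ Finset.range (2 ^ t), w r) / 2 ^ t ≤ τ * (c' + 1 : ℕ) + Φ β +
          τ * (7 * c : ℕ) := by
        refine ENNReal.div_le_of_le_mul (hle.trans ?_)
        calc _ = (2 ^ t) * (τ * (c' + 1 : ℕ)) + 2 ^ t * Φ β + τ * c *
              (8 * ∑ r ∈ Finset.range (2 ^ t), proposalValue e r 0 1) := by push_cast; ring
          _ ≤ (2 ^ t) * (τ * (c' + 1 : ℕ)) + 2 ^ t * Φ β + τ * c * (7 * 2 ^ t) := by gcongr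
          _ = _ := by push_cast; ring
      calc _ ≤ τ + (τ + (τ * (randMask k 12 9).size + (τ * (c' + 1 : ℕ) + Φ β +
            τ * (7 * c : ℕ)))) := by gcongr
        _ = τ * ((randMask k 12 9).size + c' + 3 + 7 * c : ℕ) + Φ β := by push_cast; ring
        _ ≤ _ := by
          gcongr
          rw [hc, roundTime, hc']
          omega
  · intro f hf
    by_cases h' : Agree 11 e f ∧ f 14 ≤ 1 ∧ (f 14 = 1 → f 11 < e 5)
    · have h14' : f 14 ≠ 1 := fun h14' =>
        hf (by rw [h14', h'.1 2 (by norm_num) (by norm_num), h.one])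
      simp only [I]
      rw [if_pos h', if_neg h14']
      gcongr
      exact hF f h'.1
    · simp only [I]
      rw [if_neg h']
      exact le_top

end

section

/-! ### Preparation of the rejection loop -/

/-- Divide the variable `8` by the variable `21`, both powers of two: the zero bits at the end of
`21` are removed from both, those of a word at a time. -/
def divPow (k : ℕ) : ℕ → Cmd
  | 0 => .skip
  | n + 1 => .seq (shr k 8 21) (.seq (shr k 21 21) (divPow k n))

/-- Compute powers of two `S` (variable `6`) and `T` (variable `7`) next to `b` and `a`. -/
def powers (k : ℕ) : Cmd := .seq (topPow k 6 4) (.seq (topPow k 7 3) (add k 7 7 7))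

/-- Set the variable `8` to `m = S / T`; if `S < T`, replace `S` and `T` by `a`, and `m` by `1`. -/
def blockSize (k : ℕ) : Cmd :=
  .seq (sub k 22 6 7) (.ite (test k 0 2)
    (.seq (copy k 6 3) (.seq (copy k 7 3) (copy k 8 2)))
    (.seq (copy k 8 6) (.seq (copy k 21 7) (divPow k (k + 2)))))

/-- Set the variable `10` to `1` if `m < n`, and `9` to the mask for proposals. -/
def proposalMask (k : ℕ) : Cmd :=
  .seq (topPow k 9 5) (.seq (add k 9 9 9) (.seq (sub k 22 8 5) (.seq (copy k 10 0)
    (.seq (sub k 22 8 9) (.seq (.ite (test k 0 2) (copy k 9 8) .skip)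
      (.seq (sub k 9 9 2) (copy k 14 2)))))))

/-- All that is done before the rejection loop, except for reading the input. -/
def setup (k : ℕ) : Cmd := .seq (powers k) (.seq (blockSize k) (proposalMask k))

variable {k d : ℕ} {e : ℕ → ℕ}

theorem det_topPow (hd : 1 ≤ d) {z v : ℕ} (hzv : z ≠ v) (hv : e v ≠ 0) :
    Det k d (topPow k z v) e (Function.update e z (2 ^ Nat.log2 (e v))) := by
  refine ⟨topPow_simple _ _ _, ?_⟩
  rintro s rfl
  exact env_topPow hd hzv s hv

theorem det_shr {z t w : ℕ} (ht : e t = 2 ^ w) :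
    Det k d (shr k z t) e (Function.update e z (e z / 2 ^ min w d)) := by
  refine ⟨shr_simple _ _ _, ?_⟩
  rintro s rfl
  exact env_shr s ht

theorem divPow_simple (k n : ℕ) : (divPow k n).Simple := by
  induction n with
  | zero => trivial
  | succ n ih => exact ⟨shr_simple _ _ _, shr_simple _ _ _, ih⟩

theorem det_divPow {u w n : ℕ} (h8 : e 8 = 2 ^ (u + w)) (h21 : e 21 = 2 ^ w) (hw : w ≤ d * n) :
    ∃ f, Det k d (divPow k n) e f ∧ f 8 = 2 ^ u ∧ ∀ v, v ≠ 8 → v ≠ 21 → f v = e v := by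
  induction n generalizing w e with
  | zero =>
    obtain rfl : w = 0 := by simpa using hw
    exact ⟨e, Det.skip, h8, fun _ _ _ => rfl⟩
  | succ n ih =>
    have hmin : min w d ≤ w := min_le_left _ _
    have h1 : Function.update e 8 (e 8 / 2 ^ min w d) 21 = 2 ^ w := by
      rw [Function.update_of_ne (by norm_num), h21]
    obtain ⟨f, hf, hf8, hfv⟩ := ih (w := w - min w d)
      (e := Function.update (Function.update e 8 (e 8 / 2 ^ min w d)) 21
        (Function.update e 8 (e 8 / 2 ^ min w d) 21 / 2 ^ min w d))
      (by
        rw [Function.update_of_ne (by norm_num), Function.update_self, h8,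
          Nat.pow_div (by omega) (by norm_num)]
        congr 1
        omega)
      (by rw [Function.update_self, h1, Nat.pow_div hmin (by norm_num)])
      (by rw [Nat.mul_succ] at hw; omega)
    refine ⟨f, (det_shr h21).seq ((det_shr h1).seq hf), hf8, fun v h8 h21 => ?_⟩
    rw [hfv v h8 h21, Function.update_of_ne h21, Function.update_of_ne h8]

theorem det_powers (hd : 1 ≤ d) (h1 : e 1 = 0) (h3 : e 3 ≠ 0) (h4 : e 4 ≠ 0)
    (hlt : 4 * e 3 < 2 ^ (d * (k + 2))) :
    ∃ f, Det k d (powers k) e f ∧ f 6 = 2 ^ Nat.log2 (e 4) ∧ f 7 = 2 ^ (Nat.log2 (e 3) + 1) ∧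
      ∀ v, v ≠ 0 → v ≠ 6 → v ≠ 7 → v ≠ 22 → f v = e v := by
  have hlog := Nat.log2_self_le h3
  set e₁ := Function.update e 6 (2 ^ Nat.log2 (e 4)) with he₁
  have he3 : e₁ 3 = e 3 := by simp [he₁]
  set e₂ := Function.update e₁ 7 (2 ^ Nat.log2 (e₁ 3)) with he₂
  have he7 : e₂ 7 = 2 ^ Nat.log2 (e 3) := by simp [he₂, he3]
  obtain ⟨f, hf, hfz, hfv⟩ := det_add (k := k) (e := e₂) hd (z := 7) (x := 7) (y := 7)
    (by simp [he₂, he₁, h1]) (by norm_num) (by rw [he7]; omega)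
  rw [if_neg (by norm_num)] at hfz
  refine ⟨f, (det_topPow hd (by norm_num) h4).seq ((det_topPow hd (by norm_num)
    (by rw [← he₁, he3]; exact h3)).seq hf), ?_, ?_, ?_⟩
  · rw [hfv 6 (by norm_num) (by norm_num) (by norm_num)]
    simp [he₂, he₁]
  · rw [hfz, he7]; ring
  · intro v h0 h6 h7 h22
    rw [hfv v h0 h22 h7, he₂, Function.update_of_ne h7, he₁, Function.update_of_ne h6]

theorem det_blockSize (hd : 1 ≤ d) {s t : ℕ} (h1 : e 1 = 0) (h2 : e 2 = 1) (h6 : e 6 = 2 ^ s)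
    (h7 : e 7 = 2 ^ t) (h7' : e 7 < 2 ^ (d * (k + 2))) :
    ∃ f, Det k d (blockSize k) e f ∧
      ((s < t ∧ f 6 = e 3 ∧ f 7 = e 3 ∧ f 8 = 1) ∨
        (t ≤ s ∧ f 6 = e 6 ∧ f 7 = e 7 ∧ f 8 = 2 ^ (s - t))) ∧
      ∀ v, v ≠ 0 → v ≠ 6 → v ≠ 7 → v ≠ 8 → v ≠ 21 → v ≠ 22 → f v = e v := by
  set e₁ := subEnv k d 22 6 7 e with he₁
  have e₁v : ∀ v, v ≠ 0 → v ≠ 22 → e₁ v = e v := fun v h0 h22 => by simp [he₁, subEnv, h0, h22]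
  have e₁0 : e₁ 0 = if e 6 < e 7 then 1 else 0 := by simp [he₁, subEnv]
  have e₁1 : e₁ 1 = 0 := by rw [e₁v 1 (by norm_num) (by norm_num), h1]
  have e₁2 : e₁ 2 = 1 := by rw [e₁v 2 (by norm_num) (by norm_num), h2]
  have e₁3 : e₁ 3 = e 3 := e₁v 3 (by norm_num) (by norm_num)
  have e₁6 : e₁ 6 = e 6 := e₁v 6 (by norm_num) (by norm_num)
  have e₁7 : e₁ 7 = e 7 := e₁v 7 (by norm_num) (by norm_num)
  have hlt : e 6 < e 7 ↔ s < t := by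
    rw [h6, h7]
    exact Nat.pow_lt_pow_iff_right (by norm_num)
  by_cases hst : s < t
  · refine ⟨_, (det_sub hd 22 6 7).seq (Det.ite_pos ?_ ((det_copy hd 6 3 ?_).seq
      ((det_copy hd 7 3 ?_).seq (det_copy hd 8 2 ?_))) ?_), Or.inl ⟨hst, ?_, ?_, ?_⟩, ?_⟩
    · rw [← he₁, e₁0, if_pos (hlt.mpr hst), e₁2]
    · rw [← he₁, e₁1]
    · simp [← he₁, e₁1]
    · simp [← he₁, e₁1]
    · exact ⟨sub_simple _ _ _ _, sub_simple _ _ _ _, divPow_simple _ _⟩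
    · simp [← he₁, e₁3]
    · simp [← he₁, e₁3]
    · simp [← he₁, e₁2]
    · intro v h0 h6 h7 h8 h21 h22
      simp [← he₁, h0, h6, h7, h8, e₁v v h0 h22]
  · set e₂ := Function.update (Function.update e₁ 8 (e₁ 6)) 0 0 with he₂
    set e₃ := Function.update (Function.update e₂ 21 (e₂ 7)) 0 0 with he₃
    have e₃8 : e₃ 8 = 2 ^ (s - t + t) := by
      rw [Nat.sub_add_cancel (by omega)]
      simp [he₃, he₂, e₁6, h6]
    have e₃21 : e₃ 21 = 2 ^ t := by simp [he₃, he₂, e₁7, h7]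
    obtain ⟨f, hf, hf8, hfv⟩ := det_divPow (k := k) (d := d) (n := k + 2) e₃8 e₃21 (by
      rw [h7] at h7'
      exact ((Nat.pow_lt_pow_iff_right (by norm_num)).mp h7').le)
    have hv : ∀ v, v ≠ 0 → v ≠ 8 → v ≠ 21 → v ≠ 22 → f v = e v := by
      intro v h0 h8 h21 h22
      rw [hfv v h8 h21]
      simp [he₃, he₂, h0, h8, h21, e₁v v h0 h22]
    refine ⟨f, (det_sub hd 22 6 7).seq (Det.ite_neg ?_ ⟨sub_simple _ _ _ _, sub_simple _ _ _ _,
      sub_simple _ _ _ _⟩ ((det_copy hd 8 6 e₁1).seq ((det_copy hd 21 7 ?_).seq hf))),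
      Or.inr ⟨by omega, hv 6 (by norm_num) (by norm_num) (by norm_num) (by norm_num),
        hv 7 (by norm_num) (by norm_num) (by norm_num) (by norm_num), hf8⟩,
      fun v h0 _ _ h8 h21 h22 => hv v h0 h8 h21 h22⟩
    · rw [← he₁, e₁0, if_neg (fun h => hst (hlt.mp h)), e₁2, mod_two_pow_of_le_one hd le_rfl]
      simp
    · rw [← he₂]; simp [he₂, e₁1]

theorem det_proposalMask (hd : 1 ≤ d) {u : ℕ} (h1 : e 1 = 0) (h2 : e 2 = 1) (h5 : e 5 ≠ 0)
    (h5' : 4 * e 5 < 2 ^ (d * (k + 2))) (h8 : e 8 = 2 ^ u) :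
    ∃ f t, Det k d (proposalMask k) e f ∧ f 9 + 1 = 2 ^ t ∧
      t = min u (Nat.log2 (e 5) + 1) ∧ f 10 = (if e 8 < e 5 then 1 else 0) ∧ f 14 = 1 ∧
      ∀ v, v ≠ 0 → v ≠ 9 → v ≠ 10 → v ≠ 14 → v ≠ 22 → f v = e v := by
  have hlog := Nat.log2_self_le h5
  set e₁ := Function.update e 9 (2 ^ Nat.log2 (e 5)) with he₁
  obtain ⟨f, hf, hfz, hfv⟩ := det_add (k := k) (e := e₁) hd (z := 9) (x := 9) (y := 9)
    (by simp [he₁, h1]) (by norm_num) (by simp [he₁]; omega)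
  rw [if_neg (by norm_num)] at hfz
  have f9 : f 9 = 2 ^ (Nat.log2 (e 5) + 1) := by rw [hfz]; simp [he₁]; ring
  have hfv' : ∀ v, v ≠ 0 → v ≠ 9 → v ≠ 22 → f v = e v := by
    intro v h0 h9 h22
    rw [hfv v h0 h22 h9, he₁, Function.update_of_ne h9]
  have f1 : f 1 = 0 := by rw [hfv' 1 (by norm_num) (by norm_num) (by norm_num), h1]
  have f2 : f 2 = 1 := by rw [hfv' 2 (by norm_num) (by norm_num) (by norm_num), h2]
  have f5 : f 5 = e 5 := hfv' 5 (by norm_num) (by norm_num) (by norm_num)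
  have f8 : f 8 = e 8 := hfv' 8 (by norm_num) (by norm_num) (by norm_num)
  set g := subEnv k d 22 8 9 (Function.update (Function.update (subEnv k d 22 8 5 f) 10
    (subEnv k d 22 8 5 f 0)) 0 0) with hg
  have hgv : ∀ v, v ≠ 0 → v ≠ 10 → v ≠ 22 → g v = f v := fun v h0 h10 h22 => by
    simp [hg, subEnv, h0, h10, h22]
  have g0 : g 0 = if f 8 < f 9 then 1 else 0 := by simp [hg, subEnv]
  have g10 : g 10 = if e 8 < e 5 then 1 else 0 := by simp [hg, subEnv, f5, f8]
  have g1 : g 1 = 0 := by rw [hgv 1 (by norm_num) (by norm_num) (by norm_num), f1]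
  have g2 : g 2 = 1 := by rw [hgv 2 (by norm_num) (by norm_num) (by norm_num), f2]
  have g8 : g 8 = 2 ^ u := by rw [hgv 8 (by norm_num) (by norm_num) (by norm_num), f8, h8]
  have g9 : g 9 = 2 ^ (Nat.log2 (e 5) + 1) := by
    rw [hgv 9 (by norm_num) (by norm_num) (by norm_num), f9]
  set t := min u (Nat.log2 (e 5) + 1) with ht
  have hpow : (2 : ℕ) ^ u < 2 ^ (Nat.log2 (e 5) + 1) ↔ u < Nat.log2 (e 5) + 1 :=
    Nat.pow_lt_pow_iff_right (by norm_num)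
  obtain ⟨g', hg', hg'9, hg'v⟩ : ∃ g', Det k d (.ite (test k 0 2) (copy k 9 8) .skip) g g' ∧
      g' 9 = 2 ^ t ∧ ∀ v, v ≠ 0 → v ≠ 9 → g' v = g v := by
    by_cases hlt : f 8 < f 9
    · have hut : t = u := by
        rw [f8, h8, f9, hpow] at hlt
        rw [ht]; omega
      refine ⟨_, Det.ite_pos ?_ (det_copy hd 9 8 g1) (by trivial), ?_, ?_⟩
      · rw [g0, if_pos hlt, g2]
      · simp [g8, hut]
      · intro v h0 h9
        simp [h0, h9]
    · have hut : t = Nat.log2 (e 5) + 1 := by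
        rw [f8, h8, f9, hpow] at hlt
        rw [ht]; omega
      refine ⟨g, Det.ite_neg ?_ (sub_simple _ _ _ _) Det.skip, by rw [g9, hut], fun _ _ _ => rfl⟩
      rw [g0, if_neg hlt, g2, mod_two_pow_of_le_one hd le_rfl]
      simp
  have g'1 : g' 1 = 0 := by rw [hg'v 1 (by norm_num) (by norm_num), g1]
  have g'2 : g' 2 = 1 := by rw [hg'v 2 (by norm_num) (by norm_num), g2]
  have hpos : 0 < 2 ^ t := by positivity
  refine ⟨_, t, (det_topPow hd (by norm_num) h5).seq (hf.seq ((det_sub hd 22 8 5).seq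
    ((det_copy hd 10 0 ?_).seq ((det_sub hd 22 8 9).seq (hg'.seq ((det_sub hd 9 9 2).seq
      (det_copy hd 14 2 ?_))))))), ?_, rfl, ?_, ?_, ?_⟩
  · simp [subEnv, f1]
  · simp [subEnv, g'1]
  · have : ¬ 2 ^ t < 1 := by omega
    simp only [subEnv, g'2, hg'9]
    simp [this]
    omega
  · simp [subEnv, hg'v 10, g10]
  · simp [subEnv, g'2]
  · intro v h0 h9 h10 h14 h22
    simp [subEnv, h0, h9, h14, hg'v v h0 h9, hgv v h0 h10 h22, hfv' v h0 h9 h22]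

/-- The preparation finds a block size `m` and a size `2 ^ t` of the range of proposals such that
`m * p` and the proportion of useful proposals are between constants. -/
theorem det_setup (hd : 1 ≤ d) {a b n : ℕ} (ha : 0 < a) (hab : a < b) (hb : b < 2 ^ (k * d))
    (hn : 1 ≤ n) (hn' : n < 2 ^ (k * d)) :
    ∃ f t, Det k d (setup k) (inputEnv a b n) f ∧ LoopReady k d t f ∧ f 3 = a ∧ f 4 = b ∧
      f 5 = n ∧ f 11 = 0 ∧ f 14 = 1 ∧ f 6 = f 8 * f 7 ∧ b < 4 * (f 8 * a) ∧
      (f 8 < n → 2 ^ t = f 8) ∧ (n ≤ f 8 → n ≤ 2 ^ t ∧ 2 ^ t ≤ 2 * n) := by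
  have hW : 4 * 2 ^ (k * d) ≤ 2 ^ (d * (k + 2)) := by
    calc 4 * 2 ^ (k * d) = 2 ^ (2 + k * d) := by rw [pow_add]; norm_num
      _ ≤ _ := Nat.pow_le_pow_right (by norm_num) (by nlinarith)
  obtain ⟨e₁, hd₁, e₁6, e₁7, hv₁⟩ := det_powers (k := k) (e := inputEnv a b n) hd
    (by simp [inputEnv]) (by simp [inputEnv]; omega) (by simp [inputEnv]; omega)
    (by simp [inputEnv]; omega)
  have i3 : inputEnv a b n 3 = a := by simp [inputEnv]
  have i4 : inputEnv a b n 4 = b := by simp [inputEnv]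
  rw [i4] at e₁6
  rw [i3] at e₁7
  have alog := Nat.log2_self_le ha.ne'
  have alog' : a < 2 ^ (Nat.log2 a + 1) := Nat.lt_log2_self
  have blog := Nat.log2_self_le (ha.trans hab).ne'
  have blog' : b < 2 ^ (Nat.log2 b + 1) := Nat.lt_log2_self
  have nlog := Nat.log2_self_le (show n ≠ 0 by omega)
  have nlog' : n < 2 ^ (Nat.log2 n + 1) := Nat.lt_log2_self
  rw [pow_succ] at alog' blog' nlog'
  have e₁1 : e₁ 1 = 0 := by rw [hv₁ 1] <;> simp [inputEnv]
  have e₁2 : e₁ 2 = 1 := by rw [hv₁ 2] <;> simp [inputEnv]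
  have e₁3 : e₁ 3 = a := by rw [hv₁ 3] <;> simp [inputEnv]
  obtain ⟨e₂, hd₂, hcase, hv₂⟩ := det_blockSize (k := k) (e := e₁) hd e₁1 e₁2 e₁6 e₁7 (by
    rw [e₁7, pow_succ]; omega)
  have hv₂' : ∀ v, v ≠ 0 → v ≠ 6 → v ≠ 7 → v ≠ 8 → v ≠ 21 → v ≠ 22 →
      e₂ v = inputEnv a b n v := fun v h0 h6 h7 h8 h21 h22 => by
    rw [hv₂ v h0 h6 h7 h8 h21 h22, hv₁ v h0 h6 h7 h22]
  rw [e₁3, e₁6, e₁7] at hcase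
  have hm : ∃ u, e₂ 8 = 2 ^ u := by
    rcases hcase with ⟨-, -, -, h⟩ | ⟨-, -, -, h⟩
    · exact ⟨0, h⟩
    · exact ⟨_, h⟩
  obtain ⟨u, hu⟩ := hm
  have hST : e₂ 6 = e₂ 8 * e₂ 7 ∧ e₂ 6 ≤ b ∧ a ≤ e₂ 7 ∧ e₂ 7 ≤ 2 * a ∧ e₂ 8 ≤ b ∧
      b < 4 * (e₂ 8 * a) := by
    rcases hcase with ⟨hst, h6, h7, h8⟩ | ⟨hst, h6, h7, h8⟩
    · have hpow : 2 ^ Nat.log2 b ≤ 2 ^ Nat.log2 a :=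
        Nat.pow_le_pow_right (by norm_num) (by omega)
      rw [h6, h7, h8]
      omega
    · have hmul : 2 ^ Nat.log2 b = 2 ^ (Nat.log2 b - (Nat.log2 a + 1)) * 2 ^ (Nat.log2 a + 1) := by
        rw [← pow_add]; congr 1; omega
      have h1 : e₂ 8 * (2 * 2 ^ Nat.log2 a) ≤ e₂ 8 * (2 * a) := Nat.mul_le_mul_left _ (by omega)
      have h2 : e₂ 8 * (2 * 2 ^ Nat.log2 a) = 2 ^ Nat.log2 b := by
        rw [hmul, h8, pow_succ]; ring
      have h3 : e₂ 8 ≤ e₂ 8 * (2 * 2 ^ Nat.log2 a) := Nat.le_mul_of_pos_right _ (by positivity)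
      have h4 : e₂ 8 * (2 * a) = 2 * (e₂ 8 * a) := by ring
      refine ⟨by rw [h6, h7, h8, hmul], by omega, by rw [h7, pow_succ]; omega,
        by rw [h7, pow_succ]; omega, by omega, by omega⟩
  obtain ⟨hST1, hST2, hST3, hST4, hST5, hST6⟩ := hST
  have e₂1 : e₂ 1 = 0 := by rw [hv₂' 1] <;> simp [inputEnv]
  have e₂2 : e₂ 2 = 1 := by rw [hv₂' 2] <;> simp [inputEnv]
  have e₂5 : e₂ 5 = n := by rw [hv₂' 5] <;> simp [inputEnv]
  obtain ⟨f, t, hd₃, hf9, ht, hf10, hf14, hv₃⟩ := det_proposalMask (k := k) (e := e₂) hd e₂1 e₂2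
    (by omega) (by omega) hu
  have f1 : f 1 = 0 := by
    rw [hv₃ 1 (by norm_num) (by norm_num) (by norm_num) (by norm_num) (by norm_num), e₂1]
  have f2 : f 2 = 1 := by
    rw [hv₃ 2 (by norm_num) (by norm_num) (by norm_num) (by norm_num) (by norm_num), e₂2]
  have f3 : f 3 = a := by rw [hv₃ 3, hv₂' 3] <;> simp [inputEnv]
  have f4 : f 4 = b := by rw [hv₃ 4, hv₂' 4] <;> simp [inputEnv]
  have f5 : f 5 = n := by rw [hv₃ 5, hv₂' 5] <;> simp [inputEnv]
  have f6 : f 6 = e₂ 6 := by rw [hv₃ 6] <;> simp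
  have f7 : f 7 = e₂ 7 := by rw [hv₃ 7] <;> simp
  have f8 : f 8 = e₂ 8 := by rw [hv₃ 8] <;> simp
  have f11 : f 11 = 0 := by rw [hv₃ 11, hv₂' 11] <;> simp [inputEnv]
  rw [e₂5] at ht hf10
  have hpos8 : 0 < e₂ 8 := by rw [hu]; positivity
  have htle : 2 ^ t ≤ e₂ 8 := by
    rw [hu]; exact Nat.pow_le_pow_right (by norm_num) (by omega)
  refine ⟨f, t, hd₁.seq (hd₂.seq hd₃), ⟨⟨f1, f2, ?_, ?_, ?_, ?_, ?_, ?_, ?_, ?_⟩, ?_, hf9, ?_, ?_,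
    ?_, ?_⟩, f3, f4, f5, f11, hf14, ?_, ?_, ?_, ?_⟩ <;>
    (try rw [f3]) <;> (try rw [f4]) <;> (try rw [f5]) <;> (try rw [f6]) <;> (try rw [f7]) <;>
    (try rw [f8]) <;> (try omega)
  · intro hlt
    rw [hu] at hlt ⊢
    have : u < Nat.log2 n + 1 := by
      rw [← Nat.pow_lt_pow_iff_right (show 1 < 2 by norm_num), pow_succ]
      omega
    rw [ht, min_eq_left this.le]
  · intro hle
    rw [hu] at hle
    rcases le_total u (Nat.log2 n + 1) with h | h
    · rw [ht, min_eq_left h]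
      have : 2 ^ u ≤ 2 ^ (Nat.log2 n + 1) := Nat.pow_le_pow_right (by norm_num) h
      rw [pow_succ] at this
      omega
    · rw [ht, min_eq_right h, pow_succ]
      omega

end

section

/-! ### Real identities and estimates -/

/-- The real counterpart of `altSum`. -/
noncomputable def realAltSum (θ : ℝ) : ℕ → ℕ → ℝ
  | 0, _ => 1
  | r + 1, j => 1 - (r + 1 : ℕ) / (j + 1 : ℕ) * θ * realAltSum θ r (j + 1)

/-- `realAltSum` is a normalized tail of the binomial expansion of `(1 - θ) ^ (r + j)`. -/
theorem choose_mul_realAltSum (θ : ℝ) (r j : ℕ) :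
    ((r + j).choose j : ℝ) * (-θ) ^ j * realAltSum θ r j =
      (1 - θ) ^ (r + j) - ∑ i ∈ Finset.range j, ((r + j).choose i : ℝ) * (-θ) ^ i := by
  have binomial (N : ℕ) :
      (1 - θ) ^ N = ∑ i ∈ Finset.range (N + 1), (N.choose i : ℝ) * (-θ) ^ i := by
    rw [sub_eq_neg_add, add_pow]
    exact Finset.sum_congr rfl fun i _ => by ring
  induction r generalizing j with
  | zero => rw [zero_add, binomial, Finset.sum_range_succ, realAltSum]; ring
  | succ r ih =>
    have h := ih (j + 1)
    rw [show r + (j + 1) = r + 1 + j by ring, Finset.sum_range_succ] at h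
    have hc : ((r + 1 + j).choose (j + 1) : ℝ) * (j + 1 : ℕ) =
        (r + 1 + j).choose j * (r + 1 : ℕ) := by
      have := Nat.choose_succ_right_eq (r + 1 + j) j
      rw [Nat.add_sub_cancel] at this
      exact_mod_cast this
    have hj : ((j + 1 : ℕ) : ℝ) ≠ 0 := by positivity
    rw [realAltSum]
    calc _ = ((r + 1 + j).choose j : ℝ) * (-θ) ^ j +
          ((r + 1 + j).choose j * (r + 1 : ℕ)) / (j + 1 : ℕ) * (-θ) ^ (j + 1) *
            realAltSum θ r (j + 1) := by ring
      _ = ((r + 1 + j).choose j : ℝ) * (-θ) ^ j +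
          (r + 1 + j).choose (j + 1) * (-θ) ^ (j + 1) * realAltSum θ r (j + 1) := by
          rw [← hc, mul_div_assoc, div_self hj, mul_one]
      _ = _ := by rw [h]; ring

theorem altSum_eq_ofReal {θ : ℝ} (hθ : 0 ≤ θ) (r j : ℕ) (hr : r * θ ≤ 1) :
    (0 ≤ realAltSum θ r j ∧ realAltSum θ r j ≤ 1) ∧
      altSum (ENNReal.ofReal θ) r j = ENNReal.ofReal (realAltSum θ r j) := by
  induction r generalizing j with
  | zero => simp [realAltSum, altSum]
  | succ r ih =>
    obtain ⟨⟨h0, h1⟩, h⟩ := ih (j + 1) (by push_cast at hr; linarith)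
    have hj : (1 : ℝ) ≤ (j + 1 : ℕ) := by push_cast; linarith [(Nat.cast_nonneg j : (0 : ℝ) ≤ j)]
    have hx0 : 0 ≤ ((r + 1 : ℕ) : ℝ) / (j + 1 : ℕ) * θ := by positivity
    have hx1 : ((r + 1 : ℕ) : ℝ) / (j + 1 : ℕ) * θ ≤ 1 := by
      rw [div_mul_eq_mul_div, div_le_one (by linarith)]
      exact hr.trans hj
    have hy0 := mul_nonneg hx0 h0
    have hy1 := mul_le_one₀ hx1 h0 h1
    refine ⟨⟨by rw [realAltSum]; linarith, by rw [realAltSum]; linarith⟩, ?_⟩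
    rw [altSum, realAltSum, h, ENNReal.ofReal_sub _ hy0, ENNReal.ofReal_mul hx0,
      ENNReal.ofReal_mul (by positivity), ENNReal.ofReal_div_of_pos (by positivity),
      ENNReal.ofReal_natCast, ENNReal.ofReal_natCast, ENNReal.ofReal_one]

theorem altSum_zero_right {θ : ℝ} (hθ : 0 ≤ θ) (r : ℕ) (hr : r * θ ≤ 1) :
    altSum (ENNReal.ofReal θ) r 0 = ENNReal.ofReal ((1 - θ) ^ r) := by
  rw [(altSum_eq_ofReal hθ r 0 hr).2]
  congr 1
  simpa using choose_mul_realAltSum θ r 0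

theorem one_sub_pow_mul_le_one {p : ℝ} (h0 : 0 ≤ p) (h1 : p ≤ 1) (n : ℕ) :
    (1 - p) ^ n * (1 + n * p) ≤ 1 := by
  calc (1 - p) ^ n * (1 + n * p) ≤ (1 - p) ^ n * (1 + p) ^ n := by
        refine mul_le_mul_of_nonneg_left ?_ (by apply pow_nonneg; linarith)
        exact one_add_mul_le_pow (by linarith) n
    _ = (1 - p ^ 2) ^ n := by rw [← mul_pow]; congr 1; ring
    _ ≤ 1 := pow_le_one₀ (by nlinarith) (by nlinarith [sq_nonneg p])

theorem sum_pow_mul (p : ℝ) (n : ℕ) :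
    p * ∑ r ∈ Finset.range n, (1 - p) ^ r = 1 - (1 - p) ^ n := by
  have := mul_neg_geom_sum (1 - p) n
  linarith

/-- The mass of `T-Geo(p, n)` at `r + 1`, without the restriction to `r < n`. -/
noncomputable def geoMass (p : ℝ) (n r : ℕ) : ℝ := p * (1 - p) ^ r / (1 - (1 - p) ^ n)

section GeoMass

variable {p : ℝ} {n : ℕ} {v : ℕ → ℝ≥0∞}

theorem one_sub_pow_pos (h0 : 0 < p) (h1 : p < 1) (hn : 1 ≤ n) : 0 < 1 - (1 - p) ^ n :=
  sub_pos.mpr (pow_lt_one₀ (by linarith) (by linarith) (by omega))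

theorem geoMass_nonneg (h0 : 0 < p) (h1 : p < 1) (hn : 1 ≤ n) (r : ℕ) : 0 ≤ geoMass p n r :=
  div_nonneg (mul_nonneg h0.le (pow_nonneg (by linarith) r)) (one_sub_pow_pos h0 h1 hn).le

theorem geoMass_add (p : ℝ) (n m r : ℕ) : (1 - p) ^ m * geoMass p n r = geoMass p n (m + r) := by
  rw [geoMass, geoMass, pow_add]
  ring

/-- The geometric distribution, reduced modulo `n`, is the truncated geometric distribution. -/
theorem geoMass_eq_add (h0 : 0 < p) (h1 : p < 1) (hn : 1 ≤ n) (r : ℕ) :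
    geoMass p n r = p * (1 - p) ^ r + geoMass p n (n + r) := by
  have h := (one_sub_pow_pos h0 h1 hn).ne'
  rw [geoMass, geoMass, pow_add]
  field_simp
  ring

theorem sum_geoMass (h0 : 0 < p) (h1 : p < 1) (hn : 1 ≤ n) :
    ∑ r ∈ Finset.range n, geoMass p n r = 1 := by
  simp only [geoMass]
  rw [← Finset.sum_div, ← Finset.mul_sum, sum_pow_mul, div_self (one_sub_pow_pos h0 h1 hn).ne']

theorem pow_eq_sum_mul_geoMass (h0 : 0 < p) (h1 : p < 1) (hn : 1 ≤ n) (r : ℕ) :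
    (1 - p) ^ r = (∑ i ∈ Finset.range n, (1 - p) ^ i) * geoMass p n r := by
  have h := (one_sub_pow_pos h0 h1 hn).ne'
  rw [geoMass, mul_div_assoc', eq_div_iff h, ← sum_pow_mul]
  ring

/-- The expectation of `v` at the output, if the rejection loop is entered with the base `β`. -/
noncomputable def meanValue (p : ℝ) (n : ℕ) (v : ℕ → ℝ≥0∞) (β : ℕ) : ℝ≥0∞ :=
  ∑ r ∈ Finset.range n, ENNReal.ofReal (geoMass p n r) * v ((β + r) % n + 1)

/-- Memorylessness: either one of the first `m` values is taken, or the base moves on by `m`. -/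
theorem meanValue_eq_add (h0 : 0 < p) (h1 : p < 1) {m : ℕ} (hmn : m < n) (β : ℕ) :
    meanValue p n v β =
      (∑ r ∈ Finset.range m, ENNReal.ofReal (p * (1 - p) ^ r) * v ((β + r) % n + 1)) +
        ENNReal.ofReal ((1 - p) ^ m) * meanValue p n v ((β + m) % n) := by
  have hn : 1 ≤ n := by omega
  have hq : 0 ≤ 1 - p := by linarith
  obtain ⟨l, hl⟩ := Nat.exists_eq_add_of_lt hmn
  have hnl : n = l + 1 + m := by omega
  have hshift : ENNReal.ofReal ((1 - p) ^ m) * meanValue p n v ((β + m) % n) =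
      ∑ r ∈ Finset.range n, ENNReal.ofReal (geoMass p n (m + r)) * v ((β + (m + r)) % n + 1) := by
    rw [meanValue, Finset.mul_sum]
    refine Finset.sum_congr rfl fun r _ => ?_
    rw [← mul_assoc, ← ENNReal.ofReal_mul (pow_nonneg hq m), geoMass_add, Nat.mod_add_mod,
      add_assoc]
  rw [hshift]
  have hsum₁ (f : ℕ → ℝ≥0∞) : ∑ r ∈ Finset.range n, f r =
      ∑ r ∈ Finset.range m, f r + ∑ r ∈ Finset.range (l + 1), f (m + r) := by
    rw [show n = m + (l + 1) by omega, Finset.sum_range_add]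
  have hsum₂ (f : ℕ → ℝ≥0∞) : ∑ r ∈ Finset.range n, f (m + r) =
      ∑ r ∈ Finset.range (l + 1), f (m + r) + ∑ r ∈ Finset.range m, f (n + r) := by
    conv_lhs => rw [hnl, Finset.sum_range_add]
    congr 1
    exact Finset.sum_congr rfl fun r _ => by congr 1; omega
  rw [meanValue, hsum₁,
    hsum₂ fun s => ENNReal.ofReal (geoMass p n s) * v ((β + s) % n + 1), add_left_comm, add_comm]
  congr 1
  rw [← Finset.sum_add_distrib]
  refine Finset.sum_congr rfl fun r _ => ?_
  have hmod : (β + (n + r)) % n = (β + r) % n := by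
    rw [show β + (n + r) = β + r + n by ring, Nat.add_mod_right]
  rw [hmod, ← add_mul, ← ENNReal.ofReal_add (mul_nonneg h0.le (pow_nonneg hq r))
    (geoMass_nonneg h0 h1 hn _), ← geoMass_eq_add h0 h1 hn]

end GeoMass

/-! ### Proposals are accepted with the right probabilities -/

section Proposal

variable {k d t : ℕ} {e : ℕ → ℕ} {p : ℝ} {v : ℕ → ℝ≥0∞}

theorem sum_proposalValue {N M : ℕ} (hNM : N ≤ M) (hN : ∀ r < M, r < e 5 ↔ r < N) {w : ℕ → ℝ}
    (hw : ∀ r < N, acceptProb e r = ENNReal.ofReal (w r)) (h0 : ∀ r < N, 0 ≤ w r)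
    (h1 : ∀ r < N, w r ≤ 1) (V : ℕ → ℝ≥0∞) (B : ℝ≥0∞) :
    ∑ r ∈ Finset.range M, proposalValue e r (V r) B =
      (∑ r ∈ Finset.range N, ENNReal.ofReal (w r) * V r) +
        ENNReal.ofReal (M - ∑ r ∈ Finset.range N, w r) * B := by
  obtain ⟨l, rfl⟩ := Nat.exists_eq_add_of_le hNM
  rw [Finset.sum_range_add]
  have hl : ∑ r ∈ Finset.range l, proposalValue e (N + r) (V (N + r)) B = ENNReal.ofReal l * B := by
    rw [ENNReal.ofReal_natCast, Finset.sum_congr rfl (g := fun _ => B), Finset.sum_const,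
      Finset.card_range, nsmul_eq_mul]
    intro r hr
    rw [Finset.mem_range] at hr
    rw [proposalValue, if_neg]
    rw [hN _ (by omega)]
    omega
  have hs : ∑ r ∈ Finset.range N, proposalValue e r (V r) B =
      (∑ r ∈ Finset.range N, ENNReal.ofReal (w r) * V r) +
        ENNReal.ofReal (∑ r ∈ Finset.range N, (1 - w r)) * B := by
    rw [ENNReal.ofReal_sum_of_nonneg, Finset.sum_mul, ← Finset.sum_add_distrib]
    · refine Finset.sum_congr rfl fun r hr => ?_
      rw [Finset.mem_range] at hr
      rw [proposalValue, if_pos ((hN r (by omega)).mpr hr), hw r hr, ENNReal.ofReal_sub _ (h0 r hr),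
        ENNReal.ofReal_one]
    · intro r hr
      linarith [h1 r (Finset.mem_range.mp hr)]
  have hnonneg : 0 ≤ ∑ r ∈ Finset.range N, (1 - w r) :=
    Finset.sum_nonneg fun r hr => by linarith [h1 r (Finset.mem_range.mp hr)]
  rw [hs, hl, add_assoc, ← add_mul, ← ENNReal.ofReal_add hnonneg (Nat.cast_nonneg l)]
  congr 3
  rw [Finset.sum_sub_distrib]
  simp
  ring

theorem theta_eq_ofReal {a b : ℕ} (h : Ready k d e) (h3 : e 3 = a) (h4 : e 4 = b)
    (h6 : e 6 = e 8 * e 7) : theta e = ENNReal.ofReal (a / b) := by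
  have h7 := h.pos₇
  have h8 := h.pos₈
  have hb : 0 < b := h4 ▸ h.pos₄
  rw [theta, h6, h3, h4, ← ENNReal.ofReal_natCast, ← ENNReal.ofReal_natCast b,
    ← ENNReal.ofReal_natCast a, ← ENNReal.ofReal_natCast (e 7), ← ENNReal.ofReal_natCast (e 8),
    ← ENNReal.ofReal_div_of_pos (by positivity), ← ENNReal.ofReal_div_of_pos (by positivity),
    ← ENNReal.ofReal_mul (by positivity), ← ENNReal.ofReal_div_of_pos (by positivity)]
  congr 1
  push_cast
  field_simp

theorem coinsProb_propFactors {a b : ℕ} (h : Ready k d e) (h3 : e 3 = a) (h4 : e 4 = b)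
    (h6 : e 6 = e 8 * e 7) :
    coinsProb e propFactors = ENNReal.ofReal (e 8 * (a / b)) := by
  have h8 : (e 8 : ℝ≥0∞) ≠ 0 := by exact_mod_cast h.pos₈.ne'
  rw [ENNReal.ofReal_mul (Nat.cast_nonneg _), ENNReal.ofReal_natCast,
    ← theta_eq_ofReal h h3 h4 h6, theta, ENNReal.mul_div_cancel h8 (by simp)]
  simp [propFactors, coinsProb]

end Proposal

end

section

section Rejection

variable {k d t : ℕ} {e : ℕ → ℕ} {a b : ℕ} {v : ℕ → ℝ≥0∞}

/-- What is known about the parameters of the rejection loop for the success probability `a / b`: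
the number `m`, which is the variable `8`, is of order `b / a`, and there are `m` different
proposals if `m < n`, and between `n` and `2 * n` otherwise. -/
structure Params (k d t : ℕ) (e : ℕ → ℕ) (a b : ℕ) : Prop extends LoopReady k d t e where
  pos : 0 < a
  lt : a < b
  eq₃ : e 3 = a
  eq₄ : e 4 = b
  eq₆ : e 6 = e 8 * e 7
  lt_mul : b < 4 * (e 8 * a)
  eq_pow : e 8 < e 5 → 2 ^ t = e 8
  pow_bounds : e 5 ≤ e 8 → e 5 ≤ 2 ^ t ∧ 2 ^ t ≤ 2 * e 5

theorem Params.prob_pos (h : Params k d t e a b) : (0 : ℝ) < a / b :=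
  div_pos (by exact_mod_cast h.pos) (by exact_mod_cast h.pos.trans h.lt)

theorem Params.prob_lt_one (h : Params k d t e a b) : (a / b : ℝ) < 1 := by
  rw [div_lt_one (by exact_mod_cast h.pos.trans h.lt)]
  exact_mod_cast h.lt

theorem Params.mul_prob_le_one (h : Params k d t e a b) {r : ℕ} (hr : r ≤ e 8) :
    r * (a / b : ℝ) ≤ 1 := by
  rw [mul_div_assoc', div_le_one (by exact_mod_cast h.pos.trans h.lt)]
  have h1 : r * a ≤ e 8 * e 7 := Nat.mul_le_mul hr (h.eq₃ ▸ h.le₃)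
  have h2 := h.le₆
  rw [h.eq₆, h.eq₄] at h2
  exact_mod_cast h1.trans h2

theorem Params.one_lt_mul_prob (h : Params k d t e a b) : 1 < 4 * (e 8 * (a / b : ℝ)) := by
  rw [mul_div_assoc', mul_div_assoc', one_lt_div (by exact_mod_cast h.pos.trans h.lt)]
  exact_mod_cast h.lt_mul

theorem Params.acceptProb_eq (h : Params k d t e a b) {r : ℕ} (hr : r ≤ e 8) :
    acceptProb e r = ENNReal.ofReal
      ((if e 8 < e 5 then e 8 * (a / b : ℝ) else 1) * (1 - a / b) ^ r) := by
  rw [acceptProb, theta_eq_ofReal h.toReady h.eq₃ h.eq₄ h.eq₆,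
    altSum_zero_right h.prob_pos.le r (h.mul_prob_le_one hr),
    coinsProb_propFactors h.toReady h.eq₃ h.eq₄ h.eq₆]
  have hp := h.prob_pos
  split_ifs
  · rw [← ENNReal.ofReal_mul (by positivity)]
  · rw [one_mul, one_mul]

/-- A round with few proposals, followed by a step of the base. -/
theorem Params.sum_of_lt (h : Params k d t e a b) (hmn : e 8 < e 5) (V : ℕ → ℝ≥0∞) (B : ℝ≥0∞) :
    ∑ r ∈ Finset.range (2 ^ t), proposalValue e r (V r) B =
      2 ^ t * ((∑ r ∈ Finset.range (e 8), ENNReal.ofReal (a / b * (1 - a / b) ^ r) * V r) +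
        ENNReal.ofReal ((1 - a / b) ^ e 8) * B) := by
  have hp := h.prob_pos
  have hq : (0 : ℝ) ≤ 1 - a / b := by linarith [h.prob_lt_one]
  have hm := h.mul_prob_le_one le_rfl
  rw [h.eq_pow hmn, sum_proposalValue (N := e 8) le_rfl (by intros; omega)
    (w := fun r => e 8 * (a / b : ℝ) * (1 - a / b) ^ r)]
  · rw [← Finset.mul_sum, mul_assoc, sum_pow_mul, ← Nat.cast_ofNat (R := ℝ≥0∞), ← Nat.cast_pow,
      h.eq_pow hmn, mul_add, Finset.mul_sum, ← mul_assoc]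
    congr 1
    · refine Finset.sum_congr rfl fun r _ => ?_
      rw [mul_assoc (e 8 : ℝ), ENNReal.ofReal_mul (by positivity), ENNReal.ofReal_natCast,
        mul_assoc]
    · rw [← ENNReal.ofReal_natCast (e 8), ← ENNReal.ofReal_mul (by positivity)]
      congr 2
      ring
  · intro r hr
    rw [h.acceptProb_eq hr.le, if_pos hmn]
  · intro r _
    exact mul_nonneg (by positivity) (pow_nonneg hq r)
  · intro r _
    exact mul_le_one₀ hm (pow_nonneg hq r) (pow_le_one₀ hq (by linarith))

/-- A round in which every value less than `n` is among the proposals. -/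
theorem Params.sum_of_le (h : Params k d t e a b) (hmn : e 5 ≤ e 8) (V : ℕ → ℝ≥0∞) (B : ℝ≥0∞) :
    ∑ r ∈ Finset.range (2 ^ t), proposalValue e r (V r) B =
      (∑ r ∈ Finset.range (e 5), ENNReal.ofReal ((1 - a / b) ^ r) * V r) +
        ENNReal.ofReal (2 ^ t - ∑ r ∈ Finset.range (e 5), (1 - a / b : ℝ) ^ r) * B := by
  have hp := h.prob_pos
  have hq : (0 : ℝ) ≤ 1 - a / b := by linarith [h.prob_lt_one]
  rw [sum_proposalValue (N := e 5) (h.pow_bounds hmn).1 (by intros; rfl)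
    (w := fun r => (1 - a / b : ℝ) ^ r)]
  · push_cast
    rfl
  · intro r hr
    rw [h.acceptProb_eq (by omega), if_neg (by omega), one_mul]
  · intro r _
    exact pow_nonneg hq r
  · intro r _
    exact pow_le_one₀ hq (by linarith)

theorem Params.sum_pow_le (h : Params k d t e a b) (hmn : e 5 ≤ e 8) :
    ∑ r ∈ Finset.range (e 5), (1 - a / b : ℝ) ^ r ≤ 2 ^ t := by
  have hp := h.prob_pos
  have hq : (0 : ℝ) ≤ 1 - a / b := by linarith [h.prob_lt_one]
  calc _ ≤ ∑ r ∈ Finset.range (e 5), (1 : ℝ) :=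
        Finset.sum_le_sum fun r _ => pow_le_one₀ hq (by linarith)
    _ = e 5 := by simp
    _ ≤ 2 ^ t := by exact_mod_cast (h.pow_bounds hmn).1

/-- A round preserves the expectation at the output. -/
theorem Params.round_value (h : Params k d t e a b) (β : ℕ) :
    ∑ r ∈ Finset.range (2 ^ t), proposalValue e r (v ((β + r) % e 5 + 1))
      (meanValue (a / b) (e 5) v (nextBase e β)) = 2 ^ t * meanValue (a / b) (e 5) v β := by
  rcases lt_or_ge (e 8) (e 5) with hmn | hmn
  · rw [h.sum_of_lt hmn, nextBase, if_pos hmn, ← meanValue_eq_add h.prob_pos h.prob_lt_one hmn]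
  · set S := ∑ r ∈ Finset.range (e 5), (1 - a / b : ℝ) ^ r with hS
    have hS0 : 0 ≤ S := Finset.sum_nonneg fun r _ => pow_nonneg (by linarith [h.prob_lt_one]) r
    have hS1 : S ≤ 2 ^ t := h.sum_pow_le hmn
    have hmean : ∑ r ∈ Finset.range (e 5), ENNReal.ofReal ((1 - a / b) ^ r) *
        v ((β + r) % e 5 + 1) = ENNReal.ofReal S * meanValue (a / b) (e 5) v β := by
      rw [meanValue, Finset.mul_sum]
      refine Finset.sum_congr rfl fun r _ => ?_
      rw [pow_eq_sum_mul_geoMass h.prob_pos h.prob_lt_one h.pos₅, ENNReal.ofReal_mul hS0, mul_assoc]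
    rw [h.sum_of_le hmn, nextBase, if_neg (by omega), hmean, ← add_mul,
      ← ENNReal.ofReal_add hS0 (by linarith), add_sub_cancel, ENNReal.ofReal_pow (by norm_num)]
    norm_num

/-- At least an eighth of the proposals is accepted. -/
theorem Params.round_time (h : Params k d t e a b) :
    8 * ∑ r ∈ Finset.range (2 ^ t), proposalValue e r 0 1 ≤ 7 * 2 ^ t := by
  have hp := h.prob_pos
  have hp1 := h.prob_lt_one
  rcases lt_or_ge (e 8) (e 5) with hmn | hmn
  · rw [h.sum_of_lt hmn (fun _ => 0)]
    simp only [mul_zero, Finset.sum_const_zero, zero_add, mul_one]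
    have hlt := h.one_lt_mul_prob
    have hpow := one_sub_pow_mul_le_one hp.le hp1.le (e 8)
    -- `q ^ m * (1 + m * p) ≤ 1` and `1 / 4 < m * p` give `q ^ m ≤ 4 / 5`.
    set x := (1 - a / b : ℝ) ^ e 8
    have hx : 0 ≤ x := pow_nonneg (by linarith) _
    have hx8 : 8 * x ≤ 7 := by nlinarith
    calc _ = 2 ^ t * (8 * ENNReal.ofReal x) := by ring
      _ ≤ 2 ^ t * 7 := by
        gcongr
        rw [← ENNReal.ofReal_ofNat 8, ← ENNReal.ofReal_ofNat 7, ← ENNReal.ofReal_mul (by norm_num)]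
        exact ENNReal.ofReal_le_ofReal hx8
      _ = _ := mul_comm _ _
  · rw [h.sum_of_le hmn (fun _ => 0)]
    simp only [mul_zero, Finset.sum_const_zero, zero_add, mul_one]
    set S := ∑ r ∈ Finset.range (e 5), (1 - a / b : ℝ) ^ r with hS
    have hnp := h.mul_prob_le_one hmn
    have hpow := one_sub_pow_mul_le_one hp.le hp1.le (e 5)
    have hsum : (a / b : ℝ) * S = 1 - (1 - a / b) ^ e 5 := sum_pow_mul _ _
    have hM : (2 : ℝ) ^ t ≤ 2 * e 5 := by exact_mod_cast (h.pow_bounds hmn).2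
    set y := (1 - a / b : ℝ) ^ e 5
    have hy : 0 ≤ y := pow_nonneg (by linarith) _
    have hx0 : (0 : ℝ) ≤ e 5 * (a / b) := by positivity
    -- `p * S = 1 - q ^ n ≥ n * p / (1 + n * p)`, and `n * p ≤ 1`.
    have hS2 : (e 5 : ℝ) ≤ 2 * S := by
      refine le_of_mul_le_mul_left ?_ hp
      nlinarith [mul_nonneg hx0 hy, mul_nonneg hx0 (sub_nonneg.mpr hnp)]
    have hle : 8 * (2 ^ t - S) ≤ 7 * 2 ^ t := by linarith
    calc _ = ENNReal.ofReal (8 * (2 ^ t - S)) := by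
          rw [ENNReal.ofReal_mul (by norm_num), ENNReal.ofReal_ofNat]
      _ ≤ ENNReal.ofReal (7 * 2 ^ t) := ENNReal.ofReal_le_ofReal hle
      _ = _ := by
        rw [ENNReal.ofReal_mul (by norm_num), ENNReal.ofReal_pow (by norm_num)]
        norm_num

end Rejection

/-! ### The program -/

/-- The program that samples from `T-Geo(p, n)`. -/
def sampler (k : ℕ) : Cmd :=
  .seq (input k) (.seq (.seq (setup k) (.loop (test k 14 2) (round k))) (output k 13))

/-- A bound for the expected time of `sampler`. -/
def samplerTime (k : ℕ) : ℕ :=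
  (input k).size + (setup k).size + 8 * roundTime k + (output k 13).size + 3

section Sampler

variable {k d a b n : ℕ} {τ : ℝ≥0∞}

theorem ebound_setup_loop (hd : 1 ≤ d) (ha : 0 < a) (hab : a < b) (hb : b < 2 ^ (k * d))
    (hn : 1 ≤ n) (hn' : n < 2 ^ (k * d)) (v : ℕ → ℝ≥0∞) :
    EBound k d τ (.seq (setup k) (.loop (test k 14 2) (round k))) (fun e => v (e 13))
      (inputEnv a b n) (τ * ((setup k).size + 8 * roundTime k + 1 : ℕ) +
        meanValue (a / b) n v 0) := by
  obtain ⟨f, t, hdet, hready, h3, h4, h5, h11, h14, h6, hlt, hpow, hpow'⟩ :=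
    det_setup hd ha hab hb hn hn'
  rw [← h5] at hpow hpow'
  have h : Params k d t f a b := ⟨hready, ha, hab, h3, h4, h6, hlt, hpow, hpow'⟩
  refine (EBound.seq_det hdet (ebound_mainLoop hd hready (by rw [h11]; exact hready.pos₅) h14
    (meanValue (a / b) (f 5) v) v (fun _ _ => le_rfl) (fun β _ => (h.round_value β).le)
    h.round_time)).le (le_of_eq ?_)
  rw [h11, h5]
  push_cast
  ring

/-- The expectation of `v` at a variable with the law `T-Geo(p, n)`. -/
theorem meanValue_zero (p : ℝ) (v : ℕ → ℝ≥0∞) :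
    meanValue p n v 0 = ∑ r ∈ Finset.range n, ENNReal.ofReal (geoMass p n r) * v (r + 1) := by
  refine Finset.sum_congr rfl fun r hr => ?_
  rw [zero_add, Nat.mod_eq_of_lt (Finset.mem_range.mp hr)]

theorem sum_ofReal_geoMass {p : ℝ} (h0 : 0 < p) (h1 : p < 1) (hn : 1 ≤ n) :
    ∑ r ∈ Finset.range n, ENNReal.ofReal (geoMass p n r) = 1 := by
  rw [← ENNReal.ofReal_sum_of_nonneg fun r _ => geoMass_nonneg h0 h1 hn r, sum_geoMass h0 h1 hn,
    ENNReal.ofReal_one]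

/-- The upper bound from which everything about `sampler` follows. -/
theorem cost_sampler_le (hd : 1 ≤ d) (ha : 0 < a) (hab : a < b) (hb : b < 2 ^ (k * d)) (hn : 1 ≤ n)
    (hn' : n < 2 ^ (k * d)) (v : ℕ → ℝ≥0∞) (t : ℕ) :
    cost τ (fun s => v (readNat s (List.range k))) t ((sampler k).start d k a b n) ≤
      τ * samplerTime k +
        ∑ r ∈ Finset.range n, ENNReal.ofReal (geoMass (a / b) n r) * v (r + 1) := by
  classical
  have hb0 : (0 : ℝ) < b := by exact_mod_cast ha.trans hab
  have hp : (0 : ℝ) < a / b := div_pos (by exact_mod_cast ha) hb0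
  have hp1 : (a / b : ℝ) < 1 := by rw [div_lt_one hb0]; exact_mod_cast hab
  -- The cost of the last command, which reads the result from the variable `13`.
  let V : ℕ → ℝ≥0∞ := fun i => τ * (output k 13).size + if i < 2 ^ (k * d) then v i else ∞
  have hV : meanValue (a / b) n V 0 = τ * (output k 13).size +
      ∑ r ∈ Finset.range n, ENNReal.ofReal (geoMass (a / b) n r) * v (r + 1) := by
    rw [meanValue_zero]
    calc _ = ∑ r ∈ Finset.range n, (ENNReal.ofReal (geoMass (a / b) n r) *
          (τ * (output k 13).size) + ENNReal.ofReal (geoMass (a / b) n r) * v (r + 1)) := by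
          refine Finset.sum_congr rfl fun r hr => ?_
          rw [Finset.mem_range] at hr
          simp only [V]
          rw [if_pos (by omega), mul_add]
      _ = _ := by
          rw [Finset.sum_add_distrib, ← Finset.sum_mul, sum_ofReal_geoMass hp hp1 hn, one_mul]
  have hout : ∀ s : ℕ → BitVec d, Bound τ (output k 13)
      (fun s => v (readNat s (List.range k))) s (V (env k s 13)) := by
    intro s
    by_cases h : env k s 13 < 2 ^ (k * d)
    · simp only [V]
      rw [if_pos h]
      refine (bound_det (output_simple _ _) _ s).mono (fun _ => le_rfl) ?_
      rw [readNat_output s h]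
    · simp only [V]
      rw [if_neg h, add_top]
      exact fun _ _ _ _ _ => le_top
  set X := τ * ((setup k).size + 8 * roundTime k + 1 : ℕ) + meanValue (a / b) n V 0 with hX
  have hrest : ∀ s : ℕ → BitVec d, Bound τ
      (.seq (.seq (setup k) (.loop (test k 14 2) (round k))) (output k 13))
      (fun s => v (readNat s (List.range k))) s
      (if env k s = inputEnv a b n then τ + X else ∞) := by
    intro s
    split_ifs with h
    · exact bound_seq (ebound_setup_loop hd ha hab hb hn hn' V s h) hout
    · exact fun _ _ _ _ _ => le_top
  have hall := bound_seq (bound_det (τ := τ) (input_simple k) _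
    ((sampler k).start d k a b n).regs) hrest
  refine (hall _ [] t _ fun t' _ r' m' => (cost_nil _ _ _ _ _).le).trans (le_of_eq ?_)
  rw [env_input hd (hab.trans hb) hb hn', if_pos rfl, hX, hV, samplerTime]
  push_cast
  ring

end Sampler

/-! ### Programs without memory access -/

/-- The program does not access memory. -/
def Cmd.NoMem : Cmd → Prop
  | .instr (.load _ _) => False
  | .instr (.store _ _) => False
  | .seq P Q => P.NoMem ∧ Q.NoMem
  | .ite _ P Q => P.NoMem ∧ Q.NoMem
  | .loop _ P => P.NoMem
  | _ => True

theorem Cmd.Simple.noMem {P : Cmd} (h : P.Simple) : P.NoMem := by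
  induction P with
  | skip => trivial
  | instr i => cases i <;> simp_all [Cmd.Simple, Cmd.NoMem]
  | seq P Q ihP ihQ => exact ⟨ihP h.1, ihQ h.2⟩
  | ite c P Q ihP ihQ => exact ⟨ihP h.1, ihQ h.2⟩
  | loop c P ih => exact h.elim

theorem noMem_of_mem_support_step {d : ℕ} {c c' : Config d} (h : ∀ P ∈ c.todo, P.NoMem)
    (hc : c' ∈ c.step.support) : ∀ P ∈ c'.todo, P.NoMem := by
  obtain ⟨todo, r, m⟩ := c
  match todo with
  | [] =>
    simp only [Config.step, PMF.support_pure, Set.mem_singleton_iff] at hc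
    simp [hc]
  | .skip :: K =>
    simp only [Config.step, PMF.support_pure, Set.mem_singleton_iff] at hc
    simp_all
  | .instr i :: K =>
    simp only [Config.step, PMF.support_map, Set.mem_image] at hc
    obtain ⟨s, -, rfl⟩ := hc
    simp_all
  | .seq P Q :: K =>
    simp only [Config.step, PMF.support_pure, Set.mem_singleton_iff] at hc
    simp_all [Cmd.NoMem]
  | .ite c P Q :: K =>
    simp only [Config.step, PMF.support_pure, Set.mem_singleton_iff] at hc
    subst hc
    split_ifs <;> simp_all [Cmd.NoMem]
  | .loop c P :: K =>
    simp only [Config.step, PMF.support_pure, Set.mem_singleton_iff] at hc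
    subst hc
    split_ifs <;> simp_all [Cmd.NoMem]

theorem noMem_of_mem_support_after {d : ℕ} (t : ℕ) {c c' : Config d} (h : ∀ P ∈ c.todo, P.NoMem)
    (hc : c' ∈ (c.after t).support) : ∀ P ∈ c'.todo, P.NoMem := by
  induction t generalizing c with
  | zero =>
    simp only [Config.after, PMF.support_pure, Set.mem_singleton_iff] at hc
    rwa [hc]
  | succ t ih =>
    simp only [Config.after, PMF.mem_support_bind_iff] at hc
    obtain ⟨c₁, hc₁, hc⟩ := hc
    exact ih (noMem_of_mem_support_step h hc₁) hc

theorem memorySpace_eq_zero {d : ℕ} {c : Config d} (h : ∀ P ∈ c.todo, P.NoMem) :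
    c.memorySpace = 0 := by
  rw [Config.memorySpace, ENat.iSup_eq_zero]
  intro t
  rw [ENat.iSup_eq_zero]
  intro c'
  rw [ENat.iSup_eq_zero]
  intro hc
  have h' := noMem_of_mem_support_after t h hc
  obtain ⟨todo, r, m⟩ := c'
  match todo with
  | [] => rfl
  | .instr i :: K =>
    have := h' (.instr i) (by simp)
    cases i <;> first | rfl | exact this.elim
  | .skip :: K => rfl
  | .seq P Q :: K => rfl
  | .ite c P Q :: K => rfl
  | .loop c P :: K => rfl

end

section

theorem sub_noMem (k z v w : ℕ) : (sub k z v w).NoMem := (sub_simple k z v w).noMem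

theorem randMask_noMem (k z w : ℕ) : (randMask k z w).NoMem := by
  refine ⟨?_, (and_simple k z w).noMem⟩
  induction k + 2 with
  | zero => trivial
  | succ n ih => exact ⟨ih, trivial⟩

theorem coins_noMem (k : ℕ) (l : List (ℕ × ℕ)) {Q : Cmd} (hQ : Q.NoMem) :
    (coins k l Q).NoMem := by
  induction l with
  | nil => exact hQ
  | cons q l ih =>
    simp [coins, coin, coinDigit, add, copy, Cmd.NoMem, sub_noMem, randMask_noMem, ih]

theorem powTrial_noMem (k : ℕ) : (powTrial k).NoMem := by
  have h : (powSucc k).NoMem := by simp [powSucc, copy, Cmd.NoMem, sub_noMem]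
  simp [powTrial, powCoin, accept, addMod, add, copy, Cmd.NoMem, sub_noMem, coins_noMem k _ h]

theorem setup_simple (k : ℕ) : (setup k).Simple := by
  simp [setup, powers, blockSize, proposalMask, add, copy, Cmd.Simple, topPow_simple, sub_simple,
    divPow_simple]

theorem sampler_noMem (k : ℕ) : (sampler k).NoMem := by
  have h := powTrial_noMem k
  simp [sampler, round, decideProposal, advance, addMod, add, copy, Cmd.NoMem,
    (input_simple k).noMem, (setup_simple k).noMem, (output_simple k 13).noMem, sub_noMem,
    randMask_noMem, coins_noMem k _ h, h]

/-! ### Upper bounds of total mass one are exact -/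

section Exact

variable {d k : ℕ} {c : Config d}

/-- The probability to halt within `t` steps with an output in the set `s`. -/
theorem cost_zero_eq (s : Set ℕ) [DecidablePred (· ∈ s)] (t : ℕ) :
    cost 0 (fun r => if readNat r (List.range k) ∈ s then 1 else 0) t c =
      (c.after t).toOuterMeasure {c' | c'.Halted ∧ readNat c'.regs (List.range k) ∈ s} := by
  classical
  rw [cost_eq, toOuterMeasure_eq_tsum]
  simp only [zero_mul, Finset.sum_const_zero, zero_add]
  refine tsum_congr fun c' => ?_
  congr 1
  simp only [Set.mem_ofPred_eq, Config.Halted]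
  split_ifs <;> simp_all

/-- If `μ` has total mass one and bounds the expected cost at the end for every cost function, then
it is the law of the output. -/
theorem outputProb_eq_of_cost_le {C : ℝ≥0∞} (hC : C ≠ ∞) {ι : Type*} (I : Finset ι) (μ : ι → ℝ≥0∞)
    (x : ι → ℕ) (hμ : ∑ j ∈ I, μ j = 1)
    (hcost : ∀ (τ : ℝ≥0∞) (v : ℕ → ℝ≥0∞) (t : ℕ),
      cost τ (fun s => v (readNat s (List.range k))) t c ≤ τ * C + ∑ j ∈ I, μ j * v (x j)) (i : ℕ) :
    c.outputProb k i = ∑ j ∈ I, μ j * if x j = i then 1 else 0 := by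
  classical
  have hle (s : Set ℕ) (t : ℕ) :
      (c.after t).toOuterMeasure {c' | c'.Halted ∧ readNat c'.regs (List.range k) ∈ s} ≤
        ∑ j ∈ I, μ j * if x j ∈ s then 1 else 0 := by
    rw [← cost_zero_eq]
    simpa using hcost 0 (fun j => if j ∈ s then 1 else 0) t
  set M := ∑ j ∈ I, μ j * if x j = i then 1 else 0 with hM
  set N := ∑ j ∈ I, μ j * if x j ∈ ({i}ᶜ : Set ℕ) then 1 else 0 with hN
  have hMN : M + N = 1 := by
    rw [hM, hN, ← Finset.sum_add_distrib]
    refine (Finset.sum_congr rfl fun j _ => ?_).trans hμ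
    by_cases h : x j = i <;> simp [h]
  have hNtop : N ≠ ∞ := ne_top_of_le_ne_top ENNReal.one_ne_top (hMN ▸ le_add_self)
  refine le_antisymm (iSup_le fun t => by simpa [hM] using hle {i} t) ?_
  have hlow (t : ℕ) : M ≤ c.outputProb k i + (c.after t).toOuterMeasure {c' | ¬ c'.Halted} := by
    refine ENNReal.le_of_add_le_add_right hNtop ?_
    rw [hMN]
    have htotal : (c.after t).toOuterMeasure Set.univ = 1 :=
      ((c.after t).toOuterMeasure_apply_eq_one_iff _).mpr (Set.subset_univ _)
    rw [← htotal]
    calc _ ≤ (c.after t).toOuterMeasure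
          (({c' | c'.Halted ∧ readNat c'.regs (List.range k) ∈ ({i} : Set ℕ)} ∪
            {c' | ¬ c'.Halted}) ∪
            {c' | c'.Halted ∧ readNat c'.regs (List.range k) ∈ ({i}ᶜ : Set ℕ)}) := by
          refine MeasureTheory.measure_mono fun c' _ => ?_
          simp only [Set.mem_union, Set.mem_ofPred_eq, Set.mem_singleton_iff, Set.mem_compl_iff]
          tauto
      _ ≤ _ := by
          refine (MeasureTheory.measure_union_le _ _).trans (add_le_add
            ((MeasureTheory.measure_union_le _ _).trans (add_le_add ?_ le_rfl))
            (by simpa [hN] using hle {i}ᶜ t))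
          exact le_iSup (fun t => (c.after t).toOuterMeasure
            {c' | c'.Halted ∧ readNat c'.regs (List.range k) = i}) t
  have hsum : ∑' t, (c.after t).toOuterMeasure {c' | ¬ c'.Halted} ≠ ∞ := by
    refine ne_top_of_le_ne_top hC (ENNReal.tsum_le_of_sum_range_le fun t => ?_)
    have h := hcost 1 0 t
    rw [cost_eq] at h
    simpa using h
  have hlim := ENNReal.tendsto_atTop_zero_of_tsum_ne_top hsum
  refine ge_of_tendsto' (f := fun t => c.outputProb k i +
    (c.after t).toOuterMeasure {c' | ¬ c'.Halted}) (x := Filter.atTop) ?_ hlow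
  simpa using tendsto_const_nhds.add hlim

theorem expectedTime_le_of_cost_le {C : ℝ≥0∞} (hcost : ∀ t, cost 1 (fun _ => 0) t c ≤ C) :
    c.expectedTime ≤ C := by
  refine ENNReal.tsum_le_of_sum_range_le fun t => ?_
  have h := hcost t
  rw [cost_eq] at h
  simpa using h

end Exact

theorem ofReal_truncGeoMass {p : ℝ} (n i : ℕ) :
    ENNReal.ofReal (truncGeoMass p n i) =
      ∑ r ∈ Finset.range n, ENNReal.ofReal (geoMass p n r) * if r + 1 = i then 1 else 0 := by
  rw [truncGeoMass]
  split_ifs with h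
  · rw [Finset.sum_eq_single (i - 1)]
    · rw [if_pos (by omega), mul_one, geoMass]
    · intro r _ hr
      rw [if_neg (by omega), mul_zero]
    · intro hr
      rw [Finset.mem_range] at hr
      omega
  · rw [ENNReal.ofReal_zero, Finset.sum_eq_zero]
    intro r hr
    rw [Finset.mem_range] at hr
    rw [if_neg (by omega), mul_zero]

end

end WordRAM

/-- For every number `k` of words there are a program and a constant such that, for every word
length `d ≥ 1`, every rational `p = a / b` in `(0, 1)` and every positive integer `n`, with `a`, `b`
and `n` of at most `k` words, the program generates `T-Geo(p, n)` exactly, in expected time at most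
the constant and in worst-case space (registers and memory cells) at most the constant times `n`. -/
theorem theorem3 (k : ℕ) :
    ∃ (P : WordRAM.Cmd) (C : ℕ), ∀ d : ℕ, 1 ≤ d → ∀ a b n : ℕ,
      0 < a → a < b → b < 2 ^ (k * d) → 1 ≤ n → n < 2 ^ (k * d) →
        (∀ i : ℕ, (P.start d k a b n).outputProb k i =
          ENNReal.ofReal (WordRAM.truncGeoMass ((a : ℝ) / (b : ℝ)) n i)) ∧
        (P.start d k a b n).expectedTime ≤ (C : ℝ≥0∞) ∧
        (P.registers.card : ℕ∞) + (P.start d k a b n).memorySpace ≤ (C : ℕ∞) * (n : ℕ∞) := by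
  refine ⟨WordRAM.sampler k, WordRAM.samplerTime k + (WordRAM.sampler k).registers.card, ?_⟩
  intro d hd a b n ha hab hb hn hn'
  have hb0 : (0 : ℝ) < b := by exact_mod_cast ha.trans hab
  have hp : (0 : ℝ) < a / b := div_pos (by exact_mod_cast ha) hb0
  have hp1 : (a / b : ℝ) < 1 := by rw [div_lt_one hb0]; exact_mod_cast hab
  have hcost (τ : ℝ≥0∞) (v : ℕ → ℝ≥0∞) (t : ℕ) :=
    WordRAM.cost_sampler_le (τ := τ) hd ha hab hb hn hn' v t
  refine ⟨fun i => ?_, ?_, ?_⟩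
  · rw [WordRAM.ofReal_truncGeoMass, WordRAM.outputProb_eq_of_cost_le (ENNReal.natCast_ne_top _)
      (Finset.range n) _ (fun r => r + 1) (WordRAM.sum_ofReal_geoMass hp hp1 hn) hcost]
  · refine (WordRAM.expectedTime_le_of_cost_le fun t => hcost 1 0 t).trans ?_
    simp
  · rw [WordRAM.memorySpace_eq_zero (by
      intro P hP
      rw [List.mem_singleton.mp hP]
      exact WordRAM.sampler_noMem k), add_zero]
    have h : (WordRAM.sampler k).registers.card ≤
        (WordRAM.samplerTime k + (WordRAM.sampler k).registers.card) * n := by nlinarith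
    exact_mod_cast h
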